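/- **Setting.** Let $h:\mathbb R\to[0,\infty)$ be twice continuously differentiable and $1$-periodic with $\int_0^1 h(x)\,dx=1$, and let $\theta_1,\theta_2,\dots$ be i.i.d. random variables in $[0,1]$ with density $h$. For $c>0$ and $x\in(-\tfrac12,\tfrac12]$ let $$\gamma(x)=\frac{\operatorname{sign}(x)}{\pi}\tan^{-1}\!\left(\sqrt{e^{c}\tan^2(\pi x)+e^{c}-1}\right)\qquad(\gamma(\tfrac12)=\tfrac12),$$ extended to $\mathbb R$ by $\gamma(x+k)=\gamma(x)+k$ for $k\in\mathbb Z$; this is the change of angle under the inverse of the conformal map attaching a slit of capacity $c$ to the unit disk at $1$. The harmonic measure flow of the anisotropic Hastings–Levitov cluster is $$X_0(x)=x,\qquad X_n(x)=\gamma\big(X_{n-1}(x)-\theta_n\big)+\theta_n .$$ Let $$b(x)=\frac1{2\pi}\int_0^1\cot(\pi z)\,\big(h(x-z)-h(x)\big)\,dz ,$$ and let $\psi_t(x)$, $t\in\mathbb R$, be the flow of $\dot\psi_t(x)=b(\psi_t(x))$, $\psi_0(x)=x$. Let $a_u$ be an unstable fixed point, i.e. $b(a_u)=0$ and $\lambda_u:=b'(a_u)>0$,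 and assume $h(a_u)>0$. Let $x_-<a_u<x_+$ be such that $\lambda_u/2\le b'(x)\le 3\lambda_u/2$ for all $x\in[x_-,x_+]$. For $t_0>0$ and $c>0$ put $k_0=\lfloor t_0/c\rfloor$, $$I(t_1,t_2)=\int_{t_1}^{t_2}b'\big(\psi_{s-t_0}(X_{k_0}(a_u))\big)\,ds,\qquad T_1=\inf\{t\ge t_0:\ \psi_{t-t_0}(X_{k_0}(a_u))\notin[x_-,x_+]\},$$ $$T_1^*=\min\Big(T_1,\ \inf\{t\ge t_0:\ e^{I(0,t)}>c^{-1/4}e^{I(0,t_0)/8}\},\ c^{-1/2}\Big),$$ with $\inf\emptyset=+\infty$. **Theorem.** We have $$\lim_{t_0\to\infty}\lim_{c\to0}\mathbb P\big(T_1^*=T_1\big)=1 .$$ Moreover, for every $\epsilon>0$ there is a constant $\widetilde T_\epsilon>0$, not depending on $c$ or $t_0$, such that $$\lim_{t_0\to\infty}\lim_{c\to0}\mathbb P\left(\left|T_1^*-\frac1{4\lambda_u}\log(c^{-1})\right|>\widetilde T_\epsilon\right)<\epsilon .$$ Here $c\to0$ through positive values, and both statements include that the limits exist (the limit in $c$ for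 all sufficiently large $t_0$). -/

import Mathlib

open MeasureTheory ProbabilityTheory Filter Topology

namespace AHL

noncomputable section

/-- The angular slit map on the fundamental domain `(-1/2, 1/2]`:
`γ(x) = sign(x) / π * arctan √(e^c tan²(π x) + e^c - 1)`.
At `x = 1/2`, where `tan (π x)` is infinite, the value is `1/2` (the point `1/2` is fixed). -/
def slitAngleBase (c x : ℝ) : ℝ :=
  if x = 1 / 2 then 1 / 2
  else SignType.sign x / Real.pi *
    Real.arctan (Real.sqrt (Real.exp c * Real.tan (Real.pi * x) ^ 2 + Real.exp c - 1))

/-- `γ` on the real line: for `x = k + a` with `k ∈ ℤ` and `a ∈ (-1/2, 1/2]`,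
`γ(x) = k + γ(a)`; here `k = ⌈x - 1/2⌉`. -/
def slitAngle (c x : ℝ) : ℝ :=
  (⌈x - 1 / 2⌉ : ℝ) + slitAngleBase c (x - ⌈x - 1 / 2⌉)

/-- The discrete harmonic measure flow `X_n(x)` for capacity `c` and attachment angles `θ`:
`X_0(x) = x` and `X_n(x) = γ(X_{n-1}(x) - θ_n) + θ_n`. The angle of the particle attached at
step `n + 1` is `θ n`. -/
def harmonicFlow (c : ℝ) (θ : ℕ → ℝ) (x : ℝ) : ℕ → ℝ
  | 0 => x
  | n + 1 => slitAngle c (harmonicFlow c θ x n - θ n) + θ n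

/-- The law `ν` of an attachment angle: the measure on `[0,1]` with density `h`. -/
def angleLaw (h : ℝ → ℝ) : Measure ℝ :=
  (volume.restrict (Set.Icc 0 1)).withDensity (fun x => ENNReal.ofReal (h x))

/-- The drift `b`: the Hilbert transform of the density `h`,
`b(x) = (1 / 2π) ∫_0^1 cot(π z) (h(x - z) - h(x)) dz`. -/
def drift (h : ℝ → ℝ) (x : ℝ) : ℝ :=
  1 / (2 * Real.pi) * ∫ z in (0 : ℝ)..1, Real.cot (Real.pi * z) * (h (x - z) - h x)

/-- The flow `ψ_t(x)` of the ordinary differential equation `dψ_t(x)/dt = b(ψ_t(x))`,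
`ψ_0(x) = x`, for all real times `t`: the value at time `t` of the solution through `x`.
For `t < 0` this is the inverse flow, `ψ_t = (ψ_{-t})⁻¹`. -/
def odeFlow (b : ℝ → ℝ) (t x : ℝ) : ℝ :=
  Classical.epsilon (fun f : ℝ → ℝ => f 0 = x ∧ ∀ s, HasDerivAt f (b (f s)) s) t

/-- The trajectory `t ↦ ψ_{t - t₀}(X_{k₀}(a))`, where `k₀ = n(t₀) = ⌊t₀ / c⌋`. -/
def restartedPath (h : ℝ → ℝ) (a t₀ c : ℝ) (θ : ℕ → ℝ) (t : ℝ) : ℝ :=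
  odeFlow (drift h) (t - t₀) (harmonicFlow c θ a ⌊t₀ / c⌋₊)

/-- `I(t₁, t₂) = ∫_{t₁}^{t₂} b'(ψ_{s - t₀}(X_{k₀}(a))) ds`. -/
def growthIntegral (h : ℝ → ℝ) (a t₀ c : ℝ) (θ : ℕ → ℝ) (t₁ t₂ : ℝ) : ℝ :=
  ∫ s in t₁..t₂, deriv (drift h) (restartedPath h a t₀ c θ s)

/-- `T₁ = inf {t ≥ t₀ : ψ_{t - t₀}(X_{k₀}(a)) ∉ [x₋, x₊]}`, with `inf ∅ = +∞`. -/
def exitTime (h : ℝ → ℝ) (a xm xp t₀ c : ℝ) (θ : ℕ → ℝ) : EReal :=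
  sInf ((fun t : ℝ => (t : EReal)) ''
    {t : ℝ | t₀ ≤ t ∧ restartedPath h a t₀ c θ t ∉ Set.Icc xm xp})

/-- `inf {t ≥ t₀ : e^{I(0,t)} > c^{-1/4} e^{I(0,t₀)/8}}`, with `inf ∅ = +∞`. -/
def growthTime (h : ℝ → ℝ) (a t₀ c : ℝ) (θ : ℕ → ℝ) : EReal :=
  sInf ((fun t : ℝ => (t : EReal)) ''
    {t : ℝ | t₀ ≤ t ∧ c ^ (-(1 / 4) : ℝ) * Real.exp (growthIntegral h a t₀ c θ 0 t₀ / 8) <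
      Real.exp (growthIntegral h a t₀ c θ 0 t)})

/-- `T₁* = min (T₁, inf {t ≥ t₀ : e^{I(0,t)} > c^{-1/4} e^{I(0,t₀)/8}}, c^{-1/2})`. -/
def cappedTime (h : ℝ → ℝ) (a xm xp t₀ c : ℝ) (θ : ℕ → ℝ) : EReal :=
  min (exitTime h a xm xp t₀ c θ)
    (min (growthTime h a t₀ c θ) ((c ^ (-(1 / 2) : ℝ) : ℝ) : EReal))

/-- `T₁*` is always a finite real number, so that passing to its real value loses nothing. -/
theorem coe_toReal_cappedTime (h : ℝ → ℝ) (a xm xp t₀ c : ℝ) (θ : ℕ → ℝ) :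
    ((cappedTime h a xm xp t₀ c θ).toReal : EReal) = cappedTime h a xm xp t₀ c θ := by
  have hle : ∀ S : Set ℝ, (∀ t ∈ S, t₀ ≤ t) →
      (t₀ : EReal) ≤ sInf ((fun t : ℝ => (t : EReal)) '' S) := by
    intro S hS
    refine le_sInf ?_
    rintro _ ⟨t, ht, rfl⟩
    exact EReal.coe_le_coe_iff.2 (hS t ht)
  have h1 : (t₀ : EReal) ≤ exitTime h a xm xp t₀ c θ := hle _ (fun t ht => ht.1)
  have h2 : (t₀ : EReal) ≤ growthTime h a t₀ c θ := hle _ (fun t ht => ht.1)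
  refine EReal.coe_toReal (ne_of_lt ?_) (ne_of_gt ?_)
  · exact lt_of_le_of_lt ((min_le_right _ _).trans (min_le_right _ _)) (EReal.coe_lt_top _)
  · exact lt_min (lt_of_lt_of_le (EReal.bot_lt_coe _) h1)
      (lt_min (lt_of_lt_of_le (EReal.bot_lt_coe _) h2) (EReal.bot_lt_coe _))

/-- The iterated limit `lim_{t₀ → ∞} lim_{c → 0+} p t₀ c` exists and equals `l`
(the inner limit being required to exist for all sufficiently large `t₀`). -/
def HasIteratedLimit (p : ℝ → ℝ → ℝ) (l : ℝ) : Prop :=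
  ∃ L : ℝ → ℝ, (∀ᶠ t₀ in atTop, Tendsto (fun c => p t₀ c) (𝓝[>] 0) (𝓝 (L t₀))) ∧
    Tendsto L atTop (𝓝 l)

end

end AHL

namespace AHL

theorem cot_pi_mul_nonneg {z : ℝ} (hz : z ∈ Set.Ioc (0 : ℝ) (1 / 2)) :
    0 ≤ Real.cot (Real.pi * z) := by
  have hp := Real.pi_pos
  rw [Real.cot_eq_cos_div_sin]
  refine div_nonneg (Real.cos_nonneg_of_neg_pi_div_two_le_of_le ?_ ?_)
    (Real.sin_nonneg_of_nonneg_of_le_pi ?_ ?_) <;> nlinarith [hz.1, hz.2]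

theorem cot_pi_mul_le {z : ℝ} (hz : z ∈ Set.Ioc (0 : ℝ) (1 / 2)) :
    Real.cot (Real.pi * z) ≤ 1 / (Real.pi * z) := by
  have hp := Real.pi_pos
  have hpz : 0 < Real.pi * z := mul_pos hp hz.1
  rcases eq_or_lt_of_le hz.2 with h | h
  · rw [Real.cot_eq_cos_div_sin, h, show Real.pi * (1 / 2) = Real.pi / 2 by ring,
      Real.cos_pi_div_two, zero_div]
    positivity
  · have h1 : Real.pi * z < Real.pi / 2 := by nlinarith
    have h2 := Real.lt_tan hpz h1
    rw [← Real.cot_inv_eq_tan, ← one_div] at h2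
    have hc : 0 < Real.cot (Real.pi * z) := by
      by_contra hcon
      have := one_div_nonpos.2 (not_lt.1 hcon)
      linarith
    rw [le_div_iff₀ hpz]
    rw [lt_div_iff₀ hc] at h2
    linarith

theorem measurable_cot_pi_mul : Measurable fun z : ℝ => Real.cot (Real.pi * z) := by
  have : (fun z : ℝ => Real.cot (Real.pi * z)) =
      fun z => Real.cos (Real.pi * z) / Real.sin (Real.pi * z) :=
    funext fun z => Real.cot_eq_cos_div_sin _
  rw [this]
  fun_prop

theorem cot_pi_mul_one_sub (z : ℝ) :
    Real.cot (Real.pi * (1 - z)) = -Real.cot (Real.pi * z) := by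
  rw [Real.cot_eq_cos_div_sin, Real.cot_eq_cos_div_sin, mul_sub, mul_one, Real.cos_pi_sub,
    Real.sin_pi_sub, neg_div]

/-- Folding an integral over `[0, 1]` onto `[0, 1/2]`. -/
theorem integral_fold {F : ℝ → ℝ} (h₁ : IntervalIntegrable F volume 0 (1 / 2))
    (h₂ : IntervalIntegrable (fun z => F (1 - z)) volume 0 (1 / 2)) :
    ∫ z in (0 : ℝ)..1, F z = ∫ z in (0 : ℝ)..(1 / 2), (F z + F (1 - z)) := by
  have h₃ : IntervalIntegrable F volume (1 / 2) 1 := by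
    have := h₂.comp_sub_left 1 (by simp)
    simp only [sub_sub_cancel] at this
    norm_num at this
    simpa using this.symm
  rw [← intervalIntegral.integral_add_adjacent_intervals h₁ h₃, intervalIntegral.integral_add h₁ h₂,
    intervalIntegral.integral_comp_sub_left F 1]
  norm_num

/-- A measurable function bounded on `(a, b]` by an integrable one is interval integrable. -/
theorem intervalIntegrable_of_le {F G : ℝ → ℝ} {a b : ℝ} (hab : a ≤ b) (hF : Measurable F)
    (hG : IntervalIntegrable G volume a b) (hle : ∀ z ∈ Set.Ioc a b, |F z| ≤ G z) :
    IntervalIntegrable F volume a b := by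
  refine hG.mono_fun' hF.aestronglyMeasurable ?_
  rw [Set.uIoc_of_le hab]
  exact (ae_restrict_iff' measurableSet_Ioc).2 (ae_of_all _ hle)

theorem abs_integral_le_of_le {F G : ℝ → ℝ} {a b : ℝ} (hab : a ≤ b)
    (hG : IntervalIntegrable G volume a b) (hle : ∀ z ∈ Set.Ioc a b, |F z| ≤ G z) :
    |∫ z in a..b, F z| ≤ ∫ z in a..b, G z :=
  intervalIntegral.norm_integral_le_of_norm_le (f := F) hab (ae_of_all _ hle) hG

theorem abs_sub_add_le {f : ℝ → ℝ} {K : ℝ} (hf : ∀ x y, |f x - f y| ≤ K * |x - y|) (x : ℝ) {z : ℝ}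
    (hz : 0 < z) : |f (x - z) - f (x + z)| ≤ K * (2 * z) := by
  refine (hf _ _).trans (le_of_eq ?_)
  rw [show x - z - (x + z) = -(2 * z) by ring, abs_neg, abs_of_pos (by linarith)]

theorem abs_cot_mul_sub_add_le {f : ℝ → ℝ} {K : ℝ} (hf : ∀ x y, |f x - f y| ≤ K * |x - y|) (x : ℝ)
    {z : ℝ} (hz : z ∈ Set.Ioc (0 : ℝ) (1 / 2)) :
    |Real.cot (Real.pi * z) * (f (x - z) - f (x + z))| ≤ 2 * K / Real.pi := by
  have hp := Real.pi_pos
  have hz0 := hz.1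
  rw [abs_mul, abs_of_nonneg (cot_pi_mul_nonneg hz)]
  calc Real.cot (Real.pi * z) * |f (x - z) - f (x + z)| ≤ 1 / (Real.pi * z) * (K * (2 * z)) :=
        mul_le_mul (cot_pi_mul_le hz) (abs_sub_add_le hf x hz0) (abs_nonneg _) (by positivity)
    _ = 2 * K / Real.pi := by field_simp

/-- Integral form of the drift after symmetrization. -/
theorem drift_eq_fold {f : ℝ → ℝ} {K : ℝ} (hf : ∀ x y, |f x - f y| ≤ K * |x - y|)
    (hfm : Measurable f) (hper : Function.Periodic f 1) (x : ℝ) :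
    drift f x = 1 / (2 * Real.pi) *
      ∫ z in (0 : ℝ)..(1 / 2), Real.cot (Real.pi * z) * (f (x - z) - f (x + z)) := by
  have hcm := measurable_cot_pi_mul
  have hbound : ∀ z ∈ Set.Ioc (0 : ℝ) (1 / 2), ∀ d : ℝ, |d| ≤ K * z →
      |Real.cot (Real.pi * z) * d| ≤ K / Real.pi := by
    intro z hz d hd
    rw [abs_mul, abs_of_nonneg (cot_pi_mul_nonneg hz)]
    calc Real.cot (Real.pi * z) * |d| ≤ 1 / (Real.pi * z) * (K * z) := by
          have := Real.pi_pos
          exact mul_le_mul (cot_pi_mul_le hz) hd (abs_nonneg _) (by have := hz.1; positivity)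
      _ = K / Real.pi := by
          have := hz.1
          have := Real.pi_pos
          field_simp
  have hflip : ∀ z, f (x - (1 - z)) = f (x + z) := fun z => by
    rw [← hper (x - (1 - z))]; ring_nf
  unfold drift
  rw [integral_fold]
  · congr 1
    refine intervalIntegral.integral_congr fun z _ => ?_
    simp only [cot_pi_mul_one_sub, hflip]
    ring
  · refine intervalIntegrable_of_le (by norm_num) (by fun_prop)
      (intervalIntegrable_const (c := K / Real.pi)) fun z hz => hbound z hz _ ?_
    have := hf (x - z) x
    rwa [sub_sub_cancel_left, abs_neg, abs_of_pos hz.1] at this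
  · refine intervalIntegrable_of_le (by norm_num) ?_
      (intervalIntegrable_const (c := K / Real.pi)) fun z hz => ?_
    · exact (hcm.comp (measurable_const.sub measurable_id)).mul (by fun_prop)
    · simp only [cot_pi_mul_one_sub, hflip, neg_mul, abs_neg]
      refine hbound z hz _ ?_
      have := hf (x + z) x
      rwa [add_sub_cancel_left, abs_of_pos hz.1] at this

theorem abs_drift_le {f : ℝ → ℝ} {K : ℝ} (hf : ∀ x y, |f x - f y| ≤ K * |x - y|)
    (hfm : Measurable f) (hper : Function.Periodic f 1) (x : ℝ) : |drift f x| ≤ K := by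
  have hp := Real.pi_pos
  have hK : 0 ≤ K := by simpa using (abs_nonneg _).trans (hf 1 0)
  rw [drift_eq_fold hf hfm hper, abs_mul, abs_of_pos (by positivity)]
  have : |∫ z in (0 : ℝ)..(1 / 2), Real.cot (Real.pi * z) * (f (x - z) - f (x + z))| ≤
      ∫ z in (0 : ℝ)..(1 / 2), 2 * K / Real.pi :=
    abs_integral_le_of_le (by norm_num) (by simp) fun z hz => abs_cot_mul_sub_add_le hf x hz
  rw [intervalIntegral.integral_const] at this
  have hpi := Real.pi_gt_three
  calc _ ≤ 1 / (2 * Real.pi) * ((1 / 2 - 0) • (2 * K / Real.pi)) :=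
        mul_le_mul_of_nonneg_left this (by positivity)
    _ = K * (1 / (2 * Real.pi * Real.pi)) := by rw [smul_eq_mul]; field_simp; ring
    _ ≤ K * 1 := by
        gcongr
        rw [div_le_one (by positivity)]
        nlinarith
    _ = K := mul_one K

theorem drift_holder {f : ℝ → ℝ} {K : ℝ} (hf : ∀ x y, |f x - f y| ≤ K * |x - y|)
    (hfm : Measurable f) (hper : Function.Periodic f 1) (x y : ℝ) :
    |drift f x - drift f y| ≤ 2 * K * Real.sqrt |x - y| := by
  have hp := Real.pi_pos
  have hpi := Real.pi_gt_three
  have hK : 0 ≤ K := by simpa using (abs_nonneg _).trans (hf 1 0)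
  have hcm := measurable_cot_pi_mul
  have hint : ∀ x, IntervalIntegrable
      (fun z => Real.cot (Real.pi * z) * (f (x - z) - f (x + z))) volume 0 (1 / 2) := by
    intro x
    exact intervalIntegrable_of_le (by norm_num) (by fun_prop)
      (intervalIntegrable_const (c := 2 * K / Real.pi)) fun z hz => abs_cot_mul_sub_add_le hf x hz
  rw [drift_eq_fold hf hfm hper, drift_eq_fold hf hfm hper, ← mul_sub,
    ← intervalIntegral.integral_sub (hint x) (hint y), abs_mul, abs_of_pos (by positivity)]
  have hG : IntervalIntegrable (fun z : ℝ => (3 * K / Real.pi * Real.sqrt |x - y|) *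
      z ^ (-(1 / 2) : ℝ)) volume 0 (1 / 2) :=
    (intervalIntegral.intervalIntegrable_rpow' (by norm_num)).const_mul _
  have key := abs_integral_le_of_le (F := fun z => Real.cot (Real.pi * z) * (f (x - z) - f (x + z)) -
    Real.cot (Real.pi * z) * (f (y - z) - f (y + z))) (by norm_num) hG ?_
  · rw [intervalIntegral.integral_const_mul, integral_rpow (by norm_num)] at key
    have h2 : ((1 / 2 : ℝ) ^ (-(1 / 2) + 1 : ℝ) - 0 ^ (-(1 / 2) + 1 : ℝ)) / (-(1 / 2) + 1) ≤ 2 := by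
      have : (1 / 2 : ℝ) ^ (-(1 / 2) + 1 : ℝ) ≤ 1 :=
        Real.rpow_le_one (by norm_num) (by norm_num) (by norm_num)
      rw [Real.zero_rpow (by norm_num), div_le_iff₀ (by norm_num)]
      linarith
    calc _ ≤ 1 / (2 * Real.pi) * (3 * K / Real.pi * Real.sqrt |x - y| * 2) := by
          gcongr
          exact key.trans (by gcongr)
      _ = K * Real.sqrt |x - y| * (3 / (Real.pi * Real.pi)) := by field_simp
      _ ≤ K * Real.sqrt |x - y| * 2 := by
          gcongr
          rw [div_le_iff₀ (by positivity)]
          nlinarith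
      _ = 2 * K * Real.sqrt |x - y| := by ring
  · intro z hz
    have hz0 := hz.1
    rw [← mul_sub, abs_mul, abs_of_nonneg (cot_pi_mul_nonneg hz)]
    set D := f (x - z) - f (x + z) - (f (y - z) - f (y + z)) with hD
    have h1 : |D| ≤ 4 * K * z := by
      have e1 := abs_sub_add_le hf x hz0
      have e2 := abs_sub_add_le hf y hz0
      have := abs_sub (f (x - z) - f (x + z)) (f (y - z) - f (y + z))
      linarith
    have h2 : |D| ≤ 2 * K * |x - y| := by
      have e1 := hf (x - z) (y - z)
      have e2 := hf (x + z) (y + z)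
      rw [show x - z - (y - z) = x - y by ring] at e1
      rw [show x + z - (y + z) = x - y by ring] at e2
      have := abs_sub (f (x - z) - f (y - z)) (f (x + z) - f (y + z))
      rw [hD, show f (x - z) - f (x + z) - (f (y - z) - f (y + z)) =
        f (x - z) - f (y - z) - (f (x + z) - f (y + z)) by ring]
      linarith
    have h3 : |D| ≤ 3 * K * (Real.sqrt z * Real.sqrt |x - y|) := by
      refine le_of_sq_le_sq ?_ (by positivity)
      rw [mul_pow, mul_pow, mul_pow, Real.sq_sqrt hz0.le, Real.sq_sqrt (abs_nonneg _)]
      have := mul_le_mul h1 h2 (abs_nonneg _) (by positivity)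
      have h5 : 0 ≤ K * K * (z * |x - y|) := by positivity
      nlinarith
    calc Real.cot (Real.pi * z) * |D| ≤ 1 / (Real.pi * z) * (3 * K * (Real.sqrt z * Real.sqrt |x - y|)) :=
          mul_le_mul (cot_pi_mul_le hz) h3 (abs_nonneg _) (by positivity)
      _ = 3 * K / Real.pi * Real.sqrt |x - y| * z ^ (-(1 / 2) : ℝ) := by
          rw [Real.rpow_neg hz0.le, ← Real.sqrt_eq_rpow]
          have hs : 0 < Real.sqrt z := Real.sqrt_pos.2 hz0
          field_simp
          rw [Real.sq_sqrt hz0.le]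
          ring

/-- Differentiation under the integral: the derivative of the drift of `f` is the drift of `f'`. -/
theorem hasDerivAt_drift {f f' : ℝ → ℝ} {K K' : ℝ} (hf : ∀ x y, |f x - f y| ≤ K * |x - y|)
    (hf' : ∀ x y, |f' x - f' y| ≤ K' * |x - y|) (hfm : Measurable f) (hfm' : Measurable f')
    (hper : Function.Periodic f 1) (hper' : Function.Periodic f' 1)
    (hd : ∀ x, HasDerivAt f (f' x) x) (x : ℝ) : HasDerivAt (drift f) (drift f' x) x := by
  have hp := Real.pi_pos
  have hcm := measurable_cot_pi_mul
  have h0 : (0 : ℝ) ≤ 1 / 2 := by norm_num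
  have key := (intervalIntegral.hasDerivAt_integral_of_dominated_loc_of_deriv_le
    (𝕜 := ℝ) (μ := volume) (a := 0) (b := 1 / 2) (x₀ := x) (s := Set.univ)
    (F := fun x z => Real.cot (Real.pi * z) * (f (x - z) - f (x + z)))
    (F' := fun x z => Real.cot (Real.pi * z) * (f' (x - z) - f' (x + z)))
    (bound := fun _ => 2 * K' / Real.pi) univ_mem
    (Eventually.of_forall fun y => (by fun_prop : Measurable _).aestronglyMeasurable)
    (intervalIntegrable_of_le h0 (by fun_prop) intervalIntegrable_const
      fun z hz => abs_cot_mul_sub_add_le hf x hz)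
    (by fun_prop : Measurable _).aestronglyMeasurable
    (ae_of_all _ fun z hz y _ => abs_cot_mul_sub_add_le hf' y (by rwa [Set.uIoc_of_le h0] at hz))
    intervalIntegrable_const
    (ae_of_all _ fun z _ y _ => ?_)).2
  · have e : drift f = fun x => 1 / (2 * Real.pi) *
        ∫ z in (0 : ℝ)..(1 / 2), Real.cot (Real.pi * z) * (f (x - z) - f (x + z)) :=
      funext (drift_eq_fold hf hfm hper)
    rw [e, drift_eq_fold hf' hfm' hper']
    exact key.const_mul _
  · refine HasDerivAt.const_mul _ (HasDerivAt.sub ?_ ?_)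
    · exact (hd (y - z)).comp_sub_const y z
    · exact (hd (y + z)).comp_add_const y z

theorem exists_lipschitz_of_periodic {f : ℝ → ℝ} (hf : ContDiff ℝ 1 f)
    (hper : Function.Periodic f 1) : ∃ K, ∀ x y, |f x - f y| ≤ K * |x - y| := by
  have hc : Continuous (deriv f) := hf.continuous_deriv le_rfl
  have hp : Function.Periodic (deriv f) 1 := fun x => by
    have : (fun y => f (y + 1)) = f := funext hper
    rw [← deriv_comp_add_const, this]
  obtain ⟨K, hK⟩ := (hp.isBounded_of_continuous one_ne_zero hc).exists_norm_le
  refine ⟨K, fun x y => ?_⟩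
  exact Convex.norm_image_sub_le_of_norm_deriv_le (s := Set.univ)
    (fun z _ => (hf.differentiable one_ne_zero) z) (fun z _ => hK _ ⟨z, rfl⟩) convex_univ
    trivial trivial

/-- The regularity of the drift of a periodic `C²` density used below. -/
structure RegularDrift (b : ℝ → ℝ) (L : ℝ) : Prop where
  differentiable : Differentiable ℝ b
  bound : ∀ x, |b x| ≤ L
  deriv_bound : ∀ x, |deriv b x| ≤ L
  deriv_holder : ∀ x y, |deriv b x - deriv b y| ≤ L * Real.sqrt |x - y|

theorem regularDrift_drift {h : ℝ → ℝ} (hs : ContDiff ℝ 2 h) (hper : Function.Periodic h 1) :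
    ∃ L, 0 < L ∧ RegularDrift (drift h) L := by
  obtain ⟨K, hK⟩ := exists_lipschitz_of_periodic (hs.of_le (by norm_num)) hper
  have hp' : Function.Periodic (deriv h) 1 := fun x => by
    have : (fun y => h (y + 1)) = h := funext hper
    rw [← deriv_comp_add_const, this]
  have hs' : ContDiff ℝ 1 (deriv h) := by
    have : ContDiff ℝ (1 + 1) h := by norm_num; exact hs
    exact (contDiff_succ_iff_deriv.1 this).2.2
  obtain ⟨K', hK'⟩ := exists_lipschitz_of_periodic hs' hp'
  have h0 : 0 ≤ K := by simpa using (abs_nonneg _).trans (hK 1 0)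
  have h0' : 0 ≤ K' := by simpa using (abs_nonneg _).trans (hK' 1 0)
  have hd : ∀ x, HasDerivAt (drift h) (drift (deriv h) x) x :=
    hasDerivAt_drift hK hK' hs.continuous.measurable hs'.continuous.measurable hper hp'
      fun x => ((hs.differentiable (by norm_num)) x).hasDerivAt
  refine ⟨K + 2 * K' + 1, by positivity, fun x => (hd x).differentiableAt, fun x => ?_, fun x => ?_,
    fun x y => ?_⟩
  · have := abs_drift_le hK hs.continuous.measurable hper x
    linarith
  · rw [(hd x).deriv]
    have := abs_drift_le hK' hs'.continuous.measurable hp' x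
    linarith
  · rw [(hd x).deriv, (hd y).deriv]
    refine (drift_holder hK' hs'.continuous.measurable hp' x y).trans ?_
    gcongr
    linarith

namespace RegularDrift

variable {b : ℝ → ℝ} {L : ℝ}

theorem abs_sub_le (hb : RegularDrift b L) (x y : ℝ) : |b x - b y| ≤ L * |x - y| :=
  Convex.norm_image_sub_le_of_norm_deriv_le (s := Set.univ)
    (fun z _ => hb.differentiable z) (fun z _ => hb.deriv_bound z) convex_univ trivial trivial

theorem continuous_deriv (hb : RegularDrift b L) : Continuous (deriv b) := by
  rw [continuous_iff_continuousAt]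
  intro x
  rw [ContinuousAt, tendsto_iff_norm_sub_tendsto_zero]
  have h : Tendsto (fun y : ℝ => L * Real.sqrt |y - x|) (𝓝 x) (𝓝 (L * Real.sqrt |x - x|)) :=
    Continuous.tendsto (by fun_prop) x
  simp only [sub_self, abs_zero, Real.sqrt_zero, mul_zero] at h
  exact squeeze_zero (fun _ => norm_nonneg _) (fun y => hb.deriv_holder y x) h

/-- Linearization of the drift at a point. -/
theorem abs_sub_linear_le (hb : RegularDrift b L) (a x : ℝ) :
    |b x - b a - deriv b a * (x - a)| ≤ L * Real.sqrt |x - a| * |x - a| := by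
  have h := Convex.norm_image_sub_le_of_norm_deriv_le (𝕜 := ℝ) (s := Set.uIcc a x)
    (f := fun y => b y - deriv b a * y) (C := L * Real.sqrt |x - a|) (x := a) (y := x)
    (fun z _ => (hb.differentiable z).sub (differentiableAt_id.const_mul _)) (fun z hz => ?_)
    (convex_uIcc a x) Set.left_mem_uIcc Set.right_mem_uIcc
  · simp only [Real.norm_eq_abs] at h
    rwa [show b x - deriv b a * x - (b a - deriv b a * a) = b x - b a - deriv b a * (x - a) by ring]
      at h
  · have hd : deriv (fun y => b y - deriv b a * y) z = deriv b z - deriv b a := by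
      have h1 := ((hb.differentiable z).hasDerivAt).sub ((hasDerivAt_id z).const_mul (deriv b a))
      simp only [mul_one] at h1
      exact h1.deriv
    rw [hd]
    refine (hb.deriv_holder z a).trans ?_
    have hL : 0 ≤ L := (abs_nonneg _).trans (hb.bound 0)
    exact mul_le_mul_of_nonneg_left (Real.sqrt_le_sqrt (Set.abs_sub_left_of_mem_uIcc hz)) hL

end RegularDrift

/-- The displacement `γ(u) - u` of the slit map. -/
noncomputable def slitShift (c u : ℝ) : ℝ := slitAngle c u - u

theorem slitShift_periodic (c : ℝ) : Function.Periodic (slitShift c) 1 := fun x => by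
  unfold slitShift slitAngle
  rw [show x + 1 - 1 / 2 = x - 1 / 2 + (1 : ℤ) by push_cast; ring, Int.ceil_add_intCast]
  push_cast
  rw [add_sub_add_right_eq_sub]
  ring

theorem slitShift_eq_base {c x : ℝ} (h₁ : -(1 / 2) < x) (h₂ : x ≤ 1 / 2) :
    slitShift c x = slitAngleBase c x - x := by
  have : ⌈x - 1 / 2⌉ = 0 := by
    rw [Int.ceil_eq_iff]
    constructor <;> push_cast <;> linarith
  unfold slitShift slitAngle
  rw [this]
  simp

theorem slitShift_half (c : ℝ) : slitShift c (1 / 2) = 0 := by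
  rw [slitShift_eq_base (by norm_num) le_rfl, slitAngleBase, if_pos rfl, sub_self]

theorem slitShift_one_sub {c z : ℝ} (hz : z ∈ Set.Ioc (0 : ℝ) (1 / 2)) :
    slitShift c (1 - z) = -slitShift c z := by
  obtain ⟨h0, h1⟩ := hz
  rcases eq_or_lt_of_le h1 with rfl | h1
  · norm_num [slitShift_half c]
  · rw [show (1 : ℝ) - z = -z + 1 by ring, slitShift_periodic c (-z),
      slitShift_eq_base (by linarith) (by linarith), slitShift_eq_base (by linarith) h1.le,
      slitAngleBase, slitAngleBase, if_neg (by linarith), if_neg h1.ne, sign_neg (by linarith),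
      sign_pos h0, mul_neg, Real.tan_neg, neg_sq]
    push_cast
    ring

theorem measurable_slitAngle (c : ℝ) : Measurable (slitAngle c) := by
  have h1 : Measurable (slitAngleBase c) := by
    unfold slitAngleBase
    refine Measurable.ite (measurableSet_singleton _) measurable_const ?_
    have hs : Measurable fun x : ℝ => ((SignType.sign x : SignType) : ℝ) := by
      have : (fun x : ℝ => ((SignType.sign x : SignType) : ℝ)) =
          fun x => if 0 < x then (1 : ℝ) else if x < 0 then -1 else 0 := by
        ext x
        rw [sign_apply]
        split_ifs <;> simp
      rw [this]
      exact Measurable.ite measurableSet_Ioi measurable_const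
        (Measurable.ite measurableSet_Iio measurable_const measurable_const)
    have ht : Measurable Real.tan := by
      have : Real.tan = fun x => Real.sin x / Real.cos x := funext Real.tan_eq_sin_div_cos
      rw [this]
      fun_prop
    have ha : Measurable Real.arctan := Real.continuous_arctan.measurable
    exact (hs.div_const _).mul (ha.comp (Real.continuous_sqrt.measurable.comp
      (((measurable_const.mul ((ht.comp (measurable_const.mul measurable_id)).pow_const 2)).add
        measurable_const).sub measurable_const)))
  have h2 : Measurable fun x : ℝ => ((⌈x - 1 / 2⌉ : ℤ) : ℝ) :=
    (measurable_from_top (f := fun n : ℤ => (n : ℝ))).comp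
      (Int.measurable_ceil.comp (measurable_id.sub_const _))
  exact h2.add (h1.comp (measurable_id.sub h2))

theorem measurable_slitShift (c : ℝ) : Measurable (slitShift c) :=
  (measurable_slitAngle c).sub measurable_id

theorem exists_angle_of_slitShift {c z : ℝ} (hc : 0 < c) (h0 : 0 < z) (h1 : z < 1 / 2) :
    ∃ g, Real.pi * slitShift c z = g - Real.pi * z ∧ 0 < g ∧ g < Real.pi / 2 ∧
      Real.cos g = Real.exp (-(c / 2)) * Real.cos (Real.pi * z) := by
  have hp := Real.pi_pos
  have hx : Real.pi * z < Real.pi / 2 := by nlinarith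
  have hcx : 0 < Real.cos (Real.pi * z) :=
    Real.cos_pos_of_mem_Ioo ⟨by nlinarith [mul_pos hp h0], hx⟩
  have he : 1 < Real.exp c := Real.one_lt_exp_iff.2 hc
  have hpos : 0 < Real.exp c * Real.tan (Real.pi * z) ^ 2 + Real.exp c - 1 := by
    have : 0 ≤ Real.exp c * Real.tan (Real.pi * z) ^ 2 := by positivity
    linarith
  refine ⟨Real.arctan (Real.sqrt (Real.exp c * Real.tan (Real.pi * z) ^ 2 + Real.exp c - 1)), ?_,
    Real.arctan_pos.2 (Real.sqrt_pos.2 hpos), Real.arctan_lt_pi_div_two _, ?_⟩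
  · rw [slitShift_eq_base (by linarith) h1.le, slitAngleBase, if_neg h1.ne, sign_pos h0]
    rw [SignType.coe_one]
    field_simp
  · rw [Real.cos_arctan, Real.sq_sqrt hpos.le]
    have : 1 + (Real.exp c * Real.tan (Real.pi * z) ^ 2 + Real.exp c - 1) =
        (Real.exp (c / 2) / Real.cos (Real.pi * z)) ^ 2 := by
      have h3 : Real.exp c = Real.exp (c / 2) ^ 2 := by rw [← Real.exp_nat_mul]; ring_nf
      rw [Real.tan_eq_sin_div_cos, h3]
      field_simp
      have := Real.sin_sq_add_cos_sq (Real.pi * z)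
      rw [this]
      ring
    rw [this, Real.sqrt_sq (by positivity), one_div_div, Real.exp_neg]
    field_simp

theorem slitShift_bounds {c z : ℝ} (hc : 0 < c) (hz : z ∈ Set.Ioc (0 : ℝ) (1 / 2)) :
    0 ≤ slitShift c z ∧ slitShift c z ≤ Real.sqrt c / 2 ∧
      slitShift c z ≤ c / (2 * Real.pi) * Real.cot (Real.pi * z) ∧
      c / (2 * Real.pi) * Real.cot (Real.pi * z) - slitShift c z ≤
        c / 2 * slitShift c z / (4 * z ^ 2) := by
  have hp := Real.pi_pos
  obtain ⟨h0, h1⟩ := hz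
  rcases eq_or_lt_of_le h1 with rfl | h1
  · have : Real.cot (Real.pi * (1 / 2)) = 0 := by
      rw [Real.cot_eq_cos_div_sin, show Real.pi * (1 / 2) = Real.pi / 2 by ring,
        Real.cos_pi_div_two, zero_div]
    rw [this, slitShift_half]
    simp only [mul_zero, sub_zero, zero_div, le_refl, and_self, and_true, true_and]
    positivity
  obtain ⟨g, hg, hg0, hg1, hcg⟩ := exists_angle_of_slitShift hc h0 h1
  set x := Real.pi * z with hx
  set δ := slitShift c z
  have hx0 : 0 < x := mul_pos hp h0
  have hx1 : x < Real.pi / 2 := by rw [hx]; nlinarith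
  have hcx : 0 < Real.cos x := Real.cos_pos_of_mem_Ioo ⟨by linarith, hx1⟩
  have hcg0 : 0 < Real.cos g := Real.cos_pos_of_mem_Ioo ⟨by linarith, hg1⟩
  have hsx : 0 < Real.sin x := Real.sin_pos_of_pos_of_lt_pi hx0 (by linarith)
  have hsg : 0 < Real.sin g := Real.sin_pos_of_pos_of_lt_pi hg0 (by linarith)
  have hlt : Real.cos g < Real.cos x := by
    rw [hcg]
    have : Real.exp (-(c / 2)) < 1 := by rw [← Real.exp_zero]; exact Real.exp_lt_exp.2 (by linarith)
    nlinarith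
  have hxg : x < g := by
    by_contra hcon
    exact absurd (Real.cos_le_cos_of_nonneg_of_le_pi hg0.le (by linarith) (not_lt.1 hcon))
      (not_le.2 hlt)
  have hd : 0 < g - x := by linarith
  have hlog : Real.log (Real.cos x) - Real.log (Real.cos g) = c / 2 := by
    rw [hcg, Real.log_mul (Real.exp_ne_zero _) hcx.ne', Real.log_exp]
    ring
  obtain ⟨ξ, hξ, hξe⟩ := exists_hasDerivAt_eq_slope (fun y => Real.log (Real.cos y))
    (fun y => -Real.sin y / Real.cos y) hxg
    (fun y hy => by
      have : 0 < Real.cos y := Real.cos_pos_of_mem_Ioo ⟨by linarith [hy.1], by linarith [hy.2]⟩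
      exact ((Real.hasDerivAt_cos y).log this.ne').continuousAt.continuousWithinAt)
    (fun y hy => by
      have : 0 < Real.cos y := Real.cos_pos_of_mem_Ioo ⟨by linarith [hy.1], by linarith [hy.2]⟩
      exact (Real.hasDerivAt_cos y).log this.ne')
  have hξt : Real.tan ξ * (g - x) = c / 2 := by
    rw [← hlog, Real.tan_eq_sin_div_cos]
    rw [eq_div_iff hd.ne'] at hξe
    rw [neg_div] at hξe
    linarith
  have hcotx : Real.cot x = 1 / Real.tan x := by rw [← Real.cot_inv_eq_tan, one_div, inv_inv]
  have hcotg : Real.cot g = 1 / Real.tan g := by rw [← Real.cot_inv_eq_tan, one_div, inv_inv]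
  have htx : 0 < Real.tan x := Real.tan_pos_of_pos_of_lt_pi_div_two hx0 hx1
  have htg : 0 < Real.tan g := Real.tan_pos_of_pos_of_lt_pi_div_two hg0 hg1
  have ht1 : Real.tan x * (g - x) ≤ c / 2 := by
    rw [← hξt]
    refine mul_le_mul_of_nonneg_right ?_ hd.le
    exact (Real.tan_lt_tan_of_lt_of_lt_pi_div_two (by linarith) (by linarith [hξ.2]) hξ.1).le
  have ht2 : c / 2 ≤ Real.tan g * (g - x) := by
    rw [← hξt]
    refine mul_le_mul_of_nonneg_right ?_ hd.le
    exact (Real.tan_lt_tan_of_lt_of_lt_pi_div_two (by linarith [hξ.1]) (by linarith) hξ.2).le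
  have hup : Real.pi * δ ≤ c / 2 * Real.cot x := by
    rw [hg, hcotx, mul_one_div, le_div_iff₀ htx]
    linarith
  refine ⟨?_, ?_, ?_, ?_⟩
  · have : 0 ≤ Real.pi * δ := by rw [hg]; exact hd.le
    exact nonneg_of_mul_nonneg_right this hp
  · have h2 : 2 * ((g - x) / Real.pi) ^ 2 ≤ c / 2 := by
      have e1 : Real.cos x - Real.cos g = 2 * Real.sin ((x + g) / 2) * Real.sin ((g - x) / 2) := by
        rw [Real.cos_sub_cos, show (x - g) / 2 = -((g - x) / 2) by ring, Real.sin_neg]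
        ring
      have e2 : (g - x) / Real.pi ≤ Real.sin ((g - x) / 2) := by
        have := Real.mul_le_sin (x := (g - x) / 2) (by linarith) (by linarith)
        refine le_trans (le_of_eq ?_) this
        field_simp
      have e3 : Real.sin ((g - x) / 2) ≤ Real.sin ((x + g) / 2) :=
        Real.sin_le_sin_of_le_of_le_pi_div_two (by linarith) (by linarith) (by linarith)
      have e4 : Real.cos x - Real.cos g ≤ c / 2 := by
        rw [hcg]
        have := Real.add_one_le_exp (-(c / 2))
        have := Real.cos_le_one x
        nlinarith
      have e5 : 0 ≤ (g - x) / Real.pi := by positivity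
      nlinarith
    have h3 : δ = (g - x) / Real.pi := by rw [← hg]; field_simp
    rw [← h3] at h2
    refine le_of_sq_le_sq ?_ (by positivity)
    rw [div_pow, Real.sq_sqrt hc.le]
    linarith
  · have : δ ≤ c / 2 * Real.cot x / Real.pi := by rw [le_div_iff₀ hp]; linarith
    refine this.trans (le_of_eq ?_)
    field_simp
  · have e1 : c / 2 * Real.cot g ≤ g - x := by
      rw [hcotg, mul_one_div, div_le_iff₀ htg]
      linarith
    have e2 : Real.cot x - Real.cot g ≤ (g - x) / Real.sin x ^ 2 := by
      have : Real.cot x - Real.cot g = Real.sin (g - x) / (Real.sin x * Real.sin g) := by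
        rw [Real.cot_eq_cos_div_sin, Real.cot_eq_cos_div_sin, Real.sin_sub]
        field_simp
      rw [this]
      have hs1 : Real.sin x ≤ Real.sin g :=
        Real.sin_le_sin_of_le_of_le_pi_div_two (by linarith) hg1.le hxg.le
      have hs2 : Real.sin (g - x) ≤ g - x := Real.sin_le hd.le
      rw [sq]
      gcongr
    have e3 : 2 * z ≤ Real.sin x := by
      have := Real.mul_le_sin (x := x) hx0.le hx1.le
      refine le_trans (le_of_eq ?_) this
      rw [hx]
      field_simp
    have e4 : (g - x) / Real.sin x ^ 2 ≤ (g - x) / (4 * z ^ 2) := by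
      have : 4 * z ^ 2 ≤ Real.sin x ^ 2 := by nlinarith
      gcongr
    rw [← hg] at e4 e1
    have e5 : c / 2 * Real.cot x - Real.pi * δ ≤ c / 2 * (Real.pi * δ / (4 * z ^ 2)) := by
      have : c / 2 * (Real.cot x - Real.cot g) ≤ c / 2 * (Real.pi * δ / (4 * z ^ 2)) := by
        gcongr
        rw [hg]
        rw [hg] at e4
        exact e2.trans e4
      linarith
    have e6 : c / (2 * Real.pi) * Real.cot x - δ = (c / 2 * Real.cot x - Real.pi * δ) / Real.pi := by
      field_simp
    rw [e6, div_le_iff₀ hp]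
    refine e5.trans (le_of_eq ?_)
    ring

theorem abs_slitShift_le {c : ℝ} (hc : 0 < c) (u : ℝ) : |slitShift c u| ≤ Real.sqrt c / 2 := by
  obtain ⟨y, hy, hyu⟩ := (slitShift_periodic c).exists_mem_Ioc one_pos u 0
  rw [zero_add] at hy
  rw [hyu]
  rcases le_or_gt y (1 / 2) with h | h
  · obtain ⟨h1, h2, -⟩ := slitShift_bounds hc ⟨hy.1, h⟩
    rwa [abs_of_nonneg h1]
  · rcases eq_or_lt_of_le hy.2 with rfl | h1
    · rw [← zero_add (1 : ℝ), slitShift_periodic c 0, slitShift_eq_base (by norm_num) (by norm_num)]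
      simp only [slitAngleBase, sign_zero]
      norm_num
      positivity
    · have hz : 1 - y ∈ Set.Ioc (0 : ℝ) (1 / 2) := ⟨by linarith, by linarith⟩
      have := slitShift_one_sub (c := c) hz
      rw [sub_sub_cancel] at this
      obtain ⟨h1, h2, -⟩ := slitShift_bounds hc hz
      rw [this, abs_neg, abs_of_nonneg h1]
      exact h2

/-- Quantitative comparison of the displacement with its linearization in the capacity. -/
theorem abs_slitShift_sub_cot_le {c z : ℝ} (hc : 0 < c) (hz : z ∈ Set.Ioc (0 : ℝ) (1 / 2)) :
    |slitShift c z - c / (2 * Real.pi) * Real.cot (Real.pi * z)| ≤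
      c * (c ^ (3 / 8 : ℝ) * z ^ (-(7 / 4) : ℝ)) := by
  have hz0 := hz.1
  have hp := Real.pi_pos
  have hpi := Real.pi_gt_three
  obtain ⟨h1, -, h3, h4⟩ := slitShift_bounds hc hz
  have hcot := cot_pi_mul_le hz
  have hb : c / (2 * Real.pi) * Real.cot (Real.pi * z) ≤ c / z := by
    calc c / (2 * Real.pi) * Real.cot (Real.pi * z) ≤ c / (2 * Real.pi) * (1 / (Real.pi * z)) := by
          gcongr
      _ = c / z * (1 / (2 * Real.pi * Real.pi)) := by field_simp
      _ ≤ c / z * 1 := by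
          gcongr
          rw [div_le_one (by positivity)]
          nlinarith
      _ = c / z := mul_one _
  have hA : |slitShift c z - c / (2 * Real.pi) * Real.cot (Real.pi * z)| ≤ c / z := by
    rw [abs_sub_comm, abs_of_nonneg (by linarith)]
    linarith
  have hB : |slitShift c z - c / (2 * Real.pi) * Real.cot (Real.pi * z)| ≤ c / z * (c / z ^ 2) := by
    rw [abs_sub_comm, abs_of_nonneg (by linarith)]
    refine h4.trans ?_
    calc c / 2 * slitShift c z / (4 * z ^ 2) ≤ c / 2 * (c / z) / (4 * z ^ 2) := by
          gcongr
          linarith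
      _ = c / z * (c / z ^ 2) * (1 / 8) := by field_simp; ring
      _ ≤ c / z * (c / z ^ 2) := by
          have : 0 ≤ c / z * (c / z ^ 2) := by positivity
          linarith
  have hq : 0 < c / z ^ 2 := by positivity
  have hC : |slitShift c z - c / (2 * Real.pi) * Real.cot (Real.pi * z)| ≤
      c / z * (c / z ^ 2) ^ (3 / 8 : ℝ) := by
    rcases le_total 1 (c / z ^ 2) with h | h
    · refine hA.trans (le_mul_of_one_le_right (by positivity) (Real.one_le_rpow h (by norm_num)))
    · refine hB.trans (mul_le_mul_of_nonneg_left ?_ (by positivity))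
      calc c / z ^ 2 = (c / z ^ 2) ^ (1 : ℝ) := (Real.rpow_one _).symm
        _ ≤ _ := Real.rpow_le_rpow_of_exponent_ge hq h (by norm_num)
  refine hC.trans (le_of_eq ?_)
  rw [Real.div_rpow hc.le (by positivity), ← Real.rpow_natCast z 2, ← Real.rpow_mul hz0.le,
    show (-(7 / 4) : ℝ) = -(1 + (2 : ℕ) * (3 / 8)) by norm_num, Real.rpow_neg hz0.le,
    Real.rpow_add hz0, Real.rpow_one]
  field_simp

theorem slitShift_le_div {c z : ℝ} (hc : 0 < c) (hz : z ∈ Set.Ioc (0 : ℝ) (1 / 2)) :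
    slitShift c z ≤ c / z := by
  have hp := Real.pi_pos
  have hpi := Real.pi_gt_three
  have hz0 := hz.1
  refine (slitShift_bounds hc hz).2.2.1.trans ?_
  calc c / (2 * Real.pi) * Real.cot (Real.pi * z) ≤ c / (2 * Real.pi) * (1 / (Real.pi * z)) := by
        gcongr
        exact cot_pi_mul_le hz
    _ = c / z * (1 / (2 * Real.pi * Real.pi)) := by field_simp
    _ ≤ c / z * 1 := by
        gcongr
        rw [div_le_one (by positivity)]
        nlinarith
    _ = c / z := mul_one _

theorem tendsto_slitShift_scaled {w : ℝ} (hw : 0 < w) :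
    Tendsto (fun c => slitShift c (Real.sqrt c * w) / Real.sqrt c) (𝓝[>] 0)
      (𝓝 (Real.sqrt (w ^ 2 + 1 / Real.pi ^ 2) - w)) := by
  have hp := Real.pi_pos
  set s : ℝ → ℝ := fun c => Real.sqrt c with hs
  have hs0 : Tendsto s (𝓝[>] 0) (𝓝 0) := by
    have : Tendsto s (𝓝 0) (𝓝 (Real.sqrt 0)) := Real.continuous_sqrt.tendsto 0
    rw [Real.sqrt_zero] at this
    exact this.mono_left nhdsWithin_le_nhds
  have hc0 : Tendsto (fun c : ℝ => c) (𝓝[>] 0) (𝓝 0) := nhdsWithin_le_nhds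
  have hT : Tendsto (fun c => dslope Real.tan 0 (Real.pi * (s c * w))) (𝓝[>] 0) (𝓝 1) := by
    have h1 : HasDerivAt Real.tan 1 0 := by
      have := Real.hasDerivAt_tan (x := 0) (by simp)
      simpa using this
    have h2 : Tendsto (dslope Real.tan 0) (𝓝 0) (𝓝 1) := by
      have := (continuousAt_dslope_same.2 h1.differentiableAt).tendsto
      rwa [dslope_same, h1.deriv] at this
    refine h2.comp ?_
    have := (hs0.mul_const w).const_mul Real.pi
    simpa using this
  have hE : Tendsto (fun c => dslope Real.exp 0 c) (𝓝[>] 0) (𝓝 1) := by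
    have h1 : HasDerivAt Real.exp 1 0 := by simpa using Real.hasDerivAt_exp 0
    have := (continuousAt_dslope_same.2 h1.differentiableAt).tendsto
    rw [dslope_same, h1.deriv] at this
    exact this.comp hc0
  set v : ℝ → ℝ := fun c => Real.sqrt (Real.exp c *
    (Real.pi * w * dslope Real.tan 0 (Real.pi * (s c * w))) ^ 2 + dslope Real.exp 0 c) with hv
  have hV : Tendsto v (𝓝[>] 0) (𝓝 (Real.sqrt (1 * (Real.pi * w * 1) ^ 2 + 1))) := by
    refine (Real.continuous_sqrt.tendsto _).comp (Tendsto.add (Tendsto.mul ?_ ?_) hE)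
    · have := (Real.continuous_exp.tendsto 0).comp hc0
      rw [Real.exp_zero] at this
      exact this
    · exact (hT.const_mul _).pow 2
  have hA : Tendsto (fun c => dslope Real.arctan 0 (s c * v c)) (𝓝[>] 0) (𝓝 1) := by
    have h1 : HasDerivAt Real.arctan 1 0 := by simpa using Real.hasDerivAt_arctan 0
    have h2 : Tendsto (dslope Real.arctan 0) (𝓝 0) (𝓝 1) := by
      have := (continuousAt_dslope_same.2 h1.differentiableAt).tendsto
      rwa [dslope_same, h1.deriv] at this
    refine h2.comp ?_
    have := hs0.mul hV
    simpa using this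
  have hfin : Tendsto (fun c => 1 / Real.pi * (v c * dslope Real.arctan 0 (s c * v c)) - w)
      (𝓝[>] 0) (𝓝 (1 / Real.pi * (Real.sqrt (1 * (Real.pi * w * 1) ^ 2 + 1) * 1) - w)) :=
    ((hV.mul hA).const_mul _).sub_const _
  have hlim : 1 / Real.pi * (Real.sqrt (1 * (Real.pi * w * 1) ^ 2 + 1) * 1) - w =
      Real.sqrt (w ^ 2 + 1 / Real.pi ^ 2) - w := by
    congr 1
    rw [show w ^ 2 + 1 / Real.pi ^ 2 = (1 * (Real.pi * w * 1) ^ 2 + 1) / Real.pi ^ 2 by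
      field_simp, Real.sqrt_div (by positivity), Real.sqrt_sq hp.le]
    ring
  rw [hlim] at hfin
  refine hfin.congr' ?_
  have hsmall : ∀ᶠ c in 𝓝[>] (0 : ℝ), s c * w < 1 / 2 := by
    have := hs0.mul_const w
    rw [zero_mul] at this
    exact this.eventually (gt_mem_nhds (by norm_num))
  filter_upwards [hsmall, self_mem_nhdsWithin] with c hc1 hc
  have hsc : 0 < s c := Real.sqrt_pos.2 hc
  have hz0 : 0 < s c * w := mul_pos hsc hw
  have hssq : s c * s c = c := Real.mul_self_sqrt (le_of_lt hc)
  have hslope : ∀ (f : ℝ → ℝ) (x : ℝ), f 0 = 0 → f x = x * dslope f 0 x := by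
    intro f x hf
    have := sub_smul_dslope f 0 x
    simp only [sub_zero, smul_eq_mul, hf] at this
    exact this.symm
  have htan := hslope Real.tan (Real.pi * (s c * w)) Real.tan_zero
  have hexp : Real.exp c - 1 = c * dslope Real.exp 0 c := by
    have := sub_smul_dslope Real.exp 0 c
    simp only [sub_zero, smul_eq_mul, Real.exp_zero] at this
    exact this.symm
  have harg : Real.exp c * Real.tan (Real.pi * (s c * w)) ^ 2 + Real.exp c - 1 =
      s c ^ 2 * (Real.exp c * (Real.pi * w * dslope Real.tan 0 (Real.pi * (s c * w))) ^ 2 +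
        dslope Real.exp 0 c) := by
    have h3 : c * dslope Real.exp 0 c = s c ^ 2 * dslope Real.exp 0 c := by rw [sq, hssq]
    rw [add_sub_assoc, hexp, htan, h3]
    ring
  have hshift : slitShift c (s c * w) = 1 / Real.pi * Real.arctan (s c * v c) - s c * w := by
    rw [slitShift_eq_base (by linarith) hc1.le, slitAngleBase, if_neg hc1.ne, sign_pos hz0, harg,
      Real.sqrt_mul (by positivity), Real.sqrt_sq hsc.le]
    simp [hv]
  change _ = slitShift c (s c * w) / s c
  rw [hshift, hslope Real.arctan (s c * v c) Real.arctan_zero]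
  field_simp

theorem integral_angleLaw {h : ℝ → ℝ} (hm : Measurable h) (h0 : ∀ x, 0 ≤ h x) (F : ℝ → ℝ) :
    ∫ θ, F θ ∂(angleLaw h) = ∫ θ in (0 : ℝ)..1, h θ * F θ := by
  unfold angleLaw
  rw [integral_withDensity_eq_integral_toReal_smul hm.ennreal_ofReal
    (ae_of_all _ fun _ => ENNReal.ofReal_lt_top),
    intervalIntegral.integral_of_le zero_le_one, ← integral_Icc_eq_integral_Ioc]
  refine integral_congr_ae (ae_of_all _ fun θ => ?_)
  simp only [ENNReal.toReal_ofReal (h0 θ), smul_eq_mul]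

theorem isProbabilityMeasure_angleLaw {h : ℝ → ℝ} (hc : Continuous h) (h0 : ∀ x, 0 ≤ h x)
    (h1 : ∫ x in (0 : ℝ)..1, h x = 1) : IsProbabilityMeasure (angleLaw h) := by
  constructor
  unfold angleLaw
  rw [withDensity_apply _ MeasurableSet.univ, Measure.restrict_univ,
    ← ofReal_integral_eq_lintegral_ofReal (hc.continuousOn.integrableOn_compact isCompact_Icc)
      (ae_of_all _ h0), integral_Icc_eq_integral_Ioc,
    ← intervalIntegral.integral_of_le zero_le_one, h1, ENNReal.ofReal_one]

/-- Integration of a periodic function of `x - θ` against the angle law. -/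
theorem integral_angleLaw_comp_sub {h : ℝ → ℝ} (hm : Measurable h) (h0 : ∀ x, 0 ≤ h x)
    (hper : Function.Periodic h 1) {F : ℝ → ℝ} (hF : Function.Periodic F 1) (x : ℝ) :
    ∫ θ, F (x - θ) ∂(angleLaw h) = ∫ z in (0 : ℝ)..1, F z * h (x - z) := by
  have hG : Function.Periodic (fun z => F z * h (x - z)) 1 := fun z => by
    simp only [hF z]
    rw [← hper (x - (z + 1))]
    ring_nf
  rw [integral_angleLaw hm h0]
  have h1 := intervalIntegral.integral_comp_sub_left (a := 0) (b := 1)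
    (fun z => F z * h (x - z)) x
  simp only [sub_sub_cancel, sub_zero] at h1
  have h2 := hG.intervalIntegral_add_eq (x - 1) 0
  rw [sub_add_cancel, zero_add] at h2
  rw [← h2, ← h1]
  exact intervalIntegral.integral_congr fun θ _ => mul_comm _ _

theorem periodic_sub_one_sub {h : ℝ → ℝ} (hper : Function.Periodic h 1) (x z : ℝ) :
    h (x - (1 - z)) = h (x + z) := by
  rw [← hper (x - (1 - z))]; ring_nf

theorem intervalIntegrable_slitShift_pow_mul {c : ℝ} (hc : 0 < c) (k : ℕ) {g : ℝ → ℝ}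
    (hg : Continuous g) (a b : ℝ) :
    IntervalIntegrable (fun z => slitShift c z ^ k * g z) volume a b := by
  have hb : ∀ z, ‖slitShift c z ^ k‖ ≤ (Real.sqrt c / 2) ^ k := fun z => by
    rw [Real.norm_eq_abs, abs_pow]
    exact pow_le_pow_left₀ (abs_nonneg _) (abs_slitShift_le hc z) k
  have hm := (measurable_slitShift c).pow_const k
  exact ⟨(hg.intervalIntegrable a b).1.bdd_mul hm.aestronglyMeasurable (ae_of_all _ hb),
    (hg.intervalIntegrable a b).2.bdd_mul hm.aestronglyMeasurable (ae_of_all _ hb)⟩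

theorem integral_slitShift_fold {h : ℝ → ℝ} (hc : Continuous h) (h0 : ∀ x, 0 ≤ h x)
    (hper : Function.Periodic h 1) {c : ℝ} (hc0 : 0 < c) (k : ℕ) (x : ℝ) :
    ∫ θ, slitShift c (x - θ) ^ k ∂(angleLaw h) =
      ∫ z in (0 : ℝ)..(1 / 2), slitShift c z ^ k * (h (x - z) + (-1) ^ k * h (x + z)) := by
  have hflip : ∀ z ∈ Set.Ioc (0 : ℝ) (1 / 2), slitShift c (1 - z) ^ k * h (x - (1 - z)) =
      slitShift c z ^ k * ((-1) ^ k * h (x + z)) := fun z hz => by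
    rw [slitShift_one_sub hz, periodic_sub_one_sub hper, neg_pow]
    ring
  have hp : Function.Periodic (fun u => slitShift c u ^ k) 1 := fun u => by
    simp only [slitShift_periodic c u]
  have h01 : (0 : ℝ) ≤ 1 / 2 := by norm_num
  rw [integral_angleLaw_comp_sub hc.measurable h0 hper hp, integral_fold]
  · rw [intervalIntegral.integral_of_le h01, intervalIntegral.integral_of_le h01]
    refine setIntegral_congr_fun measurableSet_Ioc fun z hz => ?_
    simp only [hflip z hz]
    ring
  · exact intervalIntegrable_slitShift_pow_mul hc0 k (by fun_prop) _ _
  · refine (intervalIntegrable_slitShift_pow_mul hc0 k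
      (g := fun z => (-1) ^ k * h (x + z)) (by fun_prop) 0 (1 / 2)).congr ?_
    intro z hz
    rw [Set.uIoc_of_le h01] at hz
    exact (hflip z hz).symm

/-- The one-step mean displacement is `c b(x)` up to a power of `c` better than `c ^ (5 / 4)`. -/
theorem abs_mean_slitShift_sub_drift_le {h : ℝ → ℝ} (hc : Continuous h) (h0 : ∀ x, 0 ≤ h x)
    (hper : Function.Periodic h 1) {K : ℝ} (hK : ∀ x y, |h x - h y| ≤ K * |x - y|)
    {c : ℝ} (hc0 : 0 < c) (x : ℝ) :
    |∫ θ, slitShift c (x - θ) ∂(angleLaw h) - c * drift h x| ≤ 8 * K * (c * c ^ (3 / 8 : ℝ)) := by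
  have hK0 : 0 ≤ K := by simpa using (abs_nonneg _).trans (hK 1 0)
  have h01 : (0 : ℝ) ≤ 1 / 2 := by norm_num
  have h1 := integral_slitShift_fold hc h0 hper hc0 1 x
  simp only [pow_one, neg_mul, one_mul, ← sub_eq_add_neg] at h1
  have hcm := measurable_cot_pi_mul
  have hhm := hc.measurable
  have hI1 : IntervalIntegrable (fun z => slitShift c z * (h (x - z) - h (x + z))) volume 0 (1 / 2) := by
    have := intervalIntegrable_slitShift_pow_mul hc0 1
      (g := fun z => h (x - z) - h (x + z)) (by fun_prop) 0 (1 / 2)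
    simpa using this
  have hI2 : IntervalIntegrable (fun z => c / (2 * Real.pi) *
      (Real.cot (Real.pi * z) * (h (x - z) - h (x + z)))) volume 0 (1 / 2) :=
    (intervalIntegrable_of_le h01 (by fun_prop) (intervalIntegrable_const (c := 2 * K / Real.pi))
      fun z hz => abs_cot_mul_sub_add_le hK x hz).const_mul _
  have h2 : c * drift h x = ∫ z in (0 : ℝ)..(1 / 2), c / (2 * Real.pi) *
      (Real.cot (Real.pi * z) * (h (x - z) - h (x + z))) := by
    rw [drift_eq_fold hK hhm hper, intervalIntegral.integral_const_mul]
    ring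
  rw [h1, h2, ← intervalIntegral.integral_sub hI1 hI2]
  have hG : IntervalIntegrable (fun z : ℝ => 2 * K * (c * c ^ (3 / 8 : ℝ)) *
      z ^ (-(3 / 4) : ℝ)) volume 0 (1 / 2) :=
    (intervalIntegral.intervalIntegrable_rpow' (by norm_num)).const_mul _
  refine (abs_integral_le_of_le h01 hG fun z hz => ?_).trans ?_
  · have hz0 := hz.1
    rw [← mul_assoc, ← sub_mul, abs_mul]
    calc _ ≤ c * (c ^ (3 / 8 : ℝ) * z ^ (-(7 / 4) : ℝ)) * (K * (2 * z)) :=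
          mul_le_mul (abs_slitShift_sub_cot_le hc0 hz) (abs_sub_add_le hK x hz0) (abs_nonneg _)
            (by positivity)
      _ = 2 * K * (c * c ^ (3 / 8 : ℝ)) * (z ^ (-(7 / 4) : ℝ) * z ^ (1 : ℝ)) := by
          rw [Real.rpow_one]; ring
      _ = _ := by rw [← Real.rpow_add hz0]; norm_num
  · rw [intervalIntegral.integral_const_mul, integral_rpow (by norm_num)]
    have : ((1 / 2 : ℝ) ^ (-(3 / 4) + 1 : ℝ) - 0 ^ (-(3 / 4) + 1 : ℝ)) / (-(3 / 4) + 1) ≤ 4 := by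
      have : (1 / 2 : ℝ) ^ (-(3 / 4) + 1 : ℝ) ≤ 1 :=
        Real.rpow_le_one (by norm_num) (by norm_num) (by norm_num)
      rw [Real.zero_rpow (by norm_num), div_le_iff₀ (by norm_num)]
      linarith
    calc _ ≤ 2 * K * (c * c ^ (3 / 8 : ℝ)) * 4 := by gcongr
      _ = _ := by ring

/-- The rescaled second moment of the displacement under Lebesgue measure on `[0, 1/2]`. -/
noncomputable def slitSq (c : ℝ) : ℝ :=
  (∫ z in (0 : ℝ)..(1 / 2), slitShift c z ^ 2) / (c * Real.sqrt c)

/-- The limit of `slitSq` at zero capacity. -/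
noncomputable def slitSqLimit : ℝ :=
  ∫ w in Set.Ioi (0 : ℝ), (Real.sqrt (w ^ 2 + 1 / Real.pi ^ 2) - w) ^ 2

theorem slitShift_scaled_sq_le {c w : ℝ} (hc : 0 < c) (hw : 0 < w)
    (hcw : Real.sqrt c * w ≤ 1 / 2) :
    (slitShift c (Real.sqrt c * w) / Real.sqrt c) ^ 2 ≤ 2 * (1 + w ^ 2)⁻¹ := by
  have hs : 0 < Real.sqrt c := Real.sqrt_pos.2 hc
  have hz : Real.sqrt c * w ∈ Set.Ioc (0 : ℝ) (1 / 2) := ⟨mul_pos hs hw, hcw⟩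
  have h0 := (slitShift_bounds hc hz).1
  have h1 : slitShift c (Real.sqrt c * w) / Real.sqrt c ≤ 1 := by
    rw [div_le_one hs]
    linarith [(slitShift_bounds hc hz).2.1]
  have h2 : slitShift c (Real.sqrt c * w) / Real.sqrt c * w ≤ 1 := by
    have := slitShift_le_div hc hz
    rw [le_div_iff₀ hz.1] at this
    rw [div_mul_eq_mul_div, div_le_one hs]
    have h3 : Real.sqrt c * Real.sqrt c = c := Real.mul_self_sqrt hc.le
    nlinarith
  set q := slitShift c (Real.sqrt c * w) / Real.sqrt c with hq
  have hq0 : 0 ≤ q := div_nonneg h0 hs.le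
  rw [← div_eq_mul_inv, le_div_iff₀ (by positivity)]
  nlinarith [mul_nonneg hq0 hw.le]

theorem tendsto_indicator_slitShift {w : ℝ} (hw : 0 < w) :
    Tendsto (fun c => Set.indicator (Set.Ioc 0 (1 / (2 * Real.sqrt c)))
      (fun w => (slitShift c (Real.sqrt c * w) / Real.sqrt c) ^ 2) w) (𝓝[>] 0)
      (𝓝 ((Real.sqrt (w ^ 2 + 1 / Real.pi ^ 2) - w) ^ 2)) := by
  refine ((tendsto_slitShift_scaled hw).pow 2).congr' ?_
  have hs0 : Tendsto (fun c => Real.sqrt c * w) (𝓝[>] 0) (𝓝 0) := by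
    have : Tendsto (fun c => Real.sqrt c * w) (𝓝 0) (𝓝 (Real.sqrt 0 * w)) :=
      (Real.continuous_sqrt.mul continuous_const).tendsto 0
    rw [Real.sqrt_zero, zero_mul] at this
    exact this.mono_left nhdsWithin_le_nhds
  filter_upwards [hs0.eventually (gt_mem_nhds (show (0 : ℝ) < 1 / 2 by norm_num)),
    self_mem_nhdsWithin] with c hc1 hc
  have hs : 0 < Real.sqrt c := Real.sqrt_pos.2 hc
  rw [Set.indicator_of_mem]
  refine ⟨hw, ?_⟩
  rw [le_div_iff₀ (by positivity)]
  linarith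

theorem abs_indicator_slitShift_le {c w : ℝ} (hc : 0 < c) :
    ‖Set.indicator (Set.Ioc 0 (1 / (2 * Real.sqrt c)))
      (fun w => (slitShift c (Real.sqrt c * w) / Real.sqrt c) ^ 2) w‖ ≤ 2 * (1 + w ^ 2)⁻¹ := by
  have hs : 0 < Real.sqrt c := Real.sqrt_pos.2 hc
  by_cases hw : w ∈ Set.Ioc 0 (1 / (2 * Real.sqrt c))
  · rw [Set.indicator_of_mem hw, Real.norm_eq_abs, abs_of_nonneg (by positivity)]
    refine slitShift_scaled_sq_le hc hw.1 ?_
    have := hw.2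
    rw [le_div_iff₀ (by positivity)] at this
    linarith
  · rw [Set.indicator_of_notMem hw, norm_zero]
    positivity

theorem slitSq_eq_setIntegral {c : ℝ} (hc : 0 < c) :
    slitSq c = ∫ w in Set.Ioi (0 : ℝ), Set.indicator (Set.Ioc 0 (1 / (2 * Real.sqrt c)))
      (fun w => (slitShift c (Real.sqrt c * w) / Real.sqrt c) ^ 2) w := by
  have hs : 0 < Real.sqrt c := Real.sqrt_pos.2 hc
  have h3 : Real.sqrt c * Real.sqrt c = c := Real.mul_self_sqrt hc.le
  rw [setIntegral_indicator measurableSet_Ioc,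
    Set.inter_eq_self_of_subset_right (fun w hw => hw.1),
    ← intervalIntegral.integral_of_le (by positivity)]
  simp only [div_pow]
  rw [intervalIntegral.integral_div,
    intervalIntegral.integral_comp_mul_left (fun z => slitShift c z ^ 2) hs.ne', mul_zero,
    show Real.sqrt c * (1 / (2 * Real.sqrt c)) = 1 / 2 by field_simp, slitSq, smul_eq_mul]
  nth_rewrite 2 [← h3]
  field_simp

theorem tendsto_slitSq : Tendsto slitSq (𝓝[>] 0) (𝓝 slitSqLimit) := by
  have h := tendsto_integral_filter_of_dominated_convergence
    (μ := volume.restrict (Set.Ioi (0 : ℝ))) (l := 𝓝[>] (0 : ℝ))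
    (F := fun c => Set.indicator (Set.Ioc 0 (1 / (2 * Real.sqrt c)))
      (fun w => (slitShift c (Real.sqrt c * w) / Real.sqrt c) ^ 2))
    (f := fun w => (Real.sqrt (w ^ 2 + 1 / Real.pi ^ 2) - w) ^ 2)
    (fun w => 2 * (1 + w ^ 2)⁻¹) ?_ ?_ ?_ ?_
  · refine h.congr' ?_
    filter_upwards [self_mem_nhdsWithin] with c hc
    exact (slitSq_eq_setIntegral hc).symm
  · refine Eventually.of_forall fun c => (Measurable.indicator ?_ measurableSet_Ioc).aestronglyMeasurable
    exact (((measurable_slitShift c).comp (measurable_const.mul measurable_id)).div_const _).pow_const 2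
  · filter_upwards [self_mem_nhdsWithin] with c hc
    exact ae_of_all _ fun w => abs_indicator_slitShift_le hc
  · exact (integrable_inv_one_add_sq.const_mul 2).integrableOn
  · exact (ae_restrict_iff' measurableSet_Ioi).2 (ae_of_all _ fun w hw => tendsto_indicator_slitShift hw)

theorem slitSqLimit_pos : 0 < slitSqLimit := by
  have hp := Real.pi_pos
  have hpos : ∀ w ∈ Set.Ioi (0 : ℝ), 0 < (Real.sqrt (w ^ 2 + 1 / Real.pi ^ 2) - w) ^ 2 := by
    intro w hw
    have : w < Real.sqrt (w ^ 2 + 1 / Real.pi ^ 2) :=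
      Real.lt_sqrt_of_sq_lt (by have : 0 < 1 / Real.pi ^ 2 := by positivity
                                linarith)
    have : 0 < Real.sqrt (w ^ 2 + 1 / Real.pi ^ 2) - w := by linarith
    positivity
  have hint : IntegrableOn (fun w : ℝ => (Real.sqrt (w ^ 2 + 1 / Real.pi ^ 2) - w) ^ 2)
      (Set.Ioi 0) := by
    refine Integrable.mono' (g := fun w => 2 * (1 + w ^ 2)⁻¹)
      (integrable_inv_one_add_sq.const_mul 2).integrableOn ?_ ?_
    · exact (by fun_prop : Continuous fun w : ℝ =>
        (Real.sqrt (w ^ 2 + 1 / Real.pi ^ 2) - w) ^ 2).aestronglyMeasurable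
    · refine (ae_restrict_iff' measurableSet_Ioi).2 (ae_of_all _ fun w hw => ?_)
      refine le_of_tendsto (tendsto_indicator_slitShift hw).norm ?_
      filter_upwards [self_mem_nhdsWithin] with c hc
      exact abs_indicator_slitShift_le hc
  unfold slitSqLimit
  rw [setIntegral_pos_iff_support_of_nonneg_ae
    ((ae_restrict_iff' measurableSet_Ioi).2 (ae_of_all _ fun w hw => (hpos w hw).le)) hint]
  have : Set.Ioi (0 : ℝ) ⊆ Function.support (fun w : ℝ => (Real.sqrt (w ^ 2 + 1 / Real.pi ^ 2) - w) ^ 2) ∩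
      Set.Ioi 0 := fun w hw => ⟨(hpos w hw).ne', hw⟩
  exact lt_of_lt_of_le (by simp) (measure_mono this)

theorem slitShift_sq_mul_le {c z : ℝ} (hc : 0 < c) (hz : z ∈ Set.Ioc (0 : ℝ) (1 / 2)) :
    slitShift c z ^ 2 * z ≤ c * Real.sqrt c * c ^ (1 / 4 : ℝ) * z ^ (-(1 / 2) : ℝ) := by
  have hz0 := hz.1
  have h0 := (slitShift_bounds hc hz).1
  have h1 : slitShift c z ≤ Real.sqrt c := by
    have := (slitShift_bounds hc hz).2.1
    have := Real.sqrt_nonneg c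
    linarith
  have h2 := slitShift_le_div hc hz
  have e : slitShift c z ^ 2 = slitShift c z ^ (1 / 2 : ℝ) * slitShift c z ^ (3 / 2 : ℝ) := by
    rw [← Real.rpow_add_of_nonneg h0 (by norm_num) (by norm_num)]
    norm_num
  have e1 : slitShift c z ^ (1 / 2 : ℝ) ≤ c ^ (1 / 4 : ℝ) := by
    refine (Real.rpow_le_rpow h0 h1 (by norm_num)).trans (le_of_eq ?_)
    rw [Real.sqrt_eq_rpow, ← Real.rpow_mul hc.le]
    norm_num
  have e2 : slitShift c z ^ (3 / 2 : ℝ) ≤ c * Real.sqrt c * z ^ (-(3 / 2) : ℝ) := by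
    refine (Real.rpow_le_rpow h0 h2 (by norm_num)).trans (le_of_eq ?_)
    rw [Real.div_rpow hc.le hz0.le, Real.rpow_neg hz0.le, Real.sqrt_eq_rpow, div_eq_mul_inv]
    congr 1
    nth_rewrite 2 [← Real.rpow_one c]
    rw [← Real.rpow_add hc]
    norm_num
  calc slitShift c z ^ 2 * z ≤ c ^ (1 / 4 : ℝ) * (c * Real.sqrt c * z ^ (-(3 / 2) : ℝ)) * z := by
        rw [e]
        have : 0 ≤ slitShift c z ^ (3 / 2 : ℝ) := Real.rpow_nonneg h0 _
        gcongr
    _ = c * Real.sqrt c * c ^ (1 / 4 : ℝ) * (z ^ (-(3 / 2) : ℝ) * z ^ (1 : ℝ)) := by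
        rw [Real.rpow_one]; ring
    _ = _ := by rw [← Real.rpow_add hz0]; norm_num

/-- The one-step second moment is `c ^ (3 / 2) * (2 * slitSqLimit * h a)` to leading order. -/
theorem exists_secondMoment_slitShift_bound {h : ℝ → ℝ} (hc : Continuous h) (h0 : ∀ x, 0 ≤ h x)
    (hper : Function.Periodic h 1) {K : ℝ} (hK : ∀ x y, |h x - h y| ≤ K * |x - y|) (a : ℝ) :
    ∃ (ε : ℝ → ℝ) (C : ℝ), 0 ≤ C ∧ Tendsto ε (𝓝[>] 0) (𝓝 0) ∧ ∀ᶠ c in 𝓝[>] 0, 0 ≤ ε c ∧ ∀ x,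
      |∫ θ, slitShift c (x - θ) ^ 2 ∂(angleLaw h) - c * Real.sqrt c * (2 * slitSqLimit * h a)| ≤
        c * Real.sqrt c * (ε c + C * |x - a|) := by
  have hK0 : 0 ≤ K := by simpa using (abs_nonneg _).trans (hK 1 0)
  have h01 : (0 : ℝ) ≤ 1 / 2 := by norm_num
  have hM := slitSqLimit_pos
  have ht : Tendsto (fun c : ℝ => 2 * h a * |slitSq c - slitSqLimit| + 4 * K * c ^ (1 / 4 : ℝ))
      (𝓝[>] 0) (𝓝 0) := by
    have t1 : Tendsto (fun c => |slitSq c - slitSqLimit|) (𝓝[>] 0) (𝓝 0) := by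
      have := (tendsto_slitSq.sub_const slitSqLimit).abs
      rwa [sub_self, abs_zero] at this
    have t2 : Tendsto (fun c : ℝ => c ^ (1 / 4 : ℝ)) (𝓝[>] 0) (𝓝 0) := by
      have := (Real.continuousAt_rpow_const 0 (1 / 4) (Or.inr (by norm_num))).tendsto
      rw [Real.zero_rpow (by norm_num)] at this
      exact this.mono_left nhdsWithin_le_nhds
    simpa using (t1.const_mul (2 * h a)).add (t2.const_mul (4 * K))
  refine ⟨_, 2 * K * (slitSqLimit + 1), by positivity, ht, ?_⟩
  filter_upwards [tendsto_slitSq.eventually (gt_mem_nhds (lt_add_one slitSqLimit)),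
    self_mem_nhdsWithin] with c hcM hc0
  have hc0 : 0 < c := hc0
  have hs : 0 < Real.sqrt c := Real.sqrt_pos.2 hc0
  refine ⟨by have := h0 a; positivity, fun x => ?_⟩
  have h1 := integral_slitShift_fold hc h0 hper hc0 2 x
  simp only [neg_sq, one_pow, one_mul] at h1
  have hI : ∀ g : ℝ → ℝ, Continuous g →
      IntervalIntegrable (fun z => slitShift c z ^ 2 * g z) volume 0 (1 / 2) := fun g hg =>
    intervalIntegrable_slitShift_pow_mul hc0 2 hg _ _
  have hI1 : IntervalIntegrable (fun z => slitShift c z ^ 2) volume 0 (1 / 2) := by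
    simpa using hI (fun _ => 1) continuous_const
  have hS : ∫ z in (0 : ℝ)..(1 / 2), slitShift c z ^ 2 = c * Real.sqrt c * slitSq c := by
    unfold slitSq
    field_simp
  have hd : |∫ z in (0 : ℝ)..(1 / 2), (slitShift c z ^ 2 * (h (x - z) + h (x + z)) -
      slitShift c z ^ 2 * (2 * h a))| ≤ c * Real.sqrt c * (4 * K * c ^ (1 / 4 : ℝ)) +
        2 * K * |x - a| * (c * Real.sqrt c * slitSq c) := by
    have hG1 : IntervalIntegrable (fun z : ℝ => 2 * K * (c * Real.sqrt c * c ^ (1 / 4 : ℝ)) *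
        z ^ (-(1 / 2) : ℝ)) volume 0 (1 / 2) :=
      (intervalIntegral.intervalIntegrable_rpow' (by norm_num)).const_mul _
    have hG2 : IntervalIntegrable (fun z : ℝ => 2 * K * |x - a| * slitShift c z ^ 2)
      volume 0 (1 / 2) := hI1.const_mul _
    refine (abs_integral_le_of_le h01 (hG1.add hG2) fun z hz => ?_).trans ?_
    · have hz0 := hz.1
      have e1 := hK (x - z) a
      have e2 := hK (x + z) a
      have e3 : |x - z - a| ≤ |x - a| + z := by
        rw [show x - z - a = x - a - z by ring]
        refine (abs_sub _ _).trans (by rw [abs_of_pos hz0])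
      have e4 : |x + z - a| ≤ |x - a| + z := by
        rw [show x + z - a = x - a + z by ring]
        refine (abs_add_le _ _).trans (by rw [abs_of_pos hz0])
      have e5 : |h (x - z) + h (x + z) - 2 * h a| ≤ 2 * K * (|x - a| + z) := by
        rw [show h (x - z) + h (x + z) - 2 * h a = h (x - z) - h a + (h (x + z) - h a) by ring]
        refine (abs_add_le _ _).trans ?_
        nlinarith
      rw [← mul_sub, abs_mul, abs_of_nonneg (by positivity)]
      have e6 := slitShift_sq_mul_le hc0 hz
      have e7 : 0 ≤ slitShift c z ^ 2 := by positivity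
      nlinarith [mul_le_mul_of_nonneg_left e5 e7, mul_le_mul_of_nonneg_left e6 hK0]
    · rw [intervalIntegral.integral_add hG1 hG2, intervalIntegral.integral_const_mul,
        intervalIntegral.integral_const_mul, integral_rpow (by norm_num), hS]
      refine add_le_add ?_ le_rfl
      have : ((1 / 2 : ℝ) ^ (-(1 / 2) + 1 : ℝ) - 0 ^ (-(1 / 2) + 1 : ℝ)) / (-(1 / 2) + 1) ≤ 2 := by
        have : (1 / 2 : ℝ) ^ (-(1 / 2) + 1 : ℝ) ≤ 1 :=
          Real.rpow_le_one (by norm_num) (by norm_num) (by norm_num)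
        rw [Real.zero_rpow (by norm_num), div_le_iff₀ (by norm_num)]
        linarith
      calc _ ≤ 2 * K * (c * Real.sqrt c * c ^ (1 / 4 : ℝ)) * 2 := by gcongr
        _ = _ := by ring
  rw [intervalIntegral.integral_sub (hI _ (by fun_prop)) (hI _ (by fun_prop)),
    intervalIntegral.integral_mul_const, hS, ← h1] at hd
  have hsplit : ∫ θ, slitShift c (x - θ) ^ 2 ∂(angleLaw h) - c * Real.sqrt c * (2 * slitSqLimit * h a) =
      (∫ θ, slitShift c (x - θ) ^ 2 ∂(angleLaw h) - c * Real.sqrt c * slitSq c * (2 * h a)) +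
        c * Real.sqrt c * (2 * h a) * (slitSq c - slitSqLimit) := by ring
  rw [hsplit]
  refine (abs_add_le _ _).trans ?_
  rw [abs_mul (c * Real.sqrt c * (2 * h a)), abs_of_nonneg (a := c * Real.sqrt c * (2 * h a))
    (by have := h0 a; positivity)]
  have hfin : 2 * K * |x - a| * (c * Real.sqrt c * slitSq c) ≤
      2 * K * |x - a| * (c * Real.sqrt c * (slitSqLimit + 1)) := by
    gcongr
  nlinarith

theorem harmonicFlow_succ_eq (c : ℝ) (θ : ℕ → ℝ) (a : ℝ) (n : ℕ) :
    harmonicFlow c θ a (n + 1) =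
      harmonicFlow c θ a n + slitShift c (harmonicFlow c θ a n - θ n) := by
  rw [harmonicFlow, slitShift]
  ring

theorem harmonicFlow_congr {c : ℝ} {θ θ' : ℕ → ℝ} (a : ℝ) {n : ℕ} (h : ∀ i < n, θ i = θ' i) :
    harmonicFlow c θ a n = harmonicFlow c θ' a n := by
  induction n with
  | zero => rfl
  | succ n ih =>
    rw [harmonicFlow, harmonicFlow, ih fun i hi => h i (hi.trans (Nat.lt_succ_self n)),
      h n (Nat.lt_succ_self n)]

theorem measurable_harmonicFlow (c a : ℝ) (n : ℕ) :
    Measurable fun θ : ℕ → ℝ => harmonicFlow c θ a n := by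
  induction n with
  | zero => exact measurable_const
  | succ n ih =>
    simp only [harmonicFlow]
    exact ((measurable_slitAngle c).comp (ih.sub (measurable_pi_apply n))).add
      (measurable_pi_apply n)

theorem abs_harmonicFlow_sub_le {c : ℝ} (hc : 0 < c) (θ : ℕ → ℝ) (a : ℝ) (n : ℕ) :
    |harmonicFlow c θ a n - a| ≤ n * Real.sqrt c := by
  induction n with
  | zero => simp [harmonicFlow]
  | succ n ih =>
    rw [harmonicFlow_succ_eq, add_sub_right_comm]
    have := abs_slitShift_le hc (harmonicFlow c θ a n - θ n)
    have := Real.sqrt_nonneg c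
    refine (abs_add_le _ _).trans ?_
    push_cast
    linarith

section Chain

variable {Ω : Type*} [MeasurableSpace Ω] {μ : Measure Ω}

theorem indepFun_harmonicFlow {θ : ℕ → Ω → ℝ} (hθ : ∀ n, Measurable (θ n))
    (hi : iIndepFun θ μ) (c a : ℝ) (n : ℕ) :
    IndepFun (fun ω => harmonicFlow c (fun i => θ i ω) a n) (θ n) μ := by
  have h := hi.indepFun_finset (Finset.range n) {n} (by simp) hθ
  let φ : (Finset.range n → ℝ) → ℝ := fun v =>
    harmonicFlow c (fun i => if hi : i ∈ Finset.range n then v ⟨i, hi⟩ else 0) a n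
  let χ : (({n} : Finset ℕ) → ℝ) → ℝ := fun v => v ⟨n, Finset.mem_singleton_self n⟩
  have hφ : Measurable φ := by
    refine (measurable_harmonicFlow c a n).comp (measurable_pi_lambda _ fun i => ?_)
    by_cases hi : i ∈ Finset.range n
    · simp only [hi, dif_pos]
      exact measurable_pi_apply _
    · simp only [hi, dif_neg, not_false_iff]
      exact measurable_const
  have hχ : Measurable χ := measurable_pi_apply _
  have h2 := h.comp hφ hχ
  have e : (fun ω => harmonicFlow c (fun i => θ i ω) a n) =
      φ ∘ fun ω (i : Finset.range n) => θ i ω := by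
    ext ω
    refine harmonicFlow_congr a fun i hi => ?_
    rw [dif_pos (Finset.mem_range.2 hi)]
  rw [e]
  exact h2

/-- Conditioning on the first of two independent variables. -/
theorem integral_indep {E : Type*} [NormedAddCommGroup E] [NormedSpace ℝ E]
    [IsProbabilityMeasure μ] {X Y : Ω → ℝ} (hX : Measurable X) (hY : Measurable Y)
    (hXY : IndepFun X Y μ) {F : ℝ × ℝ → E} (hF : StronglyMeasurable F)
    (hint : Integrable (fun ω => F (X ω, Y ω)) μ) :
    ∫ ω, F (X ω, Y ω) ∂μ = ∫ ω, ∫ t, F (X ω, t) ∂(μ.map Y) ∂μ := by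
  have := Measure.isProbabilityMeasure_map (μ := μ) hX.aemeasurable
  have := Measure.isProbabilityMeasure_map (μ := μ) hY.aemeasurable
  have hm : μ.map (fun ω => (X ω, Y ω)) = (μ.map X).prod (μ.map Y) :=
    (indepFun_iff_map_prod_eq_prod_map_map hX.aemeasurable hY.aemeasurable).1 hXY
  have hXYm : Measurable fun ω => (X ω, Y ω) := hX.prodMk hY
  have hint' : Integrable F ((μ.map X).prod (μ.map Y)) := by
    rw [← hm]
    exact (integrable_map_measure hF.aestronglyMeasurable hXYm.aemeasurable).2 hint
  rw [← integral_map (φ := fun ω => (X ω, Y ω)) hXYm.aemeasurable hF.aestronglyMeasurable, hm,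
    integral_prod _ hint',
    integral_map hX.aemeasurable (hF.integral_prod_right' (ν := μ.map Y)).aestronglyMeasurable]

theorem integrable_of_bdd {E : Type*} [NormedAddCommGroup E] [IsFiniteMeasure μ] {f : Ω → E}
    (hf : AEStronglyMeasurable f μ) {B : ℝ} (hB : ∀ ω, ‖f ω‖ ≤ B) : Integrable f μ :=
  Integrable.of_bound hf B (ae_of_all _ hB)

end Chain

/-! ### Expansions of the complex exponential -/

theorem norm_exp_sub_one_sub_le {z : ℂ} (hz : z.re ≤ 0) :
    ‖Complex.exp z - 1 - z‖ ≤ 3 * ‖z‖ ^ 2 := by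
  rcases le_or_gt ‖z‖ 1 with h | h
  · have := Complex.norm_exp_sub_one_sub_id_le h
    nlinarith [norm_nonneg z, sq_nonneg ‖z‖]
  · have h1 : ‖Complex.exp z‖ ≤ 1 := by
      rw [Complex.norm_exp]
      exact Real.exp_le_one_iff.2 hz
    have h2 : ‖Complex.exp z - 1 - z‖ ≤ ‖Complex.exp z‖ + ‖(1 : ℂ)‖ + ‖z‖ :=
      (norm_sub_le _ _).trans (add_le_add (norm_sub_le _ _) le_rfl)
    rw [norm_one] at h2
    nlinarith

theorem norm_exp_sub_quadratic_le {u : ℝ} (hu : |u| ≤ 1) :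
    ‖Complex.exp (u * Complex.I) - (1 + u * Complex.I - u ^ 2 / 2)‖ ≤ |u| * u ^ 2 := by
  have hn : ‖(u * Complex.I : ℂ)‖ = |u| := by simp
  have h := Complex.exp_bound (x := u * Complex.I) (by rwa [hn]) (n := 3) (by norm_num)
  rw [hn] at h
  have e : ∑ m ∈ Finset.range 3, (u * Complex.I : ℂ) ^ m / (m.factorial : ℂ) =
      1 + u * Complex.I - u ^ 2 / 2 := by
    simp only [Finset.sum_range_succ, Finset.sum_range_zero, mul_pow, Complex.I_sq]
    norm_num [Nat.factorial]
    ring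
  rw [e] at h
  refine h.trans ?_
  have h3 : |u| ^ 3 = |u| * u ^ 2 := by rw [← sq_abs u]; ring
  rw [h3]
  have : 0 ≤ |u| * u ^ 2 := by positivity
  norm_num [Nat.factorial]
  nlinarith

/-- Second order expansion of a characteristic function of a bounded random variable. -/
theorem norm_integral_exp_sub_quadratic_le {α : Type*} [MeasurableSpace α] {ν : Measure α}
    [IsProbabilityMeasure ν] {s : α → ℝ} (hs : Measurable s) {S r : ℝ} (hS : ∀ t, |s t| ≤ S)
    (hr : |r| * S ≤ 1) :
    ‖∫ t, Complex.exp ((r * s t : ℝ) * Complex.I) ∂ν -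
      (1 + (r * ∫ t, s t ∂ν : ℝ) * Complex.I - (r ^ 2 * ∫ t, s t ^ 2 ∂ν : ℝ) / 2)‖ ≤
      |r| * S * (r ^ 2 * ∫ t, s t ^ 2 ∂ν) := by
  have i1 : Integrable s ν := integrable_of_bdd hs.aestronglyMeasurable hS
  have i2 : Integrable (fun t => s t ^ 2) ν :=
    integrable_of_bdd (hs.pow_const 2).aestronglyMeasurable (B := S ^ 2) fun t => by
      rw [Real.norm_eq_abs, abs_pow]
      exact pow_le_pow_left₀ (abs_nonneg _) (hS t) 2
  have i3 : Integrable (fun t => Complex.exp ((r * s t : ℝ) * Complex.I)) ν := by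
    refine integrable_of_bdd (B := 1) ?_ fun t => by rw [Complex.norm_exp_ofReal_mul_I]
    exact (by fun_prop : Measurable fun t => Complex.exp ((r * s t : ℝ) * Complex.I)).aestronglyMeasurable
  have j1 : Integrable (fun t => ((r * s t : ℝ) : ℂ)) ν := (i1.const_mul r).ofReal
  have j2 : Integrable (fun t => (((r * s t) ^ 2 : ℝ) : ℂ)) ν := by
    simp_rw [mul_pow]
    exact (i2.const_mul (r ^ 2)).ofReal
  have k1 : Integrable (fun t => (1 : ℂ) + ((r * s t : ℝ) : ℂ) * Complex.I) ν :=
    (integrable_const _).add (j1.mul_const _)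
  have k2 : Integrable (fun t => (1 : ℂ) + ((r * s t : ℝ) : ℂ) * Complex.I -
      (((r * s t) ^ 2 : ℝ) : ℂ) / 2) ν := k1.sub (j2.div_const _)
  have e : (1 + (r * ∫ t, s t ∂ν : ℝ) * Complex.I - (r ^ 2 * ∫ t, s t ^ 2 ∂ν : ℝ) / 2 : ℂ) =
      ∫ t, (1 + ((r * s t : ℝ) : ℂ) * Complex.I - (((r * s t) ^ 2 : ℝ) : ℂ) / 2) ∂ν := by
    rw [integral_sub k1 (j2.div_const _),
      integral_add (integrable_const _) (j1.mul_const _), integral_mul_const, integral_div,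
      integral_complex_ofReal, integral_complex_ofReal, integral_const_mul]
    simp_rw [mul_pow]
    rw [integral_const_mul]
    simp
  rw [e, ← integral_sub i3 k2,
    ← integral_const_mul, ← integral_const_mul]
  refine norm_integral_le_of_norm_le ((i2.const_mul _).const_mul _) (ae_of_all _ fun t => ?_)
  have hu : |r * s t| ≤ |r| * S := by
    rw [abs_mul]
    exact mul_le_mul_of_nonneg_left (hS t) (abs_nonneg _)
  have := norm_exp_sub_quadratic_le (hu.trans hr)
  push_cast at this ⊢
  refine this.trans ?_
  rw [← mul_pow]
  exact mul_le_mul_of_nonneg_right hu (sq_nonneg _)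

/-- One-step moment asymptotics of the displacement at capacity `q ^ 8`: the mean is `q ^ 8 * b`
up to `O(q ^ 11)`, and the second moment is `q ^ 12 * κ` near the point `a`, up to a relative
error `ε`. -/
structure StepMoments (ν : Measure ℝ) (b : ℝ → ℝ) (a κ A C q ε : ℝ) : Prop where
  q_pos : 0 < q
  q_le_one : q ≤ 1
  eps_nonneg : 0 ≤ ε
  eps_le_one : ε ≤ 1
  A_nonneg : 0 ≤ A
  C_nonneg : 0 ≤ C
  kappa_nonneg : 0 ≤ κ
  mean : ∀ x, |∫ t, slitShift (q ^ 8) (x - t) ∂ν - q ^ 8 * b x| ≤ A * (q ^ 8 * q ^ 3)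
  secondMoment : ∀ x, |∫ t, slitShift (q ^ 8) (x - t) ^ 2 ∂ν - q ^ 8 * q ^ 4 * κ| ≤
    q ^ 8 * q ^ 4 * (ε + C * |x - a|)

namespace StepMoments

variable {ν : Measure ℝ} {b : ℝ → ℝ} {a κ A C q ε L : ℝ}

theorem abs_slitShift_le (h : StepMoments ν b a κ A C q ε) (u : ℝ) :
    |slitShift (q ^ 8) u| ≤ q ^ 4 / 2 := by
  have := AHL.abs_slitShift_le (pow_pos h.q_pos 8) u
  have e : Real.sqrt (q ^ 8) = q ^ 4 := by
    rw [show q ^ 8 = (q ^ 4) ^ 2 by ring, Real.sqrt_sq (pow_nonneg h.q_pos.le 4)]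
  rwa [e] at this

theorem abs_le_one_add_sq (d : ℝ) : |d| ≤ 1 + d ^ 2 := by
  rw [← sq_abs d]
  nlinarith [sq_nonneg (|d| - 1), abs_nonneg d]

theorem sqrt_abs_mul_le (d : ℝ) : Real.sqrt |d| * |d| ≤ 1 + d ^ 2 := by
  have h1 : Real.sqrt |d| ≤ (1 + |d|) / 2 := by
    have := Real.sq_sqrt (abs_nonneg d)
    nlinarith [sq_nonneg (Real.sqrt |d| - 1)]
  have := mul_le_mul_of_nonneg_right h1 (abs_nonneg d)
  rw [← sq_abs d]
  nlinarith [sq_nonneg (|d| - 1), abs_nonneg d]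

theorem secondMoment_le (h : StepMoments ν b a κ A C q ε) (d : ℝ) :
    ∫ t, slitShift (q ^ 8) (a + q ^ 2 * d - t) ^ 2 ∂ν ≤
      q ^ 8 * q ^ 4 * ((κ + 1 + C) * (1 + d ^ 2)) := by
  have hq := h.q_pos
  have h1 := (abs_le.1 (h.secondMoment (a + q ^ 2 * d))).2
  rw [add_sub_cancel_left, abs_mul, abs_of_nonneg (sq_nonneg q)] at h1
  have h2 : κ + (ε + C * (q ^ 2 * |d|)) ≤ (κ + 1 + C) * (1 + d ^ 2) := by
    have := abs_le_one_add_sq d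
    have h3 : q ^ 2 * |d| ≤ 1 + d ^ 2 :=
      (mul_le_of_le_one_left (abs_nonneg _) (pow_le_one₀ hq.le h.q_le_one)).trans this
    have := mul_le_mul_of_nonneg_left h3 h.C_nonneg
    have := h.eps_le_one
    have := h.kappa_nonneg
    nlinarith [sq_nonneg d]
  have h4 : 0 ≤ q ^ 8 * q ^ 4 := by positivity
  nlinarith [mul_le_mul_of_nonneg_left h2 h4]

theorem abs_mean_sub_linear_le (h : StepMoments ν b a κ A C q ε) (hb : RegularDrift b L)
    (ha : b a = 0) (hl0 : 0 ≤ deriv b a) (hl : deriv b a * q ^ 8 ≤ 1) (d : ℝ) :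
    |∫ t, slitShift (q ^ 8) (a + q ^ 2 * d - t) ∂ν -
      (Real.exp (deriv b a * q ^ 8) - 1) * (q ^ 2 * d)| ≤
      q ^ 8 * q ^ 2 * (q * ((A + L + deriv b a ^ 2) * (1 + d ^ 2))) := by
  set l := deriv b a
  have hq := h.q_pos
  have hq1 := h.q_le_one
  have hL : 0 ≤ L := (abs_nonneg _).trans (hb.bound 0)
  have h1 := h.mean (a + q ^ 2 * d)
  have h2 := hb.abs_sub_linear_le a (a + q ^ 2 * d)
  rw [ha, sub_zero, add_sub_cancel_left, abs_mul (q ^ 2) d, abs_of_nonneg (sq_nonneg q),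
    Real.sqrt_mul (sq_nonneg q), Real.sqrt_sq hq.le] at h2
  have h3 : |Real.exp (l * q ^ 8) - 1 - l * q ^ 8| ≤ (l * q ^ 8) ^ 2 :=
    Real.abs_exp_sub_one_sub_id_le (by rw [abs_of_nonneg (by positivity)]; exact hl)
  have e1 := abs_le_one_add_sq d
  have e2 := sqrt_abs_mul_le d
  set m := ∫ t, slitShift (q ^ 8) (a + q ^ 2 * d - t) ∂ν
  have hsplit : m - (Real.exp (l * q ^ 8) - 1) * (q ^ 2 * d) =
      (m - q ^ 8 * b (a + q ^ 2 * d)) + q ^ 8 * (b (a + q ^ 2 * d) - l * (q ^ 2 * d)) -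
        (Real.exp (l * q ^ 8) - 1 - l * q ^ 8) * (q ^ 2 * d) := by ring
  rw [hsplit]
  refine (abs_sub _ _).trans ((add_le_add (abs_add_le _ _) le_rfl).trans ?_)
  rw [abs_mul (q ^ 8), abs_mul _ (q ^ 2 * d), abs_mul (q ^ 2) d, abs_of_nonneg (sq_nonneg q),
    abs_of_nonneg (by positivity : 0 ≤ q ^ 8)]
  have f1 : A * (q ^ 8 * q ^ 3) ≤ q ^ 8 * q ^ 2 * (q * (A * (1 + d ^ 2))) := by
    have : 0 ≤ A * (q ^ 8 * q ^ 3) * d ^ 2 := by have := h.A_nonneg; positivity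
    nlinarith
  have f2 : q ^ 8 * |b (a + q ^ 2 * d) - l * (q ^ 2 * d)| ≤
      q ^ 8 * q ^ 2 * (q * (L * (1 + d ^ 2))) := by
    calc _ ≤ q ^ 8 * (L * (q * Real.sqrt |d|) * (q ^ 2 * |d|)) := by gcongr
      _ = q ^ 8 * q ^ 2 * (q * (L * (Real.sqrt |d| * |d|))) := by ring
      _ ≤ _ := by gcongr
  have f3 : |Real.exp (l * q ^ 8) - 1 - l * q ^ 8| * (q ^ 2 * |d|) ≤
      q ^ 8 * q ^ 2 * (q * (l ^ 2 * (1 + d ^ 2))) := by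
    calc _ ≤ (l * q ^ 8) ^ 2 * (q ^ 2 * (1 + d ^ 2)) := by gcongr
      _ = q ^ 8 * q ^ 2 * (q ^ 8 * (l ^ 2 * (1 + d ^ 2))) := by ring
      _ ≤ q ^ 8 * q ^ 2 * (q * (l ^ 2 * (1 + d ^ 2))) := by
          gcongr
          exact pow_le_of_le_one hq.le hq1 (by norm_num)
  nlinarith

/-- The coefficient in the one-step error of the characteristic function. -/
noncomputable def stepCoeff (l κ A C L Ξ : ℝ) : ℝ :=
  Ξ * (A + L + l ^ 2) + Ξ ^ 2 * (1 + C) + Ξ ^ 3 * (κ + 1 + C) + 12 * (Ξ ^ 2 * l ^ 2 + Ξ ^ 4 * κ ^ 2)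

set_option maxHeartbeats 1000000 in
theorem norm_integral_exp_step_le [IsProbabilityMeasure ν] (h : StepMoments ν b a κ A C q ε)
    (hb : RegularDrift b L) (ha : b a = 0) (hl0 : 0 ≤ deriv b a) (hl : deriv b a * q ^ 8 ≤ 1)
    {Ξ v : ℝ} (hv : |v| ≤ Ξ) (hΞ : Ξ * q ^ 2 ≤ 1) (x : ℝ) :
    ‖∫ t, Complex.exp ((v * ((x + slitShift (q ^ 8) (x - t) - a) / q ^ 2) : ℝ) * Complex.I) ∂ν -
      Real.exp (-(v ^ 2 * κ * q ^ 8 / 2)) * Complex.exp ((v * Real.exp (deriv b a * q ^ 8) *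
        ((x - a) / q ^ 2) : ℝ) * Complex.I)‖ ≤
      q ^ 8 * (stepCoeff (deriv b a) κ A C L Ξ * (q + ε) * (1 + ((x - a) / q ^ 2) ^ 2)) := by
  have hq := h.q_pos
  have hq1 := h.q_le_one
  have hε := h.eps_nonneg
  have hA := h.A_nonneg
  have hC := h.C_nonneg
  have hκ := h.kappa_nonneg
  have hL : 0 ≤ L := (abs_nonneg _).trans (hb.bound 0)
  have hΞ0 : 0 ≤ Ξ := (abs_nonneg _).trans hv
  set d := (x - a) / q ^ 2 with hd
  have hx : x = a + q ^ 2 * d := by rw [hd]; field_simp; ring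
  have hmean := h.abs_mean_sub_linear_le hb ha hl0 hl d
  have hsec := h.secondMoment_le d
  have hsec' := h.secondMoment (a + q ^ 2 * d)
  rw [add_sub_cancel_left, abs_mul, abs_of_nonneg (sq_nonneg q)] at hsec'
  rw [← hx] at hmean hsec hsec'
  set l := deriv b a
  set s : ℝ → ℝ := fun t => slitShift (q ^ 8) (x - t) with hs
  have hsm : Measurable s := (measurable_slitShift _).comp (measurable_const.sub measurable_id)
  have hS : ∀ t, |s t| ≤ q ^ 4 / 2 := fun t => h.abs_slitShift_le _
  set r := v / q ^ 2 with hr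
  have hrS : |r| * (q ^ 4 / 2) ≤ 1 := by
    rw [hr, abs_div, abs_of_nonneg (sq_nonneg q)]
    calc |v| / q ^ 2 * (q ^ 4 / 2) = |v| * q ^ 2 / 2 := by field_simp
      _ ≤ Ξ * q ^ 2 / 2 := by gcongr
      _ ≤ 1 := by linarith
  have hquad := norm_integral_exp_sub_quadratic_le (ν := ν) hsm hS hrS
  set m1 := ∫ t, s t ∂ν with hm1
  set m2 := ∫ t, s t ^ 2 ∂ν with hm2
  have hm20 : 0 ≤ m2 := integral_nonneg fun t => sq_nonneg _
  set E := Real.exp (l * q ^ 8) - 1 with hE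
  have hd1 := abs_le_one_add_sq d
  have hE2 : |E| ≤ 2 * (l * q ^ 8) := by
    have := Real.abs_exp_sub_one_le (x := l * q ^ 8) (by rwa [abs_of_nonneg (by positivity)])
    rwa [abs_of_nonneg (a := l * q ^ 8) (by positivity)] at this
  set g := v ^ 2 * κ * q ^ 8 / 2 with hg
  have hg0 : 0 ≤ g := by positivity
  set z : ℂ := ((v * E * d : ℝ) : ℂ) * Complex.I - (g : ℂ) with hz
  have hzre : z.re ≤ 0 := by
    simp only [hz, Complex.sub_re, Complex.mul_re, Complex.ofReal_re, Complex.I_re, Complex.I_im,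
      Complex.ofReal_im]
    linarith
  have hexpz := norm_exp_sub_one_sub_le hzre
  -- pull out the phase of the starting point
  have hint : ∫ t, Complex.exp ((v * ((x + slitShift (q ^ 8) (x - t) - a) / q ^ 2) : ℝ) *
      Complex.I) ∂ν = Complex.exp ((v * d : ℝ) * Complex.I) *
        ∫ t, Complex.exp ((r * s t : ℝ) * Complex.I) ∂ν := by
    rw [← integral_const_mul]
    congr 1
    ext t
    rw [← Complex.exp_add, ← add_mul, ← Complex.ofReal_add]
    congr 3
    rw [hr, hd, hs]
    field_simp
    ring
  have htarget : (Real.exp (-g) : ℂ) * Complex.exp ((v * Real.exp (l * q ^ 8) * d : ℝ) *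
      Complex.I) = Complex.exp ((v * d : ℝ) * Complex.I) * Complex.exp z := by
    rw [Complex.ofReal_exp, ← Complex.exp_add, ← Complex.exp_add, hz, hE]
    congr 1
    push_cast
    ring
  rw [hint, htarget, ← mul_sub, norm_mul, Complex.norm_exp_ofReal_mul_I, one_mul]
  -- the three error terms
  have t1 : |r| * (q ^ 4 / 2) * (r ^ 2 * m2) ≤
      q ^ 8 * (Ξ ^ 3 * (κ + 1 + C) * (q + ε) * (1 + d ^ 2)) := by
    have e : |r| * (q ^ 4 / 2) * (r ^ 2 * m2) = |v| ^ 3 * m2 / (2 * q ^ 2) := by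
      rw [hr, abs_div, abs_of_nonneg (sq_nonneg q), div_pow, ← sq_abs v]
      field_simp
    rw [e]
    calc |v| ^ 3 * m2 / (2 * q ^ 2) ≤
        Ξ ^ 3 * (q ^ 8 * q ^ 4 * ((κ + 1 + C) * (1 + d ^ 2))) / (2 * q ^ 2) := by gcongr
      _ = q ^ 8 * (Ξ ^ 3 * (κ + 1 + C) * (q ^ 2 / 2) * (1 + d ^ 2)) := by field_simp
      _ ≤ _ := by
          gcongr
          nlinarith
  have t2 : |r * m1 - v * E * d| ≤ q ^ 8 * (Ξ * (A + L + l ^ 2) * (q + ε) * (1 + d ^ 2)) := by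
    have e : r * m1 - v * E * d = v * (m1 - E * (q ^ 2 * d)) / q ^ 2 := by
      rw [hr]; field_simp
    rw [e, abs_div, abs_mul, abs_of_nonneg (sq_nonneg q)]
    calc |v| * |m1 - E * (q ^ 2 * d)| / q ^ 2 ≤
        Ξ * (q ^ 8 * q ^ 2 * (q * ((A + L + l ^ 2) * (1 + d ^ 2)))) / q ^ 2 := by gcongr
      _ = q ^ 8 * (Ξ * (A + L + l ^ 2) * q * (1 + d ^ 2)) := by field_simp
      _ ≤ _ := by
          gcongr
          linarith
  have t3 : |r ^ 2 * m2 / 2 - g| ≤ q ^ 8 * (Ξ ^ 2 * (1 + C) * (q + ε) * (1 + d ^ 2)) := by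
    have e : r ^ 2 * m2 / 2 - g = v ^ 2 * (m2 - q ^ 8 * q ^ 4 * κ) / (2 * q ^ 4) := by
      rw [hr, hg]; field_simp
    rw [e, abs_div, abs_mul, abs_of_nonneg (sq_nonneg v), abs_of_nonneg (by positivity : 0 ≤ 2 * q ^ 4),
      ← sq_abs v]
    calc |v| ^ 2 * |m2 - q ^ 8 * q ^ 4 * κ| / (2 * q ^ 4) ≤
        Ξ ^ 2 * (q ^ 8 * q ^ 4 * (ε + C * (q ^ 2 * |d|))) / (2 * q ^ 4) := by gcongr
      _ = q ^ 8 * (Ξ ^ 2 * ((ε + C * (q ^ 2 * |d|)) / 2)) := by field_simp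
      _ ≤ q ^ 8 * (Ξ ^ 2 * ((1 + C) * (q + ε) * (1 + d ^ 2))) := by
          gcongr
          have : q ^ 2 * |d| ≤ q * (1 + d ^ 2) := by
            rw [sq, mul_assoc]
            refine mul_le_mul_of_nonneg_left ?_ hq.le
            exact (mul_le_of_le_one_left (abs_nonneg _) hq1).trans hd1
          have h5 : C * (q ^ 2 * |d|) ≤ C * (q * (1 + d ^ 2)) := by gcongr
          have h6 : 0 ≤ ε * d ^ 2 := by positivity
          have h7 : 0 ≤ C * ε * (1 + d ^ 2) := by positivity
          have h8 : 0 ≤ q * (1 + d ^ 2) := by positivity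
          have h9 : 0 ≤ C * (q * (1 + d ^ 2)) := by positivity
          nlinarith
      _ = _ := by ring
  have t4 : 3 * ‖z‖ ^ 2 ≤ q ^ 8 * (12 * (Ξ ^ 2 * l ^ 2 + Ξ ^ 4 * κ ^ 2) * (q + ε) * (1 + d ^ 2)) := by
    have e : ‖z‖ ^ 2 = (v * E * d) ^ 2 + g ^ 2 := by
      rw [← Complex.normSq_eq_norm_sq, Complex.normSq_apply]
      simp [hz]
      ring
    have e1 : (v * E * d) ^ 2 ≤ Ξ ^ 2 * (2 * (l * q ^ 8)) ^ 2 * d ^ 2 := by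
      rw [mul_pow, mul_pow, ← sq_abs v, ← sq_abs E]
      gcongr
    have e2 : g ^ 2 ≤ Ξ ^ 4 * κ ^ 2 * q ^ 16 := by
      have : g ^ 2 = |v| ^ 4 * κ ^ 2 * q ^ 16 / 4 := by
        rw [hg, ← sq_abs v]; ring
      rw [this]
      have : |v| ^ 4 * κ ^ 2 * q ^ 16 ≤ Ξ ^ 4 * κ ^ 2 * q ^ 16 := by gcongr
      have : 0 ≤ Ξ ^ 4 * κ ^ 2 * q ^ 16 := by positivity
      linarith
    rw [e]
    calc 3 * ((v * E * d) ^ 2 + g ^ 2) ≤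
        3 * (Ξ ^ 2 * (2 * (l * q ^ 8)) ^ 2 * d ^ 2 + Ξ ^ 4 * κ ^ 2 * q ^ 16) := by gcongr
      _ ≤ q ^ 8 * (12 * (Ξ ^ 2 * l ^ 2 + Ξ ^ 4 * κ ^ 2) * q ^ 8 * (1 + d ^ 2)) := by
          rw [← sub_nonneg]
          have h1 : 0 ≤ 12 * (Ξ ^ 2 * l ^ 2 * q ^ 16) + 9 * (Ξ ^ 4 * κ ^ 2 * q ^ 16) +
            12 * (Ξ ^ 4 * κ ^ 2 * q ^ 16 * d ^ 2) := by positivity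
          refine h1.trans (le_of_eq ?_)
          ring
      _ ≤ _ := by
          gcongr
          have := pow_le_of_le_one hq.le hq1 (n := 8) (by norm_num)
          linarith
  have hmid : ‖(1 + (r * m1 : ℝ) * Complex.I - (r ^ 2 * m2 : ℝ) / 2) - (1 + z)‖ ≤
      |r * m1 - v * E * d| + |r ^ 2 * m2 / 2 - g| := by
    have e : (1 + (r * m1 : ℝ) * Complex.I - (r ^ 2 * m2 : ℝ) / 2) - (1 + z) =
        ((r * m1 - v * E * d : ℝ) : ℂ) * Complex.I - ((r ^ 2 * m2 / 2 - g : ℝ) : ℂ) := by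
      rw [hz]; push_cast; ring
    rw [e]
    refine (norm_sub_le _ _).trans ?_
    rw [norm_mul, Complex.norm_I, mul_one, Complex.norm_real, Complex.norm_real]
    exact le_rfl
  have htri : ‖∫ t, Complex.exp ((r * s t : ℝ) * Complex.I) ∂ν - Complex.exp z‖ ≤
      |r| * (q ^ 4 / 2) * (r ^ 2 * m2) + (|r * m1 - v * E * d| + |r ^ 2 * m2 / 2 - g|) +
        3 * ‖z‖ ^ 2 := by
    have e : ∫ t, Complex.exp ((r * s t : ℝ) * Complex.I) ∂ν - Complex.exp z =
        (∫ t, Complex.exp ((r * s t : ℝ) * Complex.I) ∂ν -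
          (1 + (r * m1 : ℝ) * Complex.I - (r ^ 2 * m2 : ℝ) / 2)) +
        ((1 + (r * m1 : ℝ) * Complex.I - (r ^ 2 * m2 : ℝ) / 2) - (1 + z)) -
        (Complex.exp z - 1 - z) := by ring
    rw [e]
    exact (norm_sub_le _ _).trans (add_le_add ((norm_add_le _ _).trans (add_le_add hquad hmid)) hexpz)
  refine htri.trans ((add_le_add (add_le_add t1 (add_le_add t2 t3)) t4).trans (le_of_eq ?_))
  unfold stepCoeff
  ring

end StepMoments

namespace StepMoments

variable {ν : Measure ℝ} {b : ℝ → ℝ} {a κ A C q ε L : ℝ}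

theorem integral_sq_step_le [IsProbabilityMeasure ν] (h : StepMoments ν b a κ A C q ε)
    (hb : RegularDrift b L) (ha : b a = 0) (x : ℝ) :
    ∫ t, ((x + slitShift (q ^ 8) (x - t) - a) / q ^ 2) ^ 2 ∂ν ≤
      ((x - a) / q ^ 2) ^ 2 +
        q ^ 8 * (2 * L + 2 * A + (κ + 1 + C)) * (1 + ((x - a) / q ^ 2) ^ 2) := by
  have hq := h.q_pos
  have hq1 := h.q_le_one
  have hA := h.A_nonneg
  have hL : 0 ≤ L := (abs_nonneg _).trans (hb.bound 0)
  set d := (x - a) / q ^ 2 with hd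
  have hx : x = a + q ^ 2 * d := by rw [hd]; field_simp; ring
  have hsec := h.secondMoment_le d
  rw [← hx] at hsec
  set s : ℝ → ℝ := fun t => slitShift (q ^ 8) (x - t) with hs
  have hsm : Measurable s := (measurable_slitShift _).comp (measurable_const.sub measurable_id)
  have hS : ∀ t, |s t| ≤ q ^ 4 / 2 := fun t => h.abs_slitShift_le _
  have i1 : Integrable s ν := integrable_of_bdd hsm.aestronglyMeasurable hS
  have i2 : Integrable (fun t => s t ^ 2) ν :=
    integrable_of_bdd (hsm.pow_const 2).aestronglyMeasurable (B := (q ^ 4 / 2) ^ 2) fun t => by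
      rw [Real.norm_eq_abs, abs_pow]
      exact pow_le_pow_left₀ (abs_nonneg _) (hS t) 2
  have e : ∀ t, ((x + slitShift (q ^ 8) (x - t) - a) / q ^ 2) ^ 2 =
      d ^ 2 + 2 * d / q ^ 2 * s t + s t ^ 2 / q ^ 4 := fun t => by
    rw [hd, hs]
    field_simp
    ring
  have k1 : Integrable (fun t => d ^ 2 + 2 * d / q ^ 2 * s t) ν :=
    (integrable_const _).add (i1.const_mul _)
  simp_rw [e]
  rw [integral_add k1 (i2.div_const _), integral_add (integrable_const _) (i1.const_mul _),
    integral_const_mul, integral_div, integral_const, probReal_univ, one_smul]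
  set m1 := ∫ t, s t ∂ν
  have hm : |m1| ≤ q ^ 8 * q ^ 2 * (L * |d|) + A * (q ^ 8 * q ^ 3) := by
    have h1 : |m1 - q ^ 8 * b x| ≤ A * (q ^ 8 * q ^ 3) := h.mean x
    have h2 := hb.abs_sub_le x a
    rw [ha, sub_zero, hx, add_sub_cancel_left, abs_mul, abs_of_nonneg (sq_nonneg q), ← hx] at h2
    have h3 : m1 = (m1 - q ^ 8 * b x) + q ^ 8 * b x := by ring
    rw [h3]
    refine (abs_add_le _ _).trans ?_
    rw [abs_mul (q ^ 8), abs_of_nonneg (by positivity : 0 ≤ q ^ 8)]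
    have : q ^ 8 * |b x| ≤ q ^ 8 * (L * (q ^ 2 * |d|)) := by gcongr
    linarith
  have hd1 := abs_le_one_add_sq d
  have t1 : 2 * d / q ^ 2 * m1 ≤ q ^ 8 * (2 * L + 2 * A) * (1 + d ^ 2) := by
    calc 2 * d / q ^ 2 * m1 ≤ |2 * d / q ^ 2 * m1| := le_abs_self _
      _ = 2 * |d| * |m1| / q ^ 2 := by
          rw [abs_mul, abs_div, abs_mul, abs_of_nonneg (sq_nonneg q), abs_two]; ring
      _ ≤ 2 * |d| * (q ^ 8 * q ^ 2 * (L * |d|) + A * (q ^ 8 * q ^ 3)) / q ^ 2 := by gcongr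
      _ = q ^ 8 * (2 * L * |d| ^ 2 + 2 * A * (q * |d|)) := by field_simp
      _ ≤ q ^ 8 * (2 * L * (1 + d ^ 2) + 2 * A * (1 + d ^ 2)) := by
          rw [sq_abs]
          gcongr
          · linarith
          · exact (mul_le_of_le_one_left (abs_nonneg _) hq1).trans hd1
      _ = _ := by ring
  have t2 : (∫ t, s t ^ 2 ∂ν) / q ^ 4 ≤ q ^ 8 * (κ + 1 + C) * (1 + d ^ 2) := by
    rw [div_le_iff₀ (by positivity)]
    refine hsec.trans (le_of_eq ?_)
    ring
  linarith

variable {Ω : Type*} [MeasurableSpace Ω] {μ : Measure Ω} [IsProbabilityMeasure μ]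
  {θ : ℕ → Ω → ℝ}

theorem integral_sq_harmonicFlow_le [IsProbabilityMeasure ν] (h : StepMoments ν b a κ A C q ε)
    (hb : RegularDrift b L) (ha : b a = 0) (hθ : ∀ n, Measurable (θ n)) (hi : iIndepFun θ μ)
    (hlaw : ∀ n, μ.map (θ n) = ν) (n : ℕ) :
    ∫ ω, ((harmonicFlow (q ^ 8) (fun i => θ i ω) a n - a) / q ^ 2) ^ 2 ∂μ ≤
      n * (q ^ 8 * (2 * L + 2 * A + (κ + 1 + C))) *
        Real.exp (n * (q ^ 8 * (2 * L + 2 * A + (κ + 1 + C)))) := by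
  have hq := h.q_pos
  have hA := h.A_nonneg
  have hC := h.C_nonneg
  have hκ := h.kappa_nonneg
  have hL : 0 ≤ L := (abs_nonneg _).trans (hb.bound 0)
  set G := q ^ 8 * (2 * L + 2 * A + (κ + 1 + C)) with hG
  have hG0 : 0 ≤ G := by positivity
  set X : ℕ → Ω → ℝ := fun n ω => harmonicFlow (q ^ 8) (fun i => θ i ω) a n with hX
  have hXm : ∀ n, Measurable (X n) := fun n =>
    (measurable_harmonicFlow (q ^ 8) a n).comp (measurable_pi_lambda _ hθ)
  have hsq : ∀ n, Integrable (fun ω => ((X n ω - a) / q ^ 2) ^ 2) μ := fun n => by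
    refine integrable_of_bdd ((((hXm n).sub_const a).div_const _).pow_const 2).aestronglyMeasurable
      (B := (n * Real.sqrt (q ^ 8) / q ^ 2) ^ 2) fun ω => ?_
    rw [Real.norm_eq_abs, abs_pow, abs_div, abs_of_nonneg (sq_nonneg q)]
    have := abs_harmonicFlow_sub_le (pow_pos hq 8) (fun i => θ i ω) a n
    gcongr
  have hrec : ∀ n ≥ 0, ∫ ω, ((X (n + 1) ω - a) / q ^ 2) ^ 2 ∂μ ≤
      (1 + G) * ∫ ω, ((X n ω - a) / q ^ 2) ^ 2 ∂μ + G := fun n _ => by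
    have hind : IndepFun (X n) (θ n) μ := indepFun_harmonicFlow hθ hi (q ^ 8) a n
    let F : ℝ × ℝ → ℝ := fun p => ((p.1 + slitShift (q ^ 8) (p.1 - p.2) - a) / q ^ 2) ^ 2
    have hF : Measurable F := (((measurable_fst.add ((measurable_slitShift _).comp
      (measurable_fst.sub measurable_snd))).sub_const a).div_const _).pow_const 2
    have e : ∀ ω, ((X (n + 1) ω - a) / q ^ 2) ^ 2 = F (X n ω, θ n ω) := fun ω => by
      simp only [hX, harmonicFlow_succ_eq, F]
    have h1 := hsq (n + 1)
    simp_rw [e] at h1 ⊢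
    rw [integral_indep (hXm n) (hθ n) hind hF.stronglyMeasurable h1, hlaw n]
    have h3 : Integrable (fun ω => 1 + ((X n ω - a) / q ^ 2) ^ 2) μ :=
      (integrable_const _).add (hsq n)
    have h2 : Integrable (fun ω => ((X n ω - a) / q ^ 2) ^ 2 +
        G * (1 + ((X n ω - a) / q ^ 2) ^ 2)) μ :=
      (hsq n).add (h3.const_mul _)
    calc ∫ ω, ∫ t, F (X n ω, t) ∂ν ∂μ ≤ ∫ ω, (((X n ω - a) / q ^ 2) ^ 2 +
          G * (1 + ((X n ω - a) / q ^ 2) ^ 2)) ∂μ :=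
          integral_mono_of_nonneg (ae_of_all _ fun ω => integral_nonneg fun t => sq_nonneg _) h2
            (ae_of_all _ fun ω => h.integral_sq_step_le hb ha (X n ω))
      _ = _ := by
          rw [integral_add (hsq n) (h3.const_mul _),
            integral_const_mul, integral_add (integrable_const _) (hsq n), integral_const,
            probReal_univ, one_smul]
          ring
  have h0 : ∫ ω, ((X 0 ω - a) / q ^ 2) ^ 2 ∂μ = 0 := by simp [hX, harmonicFlow]
  have := discrete_gronwall (u := fun n => ∫ ω, ((X n ω - a) / q ^ 2) ^ 2 ∂μ)
    (b := fun _ => G) (c := fun _ => G) (n₀ := 0) (by simp only [h0]; exact le_rfl) hrec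
    (fun _ _ => hG0) (fun _ _ => hG0) (Nat.zero_le n)
  simp only [h0, zero_add, Finset.sum_const, Nat.card_Ico, tsub_zero, nsmul_eq_mul] at this
  exact this

/-- Characteristic function of the rescaled flow, up to the accumulated one-step errors. -/
theorem norm_charFun_harmonicFlow_sub_le [IsProbabilityMeasure ν]
    (h : StepMoments ν b a κ A C q ε)
    (hb : RegularDrift b L) (ha : b a = 0) (hl0 : 0 ≤ deriv b a) (hl : deriv b a * q ^ 8 ≤ 1)
    (hθ : ∀ n, Measurable (θ n)) (hi : iIndepFun θ μ) (hlaw : ∀ n, μ.map (θ n) = ν)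
    {Ξ M : ℝ} (hΞ : Ξ * q ^ 2 ≤ 1) (v : ℕ → ℝ) {N : ℕ} (hv : ∀ n ≤ N, |v n| ≤ Ξ)
    (hvs : ∀ n < N, v n = v (n + 1) * Real.exp (deriv b a * q ^ 8))
    (hM : ∀ n ≤ N, ∫ ω, ((harmonicFlow (q ^ 8) (fun i => θ i ω) a n - a) / q ^ 2) ^ 2 ∂μ ≤ M)
    {n : ℕ} (hn : n ≤ N) :
    ‖∫ ω, Complex.exp ((v n * ((harmonicFlow (q ^ 8) (fun i => θ i ω) a n - a) / q ^ 2) : ℝ) *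
        Complex.I) ∂μ -
      Real.exp (-∑ j ∈ Finset.range n, v (j + 1) ^ 2 * κ * q ^ 8 / 2)‖ ≤
      n * (q ^ 8 * (stepCoeff (deriv b a) κ A C L Ξ * (q + ε) * (1 + M))) := by
  have hq := h.q_pos
  set B := stepCoeff (deriv b a) κ A C L Ξ * (q + ε) with hB
  have hΞ0 : 0 ≤ Ξ := (abs_nonneg _).trans (hv 0 (Nat.zero_le _))
  have hB0 : 0 ≤ B := by
    have := h.eps_nonneg
    have := h.A_nonneg
    have := h.C_nonneg
    have := h.kappa_nonneg
    have hL : 0 ≤ L := (abs_nonneg _).trans (hb.bound 0)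
    unfold B stepCoeff
    positivity
  set X : ℕ → Ω → ℝ := fun n ω => harmonicFlow (q ^ 8) (fun i => θ i ω) a n with hX
  have hXm : ∀ n, Measurable (X n) := fun n =>
    (measurable_harmonicFlow (q ^ 8) a n).comp (measurable_pi_lambda _ hθ)
  have hsq : ∀ n, Integrable (fun ω => ((X n ω - a) / q ^ 2) ^ 2) μ := fun n => by
    refine integrable_of_bdd ((((hXm n).sub_const a).div_const _).pow_const 2).aestronglyMeasurable
      (B := (n * Real.sqrt (q ^ 8) / q ^ 2) ^ 2) fun ω => ?_
    rw [Real.norm_eq_abs, abs_pow, abs_div, abs_of_nonneg (sq_nonneg q)]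
    have := abs_harmonicFlow_sub_le (pow_pos hq 8) (fun i => θ i ω) a n
    gcongr
  induction n with
  | zero => simp [harmonicFlow]
  | succ n ih =>
    have hnN : n < N := hn
    have ih := ih hnN.le
    have hind : IndepFun (X n) (θ n) μ := indepFun_harmonicFlow hθ hi (q ^ 8) a n
    let F : ℝ × ℝ → ℂ := fun p => Complex.exp
      ((v (n + 1) * ((p.1 + slitShift (q ^ 8) (p.1 - p.2) - a) / q ^ 2) : ℝ) * Complex.I)
    have hFr : Measurable fun p : ℝ × ℝ =>
        v (n + 1) * ((p.1 + slitShift (q ^ 8) (p.1 - p.2) - a) / q ^ 2) :=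
      (((measurable_fst.add ((measurable_slitShift _).comp
        (measurable_fst.sub measurable_snd))).sub_const a).div_const _).const_mul _
    have hF : Measurable F := Complex.measurable_exp.comp
      ((Complex.measurable_ofReal.comp hFr).mul_const _)
    have e : ∀ ω, Complex.exp ((v (n + 1) * ((X (n + 1) ω - a) / q ^ 2) : ℝ) * Complex.I) =
        F (X n ω, θ n ω) := fun ω => by
      simp only [hX, harmonicFlow_succ_eq, F]
    have hFi : Integrable (fun ω => F (X n ω, θ n ω)) μ :=
      integrable_of_bdd (hF.comp ((hXm n).prodMk (hθ n))).aestronglyMeasurable (B := 1)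
        fun ω => (Complex.norm_exp_ofReal_mul_I _).le
    set g := v (n + 1) ^ 2 * κ * q ^ 8 / 2 with hg
    have hg0 : 0 ≤ g := by have := h.kappa_nonneg; positivity
    set f : Ω → ℂ := fun ω => Complex.exp ((v n * ((X n ω - a) / q ^ 2) : ℝ) * Complex.I) with hf
    have hfm : Measurable f := Complex.measurable_exp.comp ((Complex.measurable_ofReal.comp
      ((((hXm n).sub_const a).div_const _).const_mul _)).mul_const _)
    have hfi : Integrable f μ := integrable_of_bdd hfm.aestronglyMeasurable (B := 1)
      fun ω => (Complex.norm_exp_ofReal_mul_I _).le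
    have hstep : ‖∫ ω, F (X n ω, θ n ω) ∂μ - Real.exp (-g) * ∫ ω, f ω ∂μ‖ ≤
        q ^ 8 * (B * (1 + M)) := by
      rw [integral_indep (hXm n) (hθ n) hind hF.stronglyMeasurable hFi, hlaw n,
        ← integral_const_mul]
      have hin : Integrable (fun ω => ∫ t, F (X n ω, t) ∂ν) μ := by
        refine integrable_of_bdd (B := 1) ?_ fun ω => ?_
        · exact ((hF.stronglyMeasurable.integral_prod_right' (ν := ν)).comp_measurable
            (hXm n)).aestronglyMeasurable
        · refine (norm_integral_le_of_norm_le_const (C := 1) (ae_of_all _ fun t =>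
            (Complex.norm_exp_ofReal_mul_I _).le)).trans ?_
          simp
      rw [← integral_sub hin (hfi.const_mul _)]
      have hbound : Integrable (fun ω => q ^ 8 * (B * (1 + ((X n ω - a) / q ^ 2) ^ 2))) μ :=
        (((integrable_const _).add (hsq n)).const_mul _).const_mul _
      refine (norm_integral_le_of_norm_le hbound (ae_of_all _ fun ω => ?_)).trans ?_
      · have := h.norm_integral_exp_step_le hb ha hl0 hl (hv (n + 1) hn) hΞ (X n ω)
        rw [← hvs n hnN] at this
        exact this
      · rw [integral_const_mul, integral_const_mul, integral_add (integrable_const _) (hsq n),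
          integral_const, probReal_univ, one_smul]
        have := hM n hnN.le
        gcongr
    change ‖∫ ω, Complex.exp ((v (n + 1) * ((X (n + 1) ω - a) / q ^ 2) : ℝ) * Complex.I) ∂μ - _‖ ≤ _
    simp_rw [e]
    rw [Finset.sum_range_succ, neg_add, add_comm, Real.exp_add, Complex.ofReal_mul]
    set P := Real.exp (-∑ j ∈ Finset.range n, v (j + 1) ^ 2 * κ * q ^ 8 / 2)
    have hsplit : ∫ ω, F (X n ω, θ n ω) ∂μ - Real.exp (-g) * P =
        (∫ ω, F (X n ω, θ n ω) ∂μ - Real.exp (-g) * ∫ ω, f ω ∂μ) +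
          Real.exp (-g) * (∫ ω, f ω ∂μ - P) := by ring
    rw [hsplit]
    have h5 : ‖(Real.exp (-g) : ℂ) * (∫ ω, f ω ∂μ - P)‖ ≤ n * (q ^ 8 * (B * (1 + M))) := by
      rw [norm_mul, Complex.norm_real, Real.norm_eq_abs, abs_of_pos (Real.exp_pos _)]
      have h6 : Real.exp (-g) ≤ 1 := Real.exp_le_one_iff.2 (by linarith)
      exact (mul_le_of_le_one_left (norm_nonneg _) h6).trans ih
    refine (norm_add_le _ _).trans ((add_le_add hstep h5).trans (le_of_eq ?_))
    rw [Nat.cast_succ]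
    ring

end StepMoments

theorem rpow_eighth_pow {c : ℝ} (hc : 0 ≤ c) : (c ^ (1 / 8 : ℝ)) ^ 8 = c := by
  rw [← Real.rpow_natCast, ← Real.rpow_mul hc]
  norm_num

theorem rpow_eighth_sq {c : ℝ} (hc : 0 ≤ c) : (c ^ (1 / 8 : ℝ)) ^ 2 = c ^ (1 / 4 : ℝ) := by
  rw [← Real.rpow_natCast, ← Real.rpow_mul hc]
  norm_num

theorem tendsto_rpow_zero {r : ℝ} (hr : 0 < r) :
    Tendsto (fun c : ℝ => c ^ r) (𝓝[>] 0) (𝓝 0) := by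
  have := (Real.continuousAt_rpow_const 0 r (Or.inr hr.le)).tendsto
  rw [Real.zero_rpow hr.ne'] at this
  exact this.mono_left nhdsWithin_le_nhds

theorem exists_stepMoments {h : ℝ → ℝ} (hs : ContDiff ℝ 2 h) (h0 : ∀ x, 0 ≤ h x)
    (hper : Function.Periodic h 1) (a : ℝ) :
    ∃ (A C : ℝ) (ε : ℝ → ℝ), Tendsto ε (𝓝[>] 0) (𝓝 0) ∧ ∀ᶠ c in 𝓝[>] (0 : ℝ),
      StepMoments (angleLaw h) (drift h) a (2 * slitSqLimit * h a) A C (c ^ (1 / 8 : ℝ)) (ε c) := by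
  obtain ⟨K, hK⟩ := exists_lipschitz_of_periodic (hs.of_le (by norm_num)) hper
  have hK0 : 0 ≤ K := by simpa using (abs_nonneg _).trans (hK 1 0)
  obtain ⟨ε, C, hC, hε, hev⟩ := exists_secondMoment_slitShift_bound hs.continuous h0 hper hK a
  refine ⟨8 * K, C, ε, hε, ?_⟩
  filter_upwards [hev, hε.eventually (ge_mem_nhds zero_lt_one), self_mem_nhdsWithin,
    (tendsto_rpow_zero (r := 1 / 8) (by norm_num)).eventually (ge_mem_nhds zero_lt_one)]
    with c h1 h2 hc h3
  have hc : 0 < c := hc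
  have hq : 0 < c ^ (1 / 8 : ℝ) := Real.rpow_pos_of_pos hc _
  have e8 := rpow_eighth_pow hc.le
  have e4 : (c ^ (1 / 8 : ℝ)) ^ 4 = Real.sqrt c := by
    rw [Real.sqrt_eq_rpow, ← Real.rpow_natCast, ← Real.rpow_mul hc.le]
    norm_num
  have e3 : (c ^ (1 / 8 : ℝ)) ^ 3 = c ^ (3 / 8 : ℝ) := by
    rw [← Real.rpow_natCast, ← Real.rpow_mul hc.le]
    norm_num
  refine ⟨hq, h3, h1.1, h2, by positivity, hC, ?_, fun x => ?_, fun x => ?_⟩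
  · have := slitSqLimit_pos
    have := h0 a
    positivity
  · rw [e8, e3]
    exact abs_mean_slitShift_sub_drift_le hs.continuous h0 hper hK hc x
  · rw [e8, e4]
    exact h1.2 x

theorem floor_div_mul_le {t₀ c : ℝ} (ht : 0 ≤ t₀) (hc : 0 < c) : (⌊t₀ / c⌋₊ : ℝ) * c ≤ t₀ := by
  rw [← le_div_iff₀ hc]
  exact Nat.floor_le (by positivity)

theorem tendsto_floor_div_mul {t₀ : ℝ} (ht : 0 ≤ t₀) :
    Tendsto (fun c : ℝ => (⌊t₀ / c⌋₊ : ℝ) * c) (𝓝[>] 0) (𝓝 t₀) := by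
  have h1 : Tendsto (fun c : ℝ => t₀ - c) (𝓝[>] 0) (𝓝 (t₀ - 0)) :=
    (tendsto_const_nhds.sub tendsto_id).mono_left nhdsWithin_le_nhds
  rw [sub_zero] at h1
  refine tendsto_of_tendsto_of_tendsto_of_le_of_le' h1 tendsto_const_nhds ?_ ?_
  · filter_upwards [self_mem_nhdsWithin] with c hc
    have hc : 0 < c := hc
    have := Nat.lt_floor_add_one (t₀ / c)
    rw [div_lt_iff₀ hc] at this
    linarith
  · filter_upwards [self_mem_nhdsWithin] with c hc
    exact floor_div_mul_le ht hc

theorem tendsto_div_exp_sub_one {l : ℝ} (hl : 0 < l) :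
    Tendsto (fun c : ℝ => c / (Real.exp (l * c) - 1)) (𝓝[>] 0) (𝓝 (1 / l)) := by
  have h1 : HasDerivAt (fun c : ℝ => Real.exp (l * c)) l 0 := by
    have := ((hasDerivAt_id (0 : ℝ)).const_mul l).exp
    simpa using this
  have h2 := (hasDerivAt_iff_tendsto_slope.1 h1).mono_left
    (nhdsWithin_mono (0 : ℝ) (fun x (hx : 0 < x) => hx.ne' : Set.Ioi (0 : ℝ) ⊆ {0}ᶜ))
  have h3 := h2.inv₀ hl.ne'
  rw [← one_div] at h3
  refine h3.congr fun c => ?_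
  rw [slope_def_field, inv_div]
  simp

theorem tendsto_geometric_variance {t₀ l : ℝ} (ht : 0 ≤ t₀) (hl : 0 < l) :
    Tendsto (fun c : ℝ => ∑ j ∈ Finset.range ⌊t₀ / c⌋₊,
      Real.exp (-(l * t₀) + l * (c * ((⌊t₀ / c⌋₊ : ℝ) - (j + 1 : ℕ)))) ^ 2 * c) (𝓝[>] 0)
      (𝓝 ((1 - Real.exp (-(2 * l * t₀))) / (2 * l))) := by
  have hlim : Tendsto (fun c : ℝ => Real.exp (-(2 * l * t₀)) *
      ((Real.exp (2 * l * (⌊t₀ / c⌋₊ * c)) - 1) * (c / (Real.exp (2 * l * c) - 1)))) (𝓝[>] 0)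
      (𝓝 (Real.exp (-(2 * l * t₀)) * ((Real.exp (2 * l * t₀) - 1) * (1 / (2 * l))))) := by
    refine Tendsto.const_mul _ (Tendsto.mul (Tendsto.sub_const ?_ _)
      (tendsto_div_exp_sub_one (by positivity)))
    exact (Real.continuous_exp.tendsto _).comp ((tendsto_floor_div_mul ht).const_mul _)
  have he : Real.exp (-(2 * l * t₀)) * ((Real.exp (2 * l * t₀) - 1) * (1 / (2 * l))) =
      (1 - Real.exp (-(2 * l * t₀))) / (2 * l) := by
    rw [Real.exp_neg]
    have := Real.exp_pos (2 * l * t₀)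
    field_simp
  rw [he] at hlim
  refine hlim.congr' ?_
  filter_upwards [self_mem_nhdsWithin] with c hc
  have hc : 0 < c := hc
  set N := ⌊t₀ / c⌋₊
  have h1 : ∑ j ∈ Finset.range N, Real.exp (-(l * t₀) + l * (c * ((N : ℝ) - (j + 1 : ℕ)))) ^ 2 * c =
      Real.exp (-(2 * l * t₀)) * c * ∑ i ∈ Finset.range N, Real.exp (2 * l * c) ^ i := by
    rw [← Finset.sum_range_reflect (fun i => Real.exp (2 * l * c) ^ i), Finset.mul_sum]
    refine Finset.sum_congr rfl fun j hj => ?_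
    have hj := Finset.mem_range.1 hj
    rw [← Real.exp_nat_mul, ← Real.exp_nat_mul, mul_comm, mul_comm (Real.exp (-(2 * l * t₀))) c,
      mul_assoc, ← Real.exp_add]
    congr 2
    rw [Nat.sub_sub, Nat.cast_sub (by omega)]
    push_cast
    ring
  have hne : Real.exp (2 * l * c) ≠ 1 := by
    rw [Ne, Real.exp_eq_one_iff]
    positivity
  rw [h1, geom_sum_eq hne, ← Real.exp_nat_mul]
  rw [show (N : ℝ) * (2 * l * c) = 2 * l * (N * c) by ring]
  ring

section Limit

variable {Ω : Type*} [MeasurableSpace Ω] {μ : Measure Ω} [IsProbabilityMeasure μ]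
  {θ : ℕ → Ω → ℝ} {h : ℝ → ℝ} {a : ℝ}

/-- The displacement of the flow from `a` at time `t₀`, on the scale `c ^ (1 / 4)` and discounted
by the linear growth. -/
noncomputable def scaledFlow (l a t₀ c : ℝ) (θ : ℕ → ℝ) : ℝ :=
  Real.exp (-(l * t₀)) * ((harmonicFlow c θ a ⌊t₀ / c⌋₊ - a) / c ^ (1 / 4 : ℝ))

theorem measurable_scaledFlow (hθ : ∀ n, Measurable (θ n)) (l a t₀ c : ℝ) :
    Measurable fun ω => scaledFlow l a t₀ c fun i => θ i ω :=
  ((((measurable_harmonicFlow c a _).comp (measurable_pi_lambda _ hθ)).sub_const a).div_const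
    _).const_mul _

/-- The variance of the limiting Gaussian fluctuation. -/
noncomputable def limitVar (h : ℝ → ℝ) (a t₀ : ℝ) : ℝ :=
  2 * slitSqLimit * h a *
    ((1 - Real.exp (-(2 * deriv (drift h) a * t₀))) / (2 * deriv (drift h) a))

theorem tendsto_integral_exp_scaledFlow (hs : ContDiff ℝ 2 h) (hper : Function.Periodic h 1)
    (h0 : ∀ x, 0 ≤ h x) (hmass : ∫ x in (0 : ℝ)..1, h x = 1)
    (ha : drift h a = 0) (hl : 0 < deriv (drift h) a)
    (hθ : ∀ n, Measurable (θ n)) (hi : iIndepFun θ μ) (hlaw : ∀ n, μ.map (θ n) = angleLaw h)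
    {t₀ : ℝ} (ht : 0 ≤ t₀) (ξ : ℝ) :
    Tendsto (fun c => ∫ ω, Complex.exp ((ξ * scaledFlow (deriv (drift h) a) a t₀ c
      (fun i => θ i ω) : ℝ) * Complex.I) ∂μ) (𝓝[>] 0)
      (𝓝 (Real.exp (-(limitVar h a t₀ * ξ ^ 2 / 2)) : ℂ)) := by
  have := isProbabilityMeasure_angleLaw hs.continuous h0 hmass
  obtain ⟨L, -, hb⟩ := regularDrift_drift hs hper
  obtain ⟨A, C, ε, hε, hev⟩ := exists_stepMoments hs h0 hper a
  unfold limitVar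
  set l := deriv (drift h) a
  set κ := 2 * slitSqLimit * h a
  set G := 2 * L + 2 * A + (κ + 1 + C) with hG
  set M := t₀ * G * Real.exp (t₀ * G) with hM
  set v : ℝ → ℕ → ℝ := fun c n =>
    ξ * Real.exp (-(l * t₀) + l * (c * ((⌊t₀ / c⌋₊ : ℝ) - n))) with hv
  set P : ℝ → ℝ := fun c =>
    ∑ j ∈ Finset.range ⌊t₀ / c⌋₊, v c (j + 1) ^ 2 * κ * c / 2 with hP
  have hPlim : Tendsto P (𝓝[>] 0) (𝓝 (κ * ((1 - Real.exp (-(2 * l * t₀))) / (2 * l)) * ξ ^ 2 / 2)) := by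
    have := ((tendsto_geometric_variance ht hl).const_mul (κ * ξ ^ 2 / 2))
    rw [show κ * ξ ^ 2 / 2 * ((1 - Real.exp (-(2 * l * t₀))) / (2 * l)) =
      κ * ((1 - Real.exp (-(2 * l * t₀))) / (2 * l)) * ξ ^ 2 / 2 by ring] at this
    refine this.congr fun c => ?_
    rw [hP, Finset.mul_sum]
    refine Finset.sum_congr rfl fun j _ => ?_
    rw [hv]
    ring
  have hmain : Tendsto (fun c => ∫ ω, Complex.exp ((ξ * scaledFlow l a t₀ c
      (fun i => θ i ω) : ℝ) * Complex.I) ∂μ - (Real.exp (-P c) : ℂ)) (𝓝[>] 0) (𝓝 0) := by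
    have hb0 : Tendsto (fun c : ℝ => t₀ * (StepMoments.stepCoeff l κ A C L |ξ| * (c ^ (1 / 8 : ℝ) + ε c) *
        (1 + M))) (𝓝[>] 0) (𝓝 (t₀ * (StepMoments.stepCoeff l κ A C L |ξ| * (0 + 0) * (1 + M)))) :=
      ((((tendsto_rpow_zero (by norm_num)).add hε).const_mul _).mul_const _).const_mul _
    rw [add_zero, mul_zero, zero_mul, mul_zero] at hb0
    refine squeeze_zero_norm' ?_ hb0
    have hc1 : ∀ᶠ c in 𝓝[>] (0 : ℝ), l * c ≤ 1 := by
      have : Tendsto (fun c : ℝ => l * c) (𝓝[>] 0) (𝓝 (l * 0)) :=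
        (tendsto_id.mono_left nhdsWithin_le_nhds).const_mul l
      rw [mul_zero] at this
      exact this.eventually (ge_mem_nhds zero_lt_one)
    have hc2 : ∀ᶠ c in 𝓝[>] (0 : ℝ), |ξ| * c ^ (1 / 4 : ℝ) ≤ 1 := by
      have := (tendsto_rpow_zero (r := 1 / 4) (by norm_num)).const_mul |ξ|
      rw [mul_zero] at this
      exact this.eventually (ge_mem_nhds zero_lt_one)
    filter_upwards [hev, hc1, hc2, self_mem_nhdsWithin] with c hst hc1 hc2 hc
    have hc : 0 < c := hc
    have hL : 0 ≤ L := (abs_nonneg _).trans (hb.bound 0)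
    have hA := hst.A_nonneg
    have hC := hst.C_nonneg
    have hκ := hst.kappa_nonneg
    have hG0 : 0 ≤ G := by positivity
    have e8 := rpow_eighth_pow hc.le
    have e2 := rpow_eighth_sq hc.le
    set N := ⌊t₀ / c⌋₊ with hN
    have hNc : (N : ℝ) * c ≤ t₀ := floor_div_mul_le ht hc
    have hnc : ∀ n ≤ N, (n : ℝ) * c ≤ t₀ := fun n hn =>
      (mul_le_mul_of_nonneg_right (Nat.cast_le.2 hn) hc.le).trans hNc
    have key := hst.norm_charFun_harmonicFlow_sub_le hb ha hl.le (by rwa [e8]) hθ hi hlaw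
      (Ξ := |ξ|) (M := M) (by rwa [e2]) (v c) (N := N) (fun n hn => ?_) (fun n hn => ?_)
      (fun n hn => ?_) le_rfl
    · have hvN : v c N = ξ * Real.exp (-(l * t₀)) := by
        rw [hv]
        simp only [← hN, sub_self, mul_zero, add_zero]
      rw [e8, e2, hvN] at key
      have e : ∀ ω, ξ * scaledFlow l a t₀ c (fun i => θ i ω) = ξ * Real.exp (-(l * t₀)) *
          ((harmonicFlow c (fun i => θ i ω) a N - a) / c ^ (1 / 4 : ℝ)) := fun ω => by
        rw [scaledFlow, mul_assoc]
      simp_rw [e]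
      refine key.trans ?_
      rw [← mul_assoc]
      refine mul_le_mul_of_nonneg_right hNc ?_
      have := hst.eps_nonneg
      have := hst.q_pos
      have : 0 ≤ M := by positivity
      unfold StepMoments.stepCoeff
      positivity
    · rw [hv, abs_mul, abs_of_pos (Real.exp_pos _)]
      refine mul_le_of_le_one_right (abs_nonneg _) (Real.exp_le_one_iff.2 ?_)
      have : c * ((N : ℝ) - n) ≤ t₀ := by
        have : 0 ≤ (n : ℝ) * c := by positivity
        linarith
      nlinarith
    · have hl' : deriv (drift h) a = l := rfl
      rw [hv, e8, mul_assoc, ← Real.exp_add, hl']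
      push_cast
      ring_nf
    · have h1 := hst.integral_sq_harmonicFlow_le hb ha hθ hi hlaw n
      refine h1.trans ?_
      rw [e8, ← mul_assoc]
      have := hnc n hn
      rw [hM]
      gcongr
  have hexp : Tendsto (fun c => (Real.exp (-P c) : ℂ)) (𝓝[>] 0)
      (𝓝 (Real.exp (-(κ * ((1 - Real.exp (-(2 * l * t₀))) / (2 * l)) * ξ ^ 2 / 2)) : ℂ)) :=
    (Complex.continuous_ofReal.tendsto _).comp ((Real.continuous_exp.tendsto _).comp hPlim.neg)
  simpa using hmain.add hexp

/-- Weak convergence of the rescaled flow to a centred Gaussian. -/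
theorem tendsto_measureReal_scaledFlow (hs : ContDiff ℝ 2 h) (hper : Function.Periodic h 1)
    (h0 : ∀ x, 0 ≤ h x) (hmass : ∫ x in (0 : ℝ)..1, h x = 1)
    (ha : drift h a = 0) (hl : 0 < deriv (drift h) a)
    (hθ : ∀ n, Measurable (θ n)) (hi : iIndepFun θ μ) (hlaw : ∀ n, μ.map (θ n) = angleLaw h)
    {t₀ : ℝ} (ht : 0 ≤ t₀) {v : NNReal} (hv : (v : ℝ) = limitVar h a t₀) {E : Set ℝ}
    (hE : MeasurableSet E) (hfr : gaussianReal 0 v (frontier E) = 0) :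
    Tendsto (fun c => μ.real {ω | scaledFlow (deriv (drift h) a) a t₀ c (fun i => θ i ω) ∈ E})
      (𝓝[>] 0) (𝓝 ((gaussianReal 0 v).real E)) := by
  refine tendsto_of_seq_tendsto fun u hu => ?_
  have hWm : ∀ c, Measurable fun ω => scaledFlow (deriv (drift h) a) a t₀ c (fun i => θ i ω) :=
    measurable_scaledFlow hθ _ _ _
  let Q : ℕ → ProbabilityMeasure ℝ := fun n =>
    ⟨μ.map fun ω => scaledFlow (deriv (drift h) a) a t₀ (u n) (fun i => θ i ω),
      Measure.isProbabilityMeasure_map (hWm _).aemeasurable⟩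
  let Q₀ : ProbabilityMeasure ℝ := ⟨gaussianReal 0 v, inferInstance⟩
  have hQ : Tendsto Q atTop (𝓝 Q₀) := by
    refine ProbabilityMeasure.tendsto_of_tendsto_charFun fun ξ => ?_
    have h1 := (tendsto_integral_exp_scaledFlow (μ := μ) hs hper h0 hmass ha hl hθ hi hlaw ht ξ).comp hu
    have h2 : charFun (Q₀ : Measure ℝ) ξ = (Real.exp (-(limitVar h a t₀ * ξ ^ 2 / 2)) : ℂ) := by
      change charFun (gaussianReal 0 v) ξ = _
      rw [charFun_gaussianReal, ← hv, Complex.ofReal_exp]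
      congr 1
      push_cast
      ring
    rw [h2]
    refine h1.congr fun n => ?_
    change _ = charFun (μ.map _) ξ
    rw [charFun_apply_real, integral_map (hWm _).aemeasurable (by fun_prop)]
    simp
  have h3 := ProbabilityMeasure.tendsto_measure_of_null_frontier_of_tendsto' hQ (E := E) hfr
  have h4 := (ENNReal.tendsto_toReal (measure_ne_top (gaussianReal 0 v) E)).comp h3
  refine h4.congr fun n => ?_
  change ((μ.map _) E).toReal = μ.real _
  rw [Measure.map_apply (hWm _) hE]
  rfl

end Limit

namespace RegularDrift

variable {b : ℝ → ℝ} {L : ℝ}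

theorem nonneg (hb : RegularDrift b L) : 0 ≤ L := (abs_nonneg _).trans (hb.bound 0)

theorem lipschitzWith (hb : RegularDrift b L) : LipschitzWith L.toNNReal b :=
  LipschitzWith.of_dist_le_mul fun x y => by
    rw [Real.coe_toNNReal _ hb.nonneg]
    exact hb.abs_sub_le x y

/-- Solutions on bounded time intervals. -/
theorem exists_solution_Ioo (hb : RegularDrift b L) (x : ℝ) (n : ℕ) :
    ∃ f : ℝ → ℝ, f 0 = x ∧ ∀ s ∈ Set.Ioo (-(n + 1 : ℝ)) (n + 1), HasDerivAt f (b (f s)) s := by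
  have hn : (0 : ℝ) < n + 1 := by positivity
  have h0 : (0 : ℝ) ∈ Set.Icc (-(n + 1 : ℝ)) (n + 1) := ⟨by linarith, hn.le⟩
  have hP : IsPicardLindelof (fun _ => b) (⟨0, h0⟩ : Set.Icc (-(n + 1 : ℝ)) (n + 1)) x
      (L.toNNReal * (n + 1)) 0 L.toNNReal L.toNNReal := by
    refine ⟨fun _ _ => hb.lipschitzWith.lipschitzOnWith, fun _ _ => continuousOn_const,
      fun _ _ y _ => ?_, ?_⟩
    · rw [Real.coe_toNNReal _ hb.nonneg]
      exact hb.bound y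
    · push_cast
      simp
  obtain ⟨f, hf0, hf⟩ := hP.exists_eq_forall_mem_Icc_hasDerivWithinAt₀
  exact ⟨f, hf0, fun s hs => (hf s (Set.Ioo_subset_Icc_self hs)).hasDerivAt (Icc_mem_nhds hs.1 hs.2)⟩

/-- Global existence of solutions. -/
theorem exists_solution (hb : RegularDrift b L) (x : ℝ) :
    ∃ f : ℝ → ℝ, f 0 = x ∧ ∀ s, HasDerivAt f (b (f s)) s := by
  choose f hf0 hf using hb.exists_solution_Ioo x
  have huniq : ∀ m n : ℕ, m ≤ n → ∀ s ∈ Set.Ioo (-(m + 1 : ℝ)) (m + 1), f m s = f n s := by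
    intro m n hmn
    have hmn' : (m : ℝ) ≤ n := Nat.cast_le.2 hmn
    have hm : (0 : ℝ) < m + 1 := by positivity
    exact ODE_solution_unique_of_mem_Ioo (v := fun _ => b) (s := fun _ => Set.univ)
      (t₀ := 0) (fun _ _ => hb.lipschitzWith.lipschitzOnWith) ⟨by linarith, hm⟩
      (fun t ht => ⟨hf m t ht, trivial⟩)
      (fun t ht => ⟨hf n t ⟨by linarith [ht.1], by linarith [ht.2]⟩, trivial⟩)
      (by rw [hf0, hf0])
  refine ⟨fun s => f ⌈|s|⌉₊ s, by simp [hf0], fun s => ?_⟩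
  have hmem : ∀ t : ℝ, t ∈ Set.Ioo (-((⌈|t|⌉₊ : ℝ) + 1)) (⌈|t|⌉₊ + 1) := fun t => by
    have := abs_le.1 (Nat.le_ceil |t|)
    exact ⟨by linarith, by linarith⟩
  set n := ⌈|s|⌉₊ + 1 with hn
  have hsn : |s| < n := by
    have := Nat.le_ceil |s|
    rw [hn]
    push_cast
    linarith
  have hev : (fun t : ℝ => f ⌈|t|⌉₊ t) =ᶠ[𝓝 s] f n := by
    have : ∀ᶠ t : ℝ in 𝓝 s, |t| < (n : ℝ) :=
      (continuous_abs.tendsto s).eventually (gt_mem_nhds hsn)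
    filter_upwards [this] with t ht
    exact huniq _ _ (Nat.ceil_le.2 ht.le) t (hmem t)
  have h2 : HasDerivAt (f n) (b (f n s)) s := by
    refine hf n s ?_
    have := abs_lt.1 hsn
    exact ⟨by linarith, by linarith⟩
  have h3 := h2.congr_of_eventuallyEq hev
  rwa [← hev.eq_of_nhds] at h3

theorem odeFlow_spec (hb : RegularDrift b L) (x : ℝ) :
    odeFlow b 0 x = x ∧ ∀ s, HasDerivAt (fun t => odeFlow b t x) (b (odeFlow b s x)) s :=
  Classical.epsilon_spec (hb.exists_solution x)

end RegularDrift

/-- A solution of `y' = b(y)` started to the right of an unstable fixed point `a` of a regular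
drift, inside a neighbourhood `[a, r]` on which the drift is uniformly expanding. -/
structure ExpandingPath (b : ℝ → ℝ) (L a r : ℝ) (y : ℝ → ℝ) : Prop where
  regular : RegularDrift b L
  fixed : b a = 0
  unstable : 0 < deriv b a
  expanding : ∀ x ∈ Set.Icc a r, deriv b a / 2 ≤ deriv b x
  left : a < y 0
  right : y 0 < r
  solution : ∀ s, HasDerivAt y (b (y s)) s

/-- The regularized logarithmic potential `R(x) = ∫_a^x (b'(u) - b'(a)) / (b'(a) b(u)) du`. -/
noncomputable def linearDefect (b : ℝ → ℝ) (a x : ℝ) : ℝ :=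
  ∫ u in a..x, (deriv b u - deriv b a) / (deriv b a * b u)

/-- The travel time function: a primitive of `1 / b` to the right of the fixed point. -/
noncomputable def travelTime (b : ℝ → ℝ) (a x : ℝ) : ℝ :=
  Real.log (b x) / deriv b a - linearDefect b a x

section Potential

variable {b : ℝ → ℝ} {L a r : ℝ}

theorem drift_lower_bound (hb : RegularDrift b L) (h0 : b a = 0)
    (hexp : ∀ x ∈ Set.Icc a r, deriv b a / 2 ≤ deriv b x) {x : ℝ} (hx : x ∈ Set.Icc a r) :
    deriv b a / 2 * (x - a) ≤ b x := by
  have := Convex.mul_sub_le_image_sub_of_le_deriv (convex_Icc a r)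
    hb.differentiable.continuous.continuousOn hb.differentiable.differentiableOn
    (C := deriv b a / 2) (fun z hz => hexp z (interior_subset hz)) a ⟨le_rfl, hx.1.trans hx.2⟩ x hx
    hx.1
  rwa [h0, sub_zero] at this

theorem drift_pos (hb : RegularDrift b L) (h0 : b a = 0) (hl : 0 < deriv b a)
    (hexp : ∀ x ∈ Set.Icc a r, deriv b a / 2 ≤ deriv b x) {x : ℝ} (hx : x ∈ Set.Ioc a r) :
    0 < b x := by
  refine lt_of_lt_of_le ?_ (drift_lower_bound hb h0 hexp ⟨hx.1.le, hx.2⟩)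
  have := hx.1
  have : 0 < x - a := by linarith
  positivity

theorem abs_defect_integrand_le (hb : RegularDrift b L) (h0 : b a = 0) (hl : 0 < deriv b a)
    (hexp : ∀ x ∈ Set.Icc a r, deriv b a / 2 ≤ deriv b x) {x : ℝ} (hx : x ∈ Set.Ioc a r) :
    |(deriv b x - deriv b a) / (deriv b a * b x)| ≤
      2 * L / deriv b a ^ 2 * (x - a) ^ (-(1 / 2) : ℝ) := by
  have hxa : 0 < x - a := sub_pos.2 hx.1
  have h1 := hb.deriv_holder x a
  rw [abs_of_pos hxa] at h1
  have h2 := drift_lower_bound hb h0 hexp ⟨hx.1.le, hx.2⟩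
  have h3 := drift_pos hb h0 hl hexp hx
  have hL := hb.nonneg
  rw [abs_div, abs_of_pos (mul_pos hl h3)]
  calc |deriv b x - deriv b a| / (deriv b a * b x) ≤
      L * Real.sqrt (x - a) / (deriv b a * (deriv b a / 2 * (x - a))) := by gcongr
    _ = 2 * L / deriv b a ^ 2 * (x - a) ^ (-(1 / 2) : ℝ) := by
        rw [Real.rpow_neg hxa.le, ← Real.sqrt_eq_rpow]
        have hs : 0 < Real.sqrt (x - a) := Real.sqrt_pos.2 hxa
        field_simp
        rw [Real.sq_sqrt hxa.le]

theorem intervalIntegrable_sub_rpow (a x : ℝ) :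
    IntervalIntegrable (fun u => (u - a) ^ (-(1 / 2) : ℝ)) volume a x := by
  have := (intervalIntegral.intervalIntegrable_rpow' (a := 0) (b := x - a)
    (r := -(1 / 2)) (by norm_num)).comp_sub_right a
  simpa using this

theorem measurable_defect_integrand (hb : RegularDrift b L) :
    Measurable fun u => (deriv b u - deriv b a) / (deriv b a * b u) :=
  (hb.continuous_deriv.measurable.sub_const _).div
    (hb.differentiable.continuous.measurable.const_mul _)

theorem intervalIntegrable_defect (hb : RegularDrift b L) (h0 : b a = 0) (hl : 0 < deriv b a)
    (hexp : ∀ x ∈ Set.Icc a r, deriv b a / 2 ≤ deriv b x) {x : ℝ} (hx : x ∈ Set.Icc a r) :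
    IntervalIntegrable (fun u => (deriv b u - deriv b a) / (deriv b a * b u)) volume a x :=
  intervalIntegrable_of_le hx.1 (measurable_defect_integrand hb)
    ((intervalIntegrable_sub_rpow a x).const_mul _)
    fun _ hz => abs_defect_integrand_le hb h0 hl hexp ⟨hz.1, hz.2.trans hx.2⟩

theorem abs_linearDefect_le (hb : RegularDrift b L) (h0 : b a = 0) (hl : 0 < deriv b a)
    (hexp : ∀ x ∈ Set.Icc a r, deriv b a / 2 ≤ deriv b x) {x : ℝ} (hx : x ∈ Set.Icc a r) :
    |linearDefect b a x| ≤ 4 * L / deriv b a ^ 2 * Real.sqrt (x - a) := by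
  refine (abs_integral_le_of_le hx.1 ((intervalIntegrable_sub_rpow a x).const_mul
    (2 * L / deriv b a ^ 2))
    fun z hz => abs_defect_integrand_le hb h0 hl hexp ⟨hz.1, hz.2.trans hx.2⟩).trans (le_of_eq ?_)
  rw [intervalIntegral.integral_const_mul,
    intervalIntegral.integral_comp_sub_right (fun u => u ^ (-(1 / 2) : ℝ)), sub_self,
    integral_rpow (by norm_num), Real.zero_rpow (by norm_num), Real.sqrt_eq_rpow]
  norm_num
  ring

theorem hasDerivAt_travelTime (hb : RegularDrift b L) (h0 : b a = 0) (hl : 0 < deriv b a)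
    (hexp : ∀ x ∈ Set.Icc a r, deriv b a / 2 ≤ deriv b x) {x : ℝ} (hx : x ∈ Set.Ioc a r) :
    HasDerivAt (travelTime b a) (1 / b x) x := by
  have hbx := drift_pos hb h0 hl hexp hx
  have h1 := intervalIntegral.integral_hasDerivAt_right
    (intervalIntegrable_defect hb h0 hl hexp ⟨hx.1.le, hx.2⟩)
    (measurable_defect_integrand hb).stronglyMeasurable.stronglyMeasurableAtFilter
    ((hb.continuous_deriv.continuousAt.sub continuousAt_const).div
      (continuousAt_const.mul hb.differentiable.continuous.continuousAt)
      (mul_pos hl hbx).ne')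
  have h2 := (((hb.differentiable x).hasDerivAt.log hbx.ne').div_const (deriv b a)).sub h1
  refine h2.congr_deriv ?_
  field_simp
  ring

theorem tendsto_linearDefect (hb : RegularDrift b L) (h0 : b a = 0) (hl : 0 < deriv b a)
    (hexp : ∀ x ∈ Set.Icc a r, deriv b a / 2 ≤ deriv b x) (har : a < r) :
    Tendsto (linearDefect b a) (𝓝[>] a) (𝓝 0) := by
  have h : Tendsto (fun x => 4 * L / deriv b a ^ 2 * Real.sqrt (x - a)) (𝓝 a)
      (𝓝 (4 * L / deriv b a ^ 2 * Real.sqrt (a - a))) := Continuous.tendsto (by fun_prop) a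
  rw [sub_self, Real.sqrt_zero, mul_zero] at h
  refine squeeze_zero_norm' ?_ (h.mono_left nhdsWithin_le_nhds)
  filter_upwards [Ioo_mem_nhdsGT har] with x hx
  exact abs_linearDefect_le hb h0 hl hexp ⟨hx.1.le, hx.2.le⟩

theorem tendsto_log_drift (hb : RegularDrift b L) (h0 : b a = 0) (hl : 0 < deriv b a)
    (hexp : ∀ x ∈ Set.Icc a r, deriv b a / 2 ≤ deriv b x) (har : a < r) :
    Tendsto (fun x => Real.log (b x) - Real.log (deriv b a) - Real.log (x - a)) (𝓝[>] a) (𝓝 0) := by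
  have h1 := (hasDerivAt_iff_tendsto_slope.1 (hb.differentiable a).hasDerivAt).mono_left
    (nhdsWithin_mono a (fun x (hx : a < x) => hx.ne' : Set.Ioi a ⊆ {a}ᶜ))
  have h2 := ((Real.continuousAt_log hl.ne').tendsto.comp h1).sub_const (Real.log (deriv b a))
  rw [sub_self] at h2
  refine h2.congr' ?_
  filter_upwards [Ioo_mem_nhdsGT har] with x hx
  have hxa : 0 < x - a := sub_pos.2 hx.1
  have hbx := drift_pos hb h0 hl hexp ⟨hx.1, hx.2.le⟩
  simp only [Function.comp, slope_def_field, h0, sub_zero]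
  rw [Real.log_div hbx.ne' hxa.ne']
  ring

end Potential

namespace ExpandingPath

variable {b : ℝ → ℝ} {L a r : ℝ} {y : ℝ → ℝ}

/-- The logarithmic expansion `∫_0^s b'(y)` along the path. -/
noncomputable def expansion (b y : ℝ → ℝ) (s : ℝ) : ℝ := ∫ u in (0 : ℝ)..s, deriv b (y u)

theorem continuous_path (h : ExpandingPath b L a r y) : Continuous y :=
  continuous_iff_continuousAt.2 fun s => (h.solution s).continuousAt

theorem continuous_deriv_path (h : ExpandingPath b L a r y) :
    Continuous fun s => deriv b (y s) :=
  h.regular.continuous_deriv.comp h.continuous_path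

theorem hasDerivAt_expansion (h : ExpandingPath b L a r y) (s : ℝ) :
    HasDerivAt (expansion b y) (deriv b (y s)) s :=
  intervalIntegral.integral_hasDerivAt_right (h.continuous_deriv_path.intervalIntegrable _ _)
    h.continuous_deriv_path.stronglyMeasurable.stronglyMeasurableAtFilter
    h.continuous_deriv_path.continuousAt

theorem expansion_zero : expansion b y 0 = 0 := intervalIntegral.integral_same

theorem drift_start_pos (h : ExpandingPath b L a r y) : 0 < b (y 0) :=
  drift_pos h.regular h.fixed h.unstable h.expanding ⟨h.left, h.right.le⟩

theorem drift_path (h : ExpandingPath b L a r y) (s : ℝ) :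
    b (y s) = b (y 0) * Real.exp (expansion b y s) := by
  have hd : ∀ s, HasDerivAt (fun s => b (y s) * Real.exp (-expansion b y s)) 0 s := fun s => by
    have h1 : HasDerivAt (fun s => b (y s)) (deriv b (y s) * b (y s)) s :=
      (h.regular.differentiable (y s)).hasDerivAt.comp s (h.solution s)
    have h2 := h1.mul (h.hasDerivAt_expansion s).neg.exp
    refine h2.congr_deriv ?_
    ring
  have := is_const_of_deriv_eq_zero (fun s => (hd s).differentiableAt) (fun s => (hd s).deriv) s 0
  simp only [expansion_zero, neg_zero, Real.exp_zero, mul_one] at this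
  rw [← this, mul_assoc, ← Real.exp_add]
  simp

theorem drift_path_pos (h : ExpandingPath b L a r y) (s : ℝ) : 0 < b (y s) := by
  rw [h.drift_path]
  exact mul_pos h.drift_start_pos (Real.exp_pos _)

theorem strictMono (h : ExpandingPath b L a r y) : StrictMono y :=
  strictMono_of_deriv_pos fun s => by
    rw [(h.solution s).deriv]
    exact h.drift_path_pos s

theorem lt_path (h : ExpandingPath b L a r y) (s : ℝ) : a < y s := by
  by_contra hcon
  have hs : s ≤ 0 := by
    by_contra hs
    have := h.strictMono (not_le.1 hs)
    have := h.left
    linarith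
  obtain ⟨u, -, hu⟩ := intermediate_value_Icc hs h.continuous_path.continuousOn
    (⟨not_lt.1 hcon, h.left.le⟩ : a ∈ Set.Icc (y s) (y 0))
  have := h.drift_path_pos u
  rw [hu, h.fixed] at this
  exact lt_irrefl _ this

theorem travelTime_path (h : ExpandingPath b L a r y) {s : ℝ} (hs : 0 ≤ s) (hr : y s ≤ r) :
    travelTime b a (y s) = travelTime b a (y 0) + s := by
  have hd : ∀ u ∈ Set.Icc 0 s, HasDerivAt (fun u => travelTime b a (y u) - u) 0 u := by
    intro u hu
    have hmem : y u ∈ Set.Ioc a r := ⟨h.lt_path u, (h.strictMono.monotone hu.2).trans hr⟩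
    have h1 := (hasDerivAt_travelTime h.regular h.fixed h.unstable h.expanding hmem).comp u
      (h.solution u)
    refine (h1.sub (hasDerivAt_id u)).congr_deriv ?_
    have := h.drift_path_pos u
    field_simp
    ring
  have := constant_of_has_deriv_right_zero (fun u hu => (hd u hu).continuousAt.continuousWithinAt)
    (fun u hu => (hd u ⟨hu.1, hu.2.le⟩).hasDerivWithinAt) s ⟨hs, le_rfl⟩
  simp only [sub_zero] at this
  linarith

/-- The time at which the path reaches the right end of the neighbourhood. -/
noncomputable def hitTime (b : ℝ → ℝ) (a r x : ℝ) : ℝ := travelTime b a r - travelTime b a x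

theorem hitTime_spec (h : ExpandingPath b L a r y) :
    0 < hitTime b a r (y 0) ∧ y (hitTime b a r (y 0)) = r := by
  set m := deriv b a / 2 * (y 0 - a) with hm
  have hm0 : 0 < m := mul_pos (half_pos h.unstable) (sub_pos.2 h.left)
  have hex : ∃ s, 0 ≤ s ∧ r ≤ y s := by
    by_contra! hcon
    set S := (r - y 0) / m with hS
    have hS0 : 0 ≤ S := div_nonneg (sub_pos.2 h.right).le hm0.le
    have := Convex.mul_sub_le_image_sub_of_le_deriv (convex_Icc 0 S)
      h.continuous_path.continuousOn (fun u _ => (h.solution u).differentiableAt.differentiableWithinAt)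
      (C := m) (fun u hu => ?_) 0 ⟨le_rfl, hS0⟩ S ⟨hS0, le_rfl⟩ hS0
    · rw [sub_zero, hS, mul_div_cancel₀ _ hm0.ne'] at this
      have := hcon S hS0
      linarith
    · have hu0 : 0 ≤ u := (interior_subset hu).1
      rw [(h.solution u).deriv]
      have h1 := drift_lower_bound h.regular h.fixed h.expanding
        (⟨(h.lt_path u).le, (hcon u hu0).le⟩ : y u ∈ Set.Icc a r)
      have h2 := h.strictMono.monotone hu0
      have h3 := h.unstable
      rw [hm]
      nlinarith
  obtain ⟨S, hS0, hS⟩ := hex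
  obtain ⟨s, hs, hsr⟩ := intermediate_value_Icc hS0 h.continuous_path.continuousOn
    (⟨h.right.le, hS⟩ : r ∈ Set.Icc (y 0) (y S))
  have h1 := h.travelTime_path hs.1 hsr.le
  rw [hsr] at h1
  have h2 : hitTime b a r (y 0) = s := by
    unfold hitTime
    linarith
  rw [h2]
  refine ⟨lt_of_le_of_ne hs.1 ?_, hsr⟩
  rintro rfl
  exact h.right.ne hsr

theorem notMem_Icc_iff (h : ExpandingPath b L a r y) {xm : ℝ} (hxm : xm < a) (s : ℝ) :
    y s ∉ Set.Icc xm r ↔ hitTime b a r (y 0) < s := by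
  rw [← h.strictMono.lt_iff_lt, h.hitTime_spec.2, Set.mem_Icc, not_and, not_le]
  exact ⟨fun hh => hh (hxm.trans (h.lt_path s)).le, fun hh _ => hh⟩

theorem path_le (h : ExpandingPath b L a r y) {s : ℝ} (hs : s ≤ hitTime b a r (y 0)) : y s ≤ r := by
  rw [← h.hitTime_spec.2]
  exact h.strictMono.monotone hs

theorem expansion_eq_log (h : ExpandingPath b L a r y) (s : ℝ) :
    expansion b y s = Real.log (b (y s)) - Real.log (b (y 0)) := by
  rw [h.drift_path s, Real.log_mul h.drift_start_pos.ne' (Real.exp_ne_zero _), Real.log_exp]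
  ring

theorem expansion_hitTime (h : ExpandingPath b L a r y) :
    expansion b y (hitTime b a r (y 0)) = Real.log (b r) - Real.log (b (y 0)) := by
  rw [h.expansion_eq_log, h.hitTime_spec.2]

theorem monotoneOn_expansion (h : ExpandingPath b L a r y) :
    MonotoneOn (expansion b y) (Set.Iic (hitTime b a r (y 0))) := by
  refine monotoneOn_of_deriv_nonneg (convex_Iic _)
    (fun s _ => (h.hasDerivAt_expansion s).continuousAt.continuousWithinAt)
    (fun s _ => (h.hasDerivAt_expansion s).differentiableAt.differentiableWithinAt) fun s hs => ?_
  rw [(h.hasDerivAt_expansion s).deriv]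
  have := h.expanding (y s) ⟨(h.lt_path s).le, h.path_le (show s ∈ Set.Iic _ from interior_subset hs)⟩
  have := h.unstable
  linarith

/-- The expansion up to time `s` is linear up to a bounded error, before leaving `[a, r]`. -/
theorem expansion_le (h : ExpandingPath b L a r y) {s : ℝ} (hs : 0 ≤ s)
    (hs' : s ≤ hitTime b a r (y 0)) :
    expansion b y s ≤ deriv b a * (s + 8 * L / deriv b a ^ 2 * Real.sqrt (r - a)) := by
  have hl := h.unstable
  have h1 := h.travelTime_path hs (h.path_le hs')
  have hb : ∀ u, y u ≤ r → |linearDefect b a (y u)| ≤ 4 * L / deriv b a ^ 2 * Real.sqrt (r - a) := by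
    intro u hu
    refine (abs_linearDefect_le h.regular h.fixed hl h.expanding ⟨(h.lt_path u).le, hu⟩).trans ?_
    have := h.regular.nonneg
    gcongr
  have h2 := abs_le.1 (hb s (h.path_le hs'))
  have h3 := abs_le.1 (hb 0 h.right.le)
  unfold travelTime at h1
  rw [h.expansion_eq_log]
  have h4 : Real.log (b (y s)) - Real.log (b (y 0)) =
      deriv b a * (s + (linearDefect b a (y s) - linearDefect b a (y 0))) := by
    field_simp at h1
    linarith
  rw [h4]
  refine mul_le_mul_of_nonneg_left ?_ hl.le
  have : 8 * L / deriv b a ^ 2 * Real.sqrt (r - a) =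
    2 * (4 * L / deriv b a ^ 2 * Real.sqrt (r - a)) := by ring
  linarith [h2.2, h3.1]

/-- The expansion over a fixed time window in the past is asymptotically linear. -/
theorem abs_expansion_past_le (h : ExpandingPath b L a r y) {t₀ : ℝ} (ht : 0 ≤ t₀) :
    |-expansion b y (-t₀) - deriv b a * t₀| ≤ L * Real.sqrt (y 0 - a) * t₀ := by
  have hL := h.regular.nonneg
  have e : -expansion b y (-t₀) - deriv b a * t₀ =
      ∫ u in (-t₀)..0, (deriv b (y u) - deriv b a) := by
    rw [intervalIntegral.integral_sub (h.continuous_deriv_path.intervalIntegrable _ _)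
      intervalIntegrable_const, intervalIntegral.integral_const, expansion,
      intervalIntegral.integral_symm]
    simp
    ring
  rw [e]
  have := intervalIntegral.norm_integral_le_of_norm_le_const (a := -t₀) (b := 0)
    (f := fun u => deriv b (y u) - deriv b a) (C := L * Real.sqrt (y 0 - a)) fun u hu => ?_
  · rwa [zero_sub, neg_neg, abs_of_nonneg ht] at this
  · rw [Set.uIoc_of_le (by linarith)] at hu
    refine (h.regular.deriv_holder _ _).trans ?_
    have h1 := h.lt_path u
    have h2 := h.strictMono.monotone hu.2
    rw [abs_of_pos (by linarith)]
    gcongr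

end ExpandingPath

/-- The exit time of `t ↦ y (t - t₀)` from `[xm, xp]` after time `t₀`. -/
noncomputable def pathExit (y : ℝ → ℝ) (xm xp t₀ : ℝ) : EReal :=
  sInf ((fun t : ℝ => (t : EReal)) '' {t : ℝ | t₀ ≤ t ∧ y (t - t₀) ∉ Set.Icc xm xp})

/-- The time at which the exponential growth with rate `β` passes the threshold. -/
noncomputable def pathGrowth (β : ℝ → ℝ) (t₀ c : ℝ) : EReal :=
  sInf ((fun t : ℝ => (t : EReal)) '' {t : ℝ | t₀ ≤ t ∧
    c ^ (-(1 / 4) : ℝ) * Real.exp ((∫ s in (0 : ℝ)..t₀, β (s - t₀)) / 8) <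
      Real.exp (∫ s in (0 : ℝ)..t, β (s - t₀))})

/-- The exit time capped by the growth time and by `c ^ (-1 / 2)`. -/
noncomputable def pathCapped (y β : ℝ → ℝ) (xm xp t₀ c : ℝ) : EReal :=
  min (pathExit y xm xp t₀) (min (pathGrowth β t₀ c) ((c ^ (-(1 / 2) : ℝ) : ℝ) : EReal))

theorem exitTime_eq_pathExit (h : ℝ → ℝ) (a xm xp t₀ c : ℝ) (θ : ℕ → ℝ) :
    exitTime h a xm xp t₀ c θ =
      pathExit (fun s => odeFlow (drift h) s (harmonicFlow c θ a ⌊t₀ / c⌋₊)) xm xp t₀ := rfl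

theorem cappedTime_eq_pathCapped (h : ℝ → ℝ) (a xm xp t₀ c : ℝ) (θ : ℕ → ℝ) :
    cappedTime h a xm xp t₀ c θ =
      pathCapped (fun s => odeFlow (drift h) s (harmonicFlow c θ a ⌊t₀ / c⌋₊))
        (fun s => deriv (drift h) (odeFlow (drift h) s (harmonicFlow c θ a ⌊t₀ / c⌋₊)))
        xm xp t₀ c := rfl

theorem pathExit_reflect (y : ℝ → ℝ) (a xm xp t₀ : ℝ) :
    pathExit (fun s => 2 * a - y s) (2 * a - xp) (2 * a - xm) t₀ = pathExit y xm xp t₀ := by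
  unfold pathExit
  congr 2
  ext t
  simp only [Set.mem_ofPred_eq, Set.mem_Icc, sub_le_sub_iff_left]
  rw [and_comm (a := y (t - t₀) ≤ xp)]

theorem pathCapped_reflect (y β : ℝ → ℝ) (a xm xp t₀ c : ℝ) :
    pathCapped (fun s => 2 * a - y s) β (2 * a - xp) (2 * a - xm) t₀ c =
      pathCapped y β xm xp t₀ c := by
  unfold pathCapped
  rw [pathExit_reflect]

namespace ExpandingPath

variable {b : ℝ → ℝ} {L a r : ℝ} {y : ℝ → ℝ} {xm t₀ c : ℝ}

theorem pathExit_eq (h : ExpandingPath b L a r y) (hxm : xm < a) :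
    pathExit y xm r t₀ = ((t₀ + hitTime b a r (y 0) : ℝ) : EReal) := by
  have hτ := h.hitTime_spec.1
  unfold pathExit
  have hset : {t : ℝ | t₀ ≤ t ∧ y (t - t₀) ∉ Set.Icc xm r} = Set.Ioi (t₀ + hitTime b a r (y 0)) := by
    ext t
    rw [Set.mem_ofPred_eq, h.notMem_Icc_iff hxm, Set.mem_Ioi]
    constructor
    · rintro ⟨-, h2⟩
      linarith
    · intro h2
      exact ⟨by linarith, by linarith⟩
  rw [hset]
  refine le_antisymm ?_ (le_sInf ?_)
  · refine le_of_forall_gt_imp_ge_of_dense fun z hz => ?_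
    obtain ⟨w, hw1, hw2⟩ := EReal.lt_iff_exists_real_btwn.1 hz
    have hmem : (w : EReal) ∈ (fun t : ℝ => (t : EReal)) '' Set.Ioi (t₀ + hitTime b a r (y 0)) :=
      ⟨w, EReal.coe_lt_coe_iff.1 hw1, rfl⟩
    exact (sInf_le hmem).trans hw2.le
  · rintro _ ⟨t, ht, rfl⟩
    exact EReal.coe_le_coe_iff.2 (le_of_lt ht)

theorem integral_deriv_path (h : ExpandingPath b L a r y) (t : ℝ) :
    ∫ s in (0 : ℝ)..t, deriv b (y (s - t₀)) = expansion b y (t - t₀) - expansion b y (-t₀) := by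
  rw [intervalIntegral.integral_comp_sub_right (fun s => deriv b (y s)), zero_sub, expansion,
    expansion, intervalIntegral.integral_interval_sub_left
    (h.continuous_deriv_path.intervalIntegrable _ _)
    (h.continuous_deriv_path.intervalIntegrable _ _)]

theorem growth_iff (h : ExpandingPath b L a r y) (hc : 0 < c) (t : ℝ) :
    c ^ (-(1 / 4) : ℝ) * Real.exp ((∫ s in (0 : ℝ)..t₀, deriv b (y (s - t₀))) / 8) <
      Real.exp (∫ s in (0 : ℝ)..t, deriv b (y (s - t₀))) ↔
    -(1 / 4) * Real.log c < expansion b y (t - t₀) + 7 / 8 * -expansion b y (-t₀) := by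
  rw [h.integral_deriv_path, h.integral_deriv_path, sub_self, expansion_zero, zero_sub,
    Real.rpow_def_of_pos hc, ← Real.exp_add, Real.exp_lt_exp]
  constructor <;> intro h <;> linarith

theorem pathCapped_eq_pathExit_iff (h : ExpandingPath b L a r y) (hxm : xm < a) (hc : 0 < c) :
    pathCapped y (fun s => deriv b (y s)) xm r t₀ c = pathExit y xm r t₀ ↔
      Real.log (b r) - Real.log (b (y 0)) + 7 / 8 * -expansion b y (-t₀) ≤ -(1 / 4) * Real.log c ∧
        t₀ + hitTime b a r (y 0) ≤ c ^ (-(1 / 2) : ℝ) := by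
  have hτ := h.hitTime_spec.1
  set τ := hitTime b a r (y 0) with hτdef
  unfold pathCapped
  rw [min_eq_left_iff, le_min_iff, h.pathExit_eq hxm, EReal.coe_le_coe_iff, ← hτdef]
  refine and_congr_left fun _ => ?_
  rw [pathGrowth, le_sInf_iff, ← h.expansion_hitTime, ← hτdef]
  constructor
  · intro hh
    by_contra! hcon
    have hcont : ContinuousAt (fun s => expansion b y s + 7 / 8 * -expansion b y (-t₀)) τ :=
      (h.hasDerivAt_expansion τ).continuousAt.add continuousAt_const
    have hev := (hcont.eventually (lt_mem_nhds hcon)).filter_mono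
      (nhdsWithin_le_nhds (s := Set.Iio τ))
    obtain ⟨s, hs1, hs2⟩ := (hev.and (Ioo_mem_nhdsLT hτ)).exists
    have := hh _ ⟨t₀ + s, ⟨by linarith [hs2.1], (h.growth_iff hc _).2 ?_⟩, rfl⟩
    · have := EReal.coe_le_coe_iff.1 this
      linarith [hs2.2]
    · rwa [add_sub_cancel_left]
  · rintro hh _ ⟨t, ⟨ht1, ht2⟩, rfl⟩
    rw [h.growth_iff hc] at ht2
    refine EReal.coe_le_coe_iff.2 ?_
    by_contra! hcon
    have : expansion b y (t - t₀) ≤ expansion b y τ :=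
      h.monotoneOn_expansion (by rw [Set.mem_Iic, ← hτdef]; linarith) (by rw [Set.mem_Iic])
        (by linarith)
    linarith

theorem le_toReal_pathCapped (h : ExpandingPath b L a r y) (hxm : xm < a) (hc : 0 < c)
    (hne : pathCapped y (fun s => deriv b (y s)) xm r t₀ c ≠ pathExit y xm r t₀) :
    min (c ^ (-(1 / 2) : ℝ)) ((-(1 / 4) * Real.log c - 7 / 8 * -expansion b y (-t₀)) / deriv b a +
      t₀ - 8 * L / deriv b a ^ 2 * Real.sqrt (r - a)) ≤
      (pathCapped y (fun s => deriv b (y s)) xm r t₀ c).toReal := by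
  have hl := h.unstable
  set bound := (-(1 / 4) * Real.log c - 7 / 8 * -expansion b y (-t₀)) / deriv b a +
      t₀ - 8 * L / deriv b a ^ 2 * Real.sqrt (r - a) with hbound
  set τ := hitTime b a r (y 0) with hτdef
  have hex := h.pathExit_eq (t₀ := t₀) hxm
  rw [← hτdef] at hex
  have hlt : pathCapped y (fun s => deriv b (y s)) xm r t₀ c < pathExit y xm r t₀ :=
    lt_of_le_of_ne (min_le_left _ _) hne
  have hkey : ((min (c ^ (-(1 / 2) : ℝ)) bound : ℝ) : EReal) ≤
      pathCapped y (fun s => deriv b (y s)) xm r t₀ c := by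
    have hcap : pathCapped y (fun s => deriv b (y s)) xm r t₀ c =
        min (pathGrowth (fun s => deriv b (y s)) t₀ c) ((c ^ (-(1 / 2) : ℝ) : ℝ) : EReal) := by
      unfold pathCapped at hlt ⊢
      exact min_eq_right (le_of_not_ge fun hcon => by
        rw [min_eq_left hcon] at hlt
        exact lt_irrefl _ hlt)
    rw [hcap]
    refine le_min ?_ (EReal.coe_le_coe_iff.2 (min_le_left _ _))
    by_contra! hcon
    rw [pathGrowth, sInf_lt_iff] at hcon
    obtain ⟨_, ⟨t, ⟨ht1, ht2⟩, rfl⟩, ht3⟩ := hcon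
    have ht3 := EReal.coe_lt_coe_iff.1 ht3
    have htb : t < bound := ht3.trans_le (min_le_right _ _)
    rw [h.growth_iff hc] at ht2
    have htτ : t < t₀ + τ := by
      have h1 : pathGrowth (fun s => deriv b (y s)) t₀ c ≤ (t : EReal) :=
        sInf_le ⟨t, ⟨ht1, (h.growth_iff hc t).2 ht2⟩, rfl⟩
      by_contra! hge
      have h2 : pathCapped y (fun s => deriv b (y s)) xm r t₀ c =
          ((c ^ (-(1 / 2) : ℝ) : ℝ) : EReal) := by
        rw [hcap]
        refine min_eq_right (le_of_not_gt fun hgt => ?_)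
        rw [hcap, min_eq_left hgt.le, pathGrowth, sInf_lt_iff] at hlt
        obtain ⟨_, ⟨u, ⟨hu1, hu2⟩, rfl⟩, hu3⟩ := hlt
        rw [hex] at hu3
        have hu3 := EReal.coe_lt_coe_iff.1 hu3
        rw [h.growth_iff hc] at hu2
        have h4 := h.expansion_le (s := u - t₀) (by linarith) (by rw [← hτdef]; linarith)
        have h5 : bound < u := by
          rw [hbound]
          have : (-(1 / 4) * Real.log c - 7 / 8 * -expansion b y (-t₀)) / deriv b a <
              u - t₀ + 8 * L / deriv b a ^ 2 * Real.sqrt (r - a) := by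
            rw [div_lt_iff₀ hl]
            linarith
          linarith
        linarith
      rw [h2, hex] at hlt
      have h6 := EReal.coe_lt_coe_iff.1 hlt
      have h7 := ht3.trans_le (min_le_left _ _)
      linarith
    have h4 := h.expansion_le (s := t - t₀) (by linarith) (by rw [← hτdef]; linarith)
    have h5 : (-(1 / 4) * Real.log c - 7 / 8 * -expansion b y (-t₀)) / deriv b a <
        t - t₀ + 8 * L / deriv b a ^ 2 * Real.sqrt (r - a) := by
      rw [div_lt_iff₀ hl]
      linarith
    linarith
  rw [← EReal.coe_le_coe_iff, EReal.coe_toReal]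
  · exact hkey
  · exact (hlt.trans_le le_top).ne
  · exact (lt_of_lt_of_le (EReal.bot_lt_coe _) hkey).ne'

end ExpandingPath

/-- A regular drift with an unstable fixed point `a`, uniformly expanding on `[a, r]`. -/
structure ExpandingDrift (b : ℝ → ℝ) (L a r : ℝ) : Prop where
  regular : RegularDrift b L
  fixed : b a = 0
  unstable : 0 < deriv b a
  expanding : ∀ x ∈ Set.Icc a r, deriv b a / 2 ≤ deriv b x
  lt_radius : a < r

theorem tendsto_rpow_neg_half_sub_log (k : ℝ) :
    Tendsto (fun c : ℝ => c ^ (-(1 / 2) : ℝ) + k * Real.log c) (𝓝[>] 0) atTop := by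
  have hu : Tendsto (fun c : ℝ => c ^ (-(1 / 4) : ℝ)) (𝓝[>] 0) atTop := by
    have := (tendsto_rpow_atTop (y := 1 / 4) (by norm_num)).comp tendsto_inv_nhdsGT_zero
    refine this.congr' ?_
    filter_upwards [self_mem_nhdsWithin] with c hc
    rw [Function.comp, Real.inv_rpow (le_of_lt hc), Real.rpow_neg (le_of_lt hc)]
  refine tendsto_atTop_mono' _ ?_ hu
  filter_upwards [hu.eventually_ge_atTop (4 * |k| + 1), self_mem_nhdsWithin] with c h1 hc
  have hc : 0 < c := hc
  set u := c ^ (-(1 / 4) : ℝ) with hu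
  have hu0 : 0 < u := Real.rpow_pos_of_pos hc _
  have e1 : c ^ (-(1 / 2) : ℝ) = u * u := by
    rw [hu, ← Real.rpow_add hc]
    norm_num
  have e2 : Real.log c = -(4 * Real.log u) := by
    rw [hu, Real.log_rpow hc]
    ring
  have e3 : Real.log u ≤ u := (Real.log_le_sub_one_of_pos hu0).trans (by linarith)
  have e4 : 0 ≤ Real.log u := Real.log_nonneg (by have := abs_nonneg k; linarith)
  have e5 : k * Real.log u ≤ |k| * u := by
    calc k * Real.log u ≤ |k| * Real.log u := mul_le_mul_of_nonneg_right (le_abs_self k) e4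
      _ ≤ |k| * u := mul_le_mul_of_nonneg_left e3 (abs_nonneg k)
  rw [e1, e2]
  nlinarith

theorem eventually_start {a l t₀ H : ℝ} {P : ℝ → Prop} (hP : ∀ᶠ x in 𝓝[>] a, P x) :
    ∀ᶠ c in 𝓝[>] (0 : ℝ), ∀ ℓ ≤ H, P (a + c ^ (1 / 4 : ℝ) * Real.exp (l * t₀ + ℓ)) := by
  obtain ⟨u, hu, hsub⟩ := mem_nhdsGT_iff_exists_Ioo_subset.1 hP
  have hu : a < u := hu
  have ht := (tendsto_rpow_zero (r := 1 / 4) (by norm_num)).mul_const (Real.exp (l * t₀ + H))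
  rw [zero_mul] at ht
  filter_upwards [ht.eventually (gt_mem_nhds (sub_pos.2 hu)), self_mem_nhdsWithin] with c h1 hc ℓ hℓ
  have hc : 0 < c := hc
  have h2 : c ^ (1 / 4 : ℝ) * Real.exp (l * t₀ + ℓ) ≤ c ^ (1 / 4 : ℝ) * Real.exp (l * t₀ + H) := by
    gcongr
  have h3 : 0 < c ^ (1 / 4 : ℝ) * Real.exp (l * t₀ + ℓ) := by positivity
  exact hsub ⟨by linarith, by linarith⟩

namespace ExpandingDrift

open ExpandingPath

variable {b : ℝ → ℝ} {L a r : ℝ}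

/-- The logarithmic threshold for the event that the exit occurs before the cap. -/
noncomputable def capThreshold (b : ℝ → ℝ) (a r t₀ : ℝ) : ℝ :=
  Real.log (b r) - Real.log (deriv b a) - deriv b a * t₀ / 8

/-- The centring constant of the exit time. -/
noncomputable def exitShift (b : ℝ → ℝ) (a r : ℝ) : ℝ :=
  travelTime b a r - Real.log (deriv b a) / deriv b a

/-- Uniform smallness of the error terms in the initial condition. -/
theorem eventually_errors (h : ExpandingDrift b L a r) {t₀ : ℝ} (ht : 0 ≤ t₀) (H : ℝ) {η : ℝ}
    (hη : 0 < η) :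
    ∀ᶠ c in 𝓝[>] (0 : ℝ), ∀ ℓ ≤ H, ∀ y : ℝ → ℝ,
      y 0 = a + c ^ (1 / 4 : ℝ) * Real.exp (deriv b a * t₀ + ℓ) →
      (∀ s, HasDerivAt y (b (y s)) s) → ExpandingPath b L a r y ∧ ∃ e₁ e₂ e₃ : ℝ,
        |e₁| ≤ η ∧ |e₂| ≤ η ∧ |e₃| ≤ η ∧
        Real.log (b (y 0)) = Real.log (deriv b a) + (1 / 4 * Real.log c + deriv b a * t₀ + ℓ) + e₁ ∧
        -expansion b y (-t₀) = deriv b a * t₀ + e₂ ∧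
        hitTime b a r (y 0) = travelTime b a r - Real.log (b (y 0)) / deriv b a + e₃ := by
  have hl := h.unstable
  have p1 := (tendsto_log_drift h.regular h.fixed hl h.expanding h.lt_radius).eventually
    (Metric.closedBall_mem_nhds 0 hη)
  have p2 := (tendsto_linearDefect h.regular h.fixed hl h.expanding h.lt_radius).eventually
    (Metric.closedBall_mem_nhds 0 hη)
  have p3 : ∀ᶠ x in 𝓝[>] a, L * Real.sqrt (x - a) * t₀ ≤ η := by
    have : Tendsto (fun x => L * Real.sqrt (x - a) * t₀) (𝓝 a) (𝓝 (L * Real.sqrt (a - a) * t₀)) :=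
      Continuous.tendsto (by fun_prop) a
    rw [sub_self, Real.sqrt_zero, mul_zero, zero_mul] at this
    exact (this.mono_left nhdsWithin_le_nhds).eventually (ge_mem_nhds hη)
  have p4 : ∀ᶠ x in 𝓝[>] a, x ∈ Set.Ioo a r := Ioo_mem_nhdsGT h.lt_radius
  filter_upwards [eventually_start (l := deriv b a) (t₀ := t₀) (H := H)
    (p1.and (p2.and (p3.and p4))), self_mem_nhdsWithin] with c hcP hc ℓ hℓ y hy0 hy
  have hc : 0 < c := hc
  obtain ⟨q1, q2, q3, q4⟩ := hcP ℓ hℓ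
  rw [← hy0] at q1 q2 q3 q4
  rw [dist_zero_right, Real.norm_eq_abs] at q1 q2
  have hpath : ExpandingPath b L a r y :=
    ⟨h.regular, h.fixed, hl, h.expanding, q4.1, q4.2, hy⟩
  have hlog : Real.log (y 0 - a) = 1 / 4 * Real.log c + deriv b a * t₀ + ℓ := by
    rw [hy0, add_sub_cancel_left, Real.log_mul (Real.rpow_pos_of_pos hc _).ne' (Real.exp_ne_zero _),
      Real.log_rpow hc, Real.log_exp]
    ring
  refine ⟨hpath, _, _, _, q1, (hpath.abs_expansion_past_le ht).trans q3, q2, ?_, ?_, ?_⟩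
  · rw [hlog]; ring
  · ring
  · unfold hitTime
    nth_rewrite 2 [travelTime]
    ring

theorem eventually_capped_iff (h : ExpandingDrift b L a r) {t₀ : ℝ} (ht : 0 ≤ t₀) (H : ℝ) {δ : ℝ}
    (hδ : 0 < δ) :
    ∀ᶠ c in 𝓝[>] (0 : ℝ), ∀ ℓ, |ℓ| ≤ H → δ ≤ |ℓ - capThreshold b a r t₀| → ∀ (y : ℝ → ℝ) (xm : ℝ),
      xm < a → y 0 = a + c ^ (1 / 4 : ℝ) * Real.exp (deriv b a * t₀ + ℓ) →
      (∀ s, HasDerivAt y (b (y s)) s) →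
      (pathCapped y (fun s => deriv b (y s)) xm r t₀ c = pathExit y xm r t₀ ↔
        capThreshold b a r t₀ < ℓ) := by
  have hl := h.unstable
  set l := deriv b a with hldef
  have hη : 0 < δ / 4 := by positivity
  have hbig := (tendsto_rpow_neg_half_sub_log (1 / (4 * l))).eventually_ge_atTop
    (exitShift b a r + H / l + δ / 4 / l + δ / 4)
  filter_upwards [h.eventually_errors ht H hη, hbig, self_mem_nhdsWithin]
    with c herr hbig hc ℓ hℓ hℓδ y xm hxm hy0 hy
  have hc : 0 < c := hc
  obtain ⟨hpath, e₁, e₂, e₃, h1, h2, h3, hlog, hI, hhit⟩ := herr ℓ (le_of_abs_le hℓ) y hy0 hy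
  have h1 := abs_le.1 h1
  have h2 := abs_le.1 h2
  have h3 := abs_le.1 h3
  have hℓ := abs_le.1 hℓ
  rw [hpath.pathCapped_eq_pathExit_iff hxm hc, hI, hhit, hlog]
  have hsecond : t₀ + (travelTime b a r - (Real.log l + (1 / 4 * Real.log c + l * t₀ + ℓ) + e₁) / l +
      e₃) ≤ c ^ (-(1 / 2) : ℝ) := by
    have e : t₀ + (travelTime b a r - (Real.log l + (1 / 4 * Real.log c + l * t₀ + ℓ) + e₁) / l +
      e₃) = exitShift b a r - ℓ / l - e₁ / l + e₃ - 1 / (4 * l) * Real.log c := by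
      unfold exitShift
      rw [← hldef]
      field_simp
      ring
    have h5 : -ℓ / l ≤ H / l := by gcongr; linarith
    have h6 : -e₁ / l ≤ δ / 4 / l := by gcongr; linarith
    rw [neg_div] at h5 h6
    rw [e]
    linarith
  rw [and_iff_left hsecond]
  unfold capThreshold at hℓδ ⊢
  rw [← hldef] at hℓδ ⊢
  rcases le_abs.1 hℓδ with h7 | h7 <;> constructor <;> intro h8 <;> linarith

theorem eventually_deviation_iff (h : ExpandingDrift b L a r) {t₀ T : ℝ} (ht : 0 ≤ t₀)
    (hT : T + 8 * L / deriv b a ^ 2 * Real.sqrt (r - a) + 1 ≤ t₀ / 8)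
    (hcap : capThreshold b a r t₀ ≤ deriv b a * (exitShift b a r - T)) (H : ℝ) {δ : ℝ}
    (hδ : 0 < δ) :
    ∀ᶠ c in 𝓝[>] (0 : ℝ), ∀ ℓ, |ℓ| ≤ H → δ ≤ |ℓ - capThreshold b a r t₀| →
      δ ≤ |ℓ - deriv b a * (exitShift b a r - T)| → δ ≤ |ℓ - deriv b a * (exitShift b a r + T)| →
      ∀ (y : ℝ → ℝ) (xm : ℝ),
      xm < a → y 0 = a + c ^ (1 / 4 : ℝ) * Real.exp (deriv b a * t₀ + ℓ) →
      (∀ s, HasDerivAt y (b (y s)) s) →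
      (T < |(pathCapped y (fun s => deriv b (y s)) xm r t₀ c).toReal -
          1 / (4 * deriv b a) * Real.log c⁻¹| ↔
        ¬(deriv b a * (exitShift b a r - T) ≤ ℓ ∧ ℓ ≤ deriv b a * (exitShift b a r + T))) := by
  have hl := h.unstable
  set l := deriv b a with hldef
  set K := exitShift b a r with hK
  set η := min (δ / (4 * (1 + l))) (l / 2) with hηdef
  have hη : 0 < η := by positivity
  have hη1 : η ≤ δ / (4 * (1 + l)) := min_le_left _ _
  have hη2 : η ≤ l / 2 := min_le_right _ _
  have hη3 : η + l * η < δ := by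
    rw [le_div_iff₀ (by positivity)] at hη1
    nlinarith
  have hbig := (tendsto_rpow_neg_half_sub_log (1 / (4 * l))).eventually_ge_atTop (T + 1)
  filter_upwards [h.eventually_errors ht H hη, hbig, h.eventually_capped_iff ht H hδ,
    self_mem_nhdsWithin] with c herr hbig hiff hc ℓ hℓ hℓδ hℓ1 hℓ2 y xm hxm hy0 hy
  have hc : 0 < c := hc
  obtain ⟨hpath, e₁, e₂, e₃, h1, h2, h3, hlog, hI, hhit⟩ := herr ℓ (le_of_abs_le hℓ) y hy0 hy
  have hiff := hiff ℓ hℓ hℓδ y xm hxm hy0 hy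
  have h1 := abs_le.1 h1
  have h2 := abs_le.1 h2
  have h3 := abs_le.1 h3
  rw [Real.log_inv]
  by_cases hlt : capThreshold b a r t₀ < ℓ
  · rw [hiff.2 hlt, hpath.pathExit_eq hxm, EReal.toReal_coe, hhit, hlog]
    have e : t₀ + (travelTime b a r - (Real.log l + (1 / 4 * Real.log c + l * t₀ + ℓ) + e₁) / l +
      e₃) - 1 / (4 * l) * -Real.log c = (l * K - ℓ - e₁ + l * e₃) / l := by
      rw [hK]
      unfold exitShift
      rw [← hldef]
      field_simp
      ring
    have h4 : l * e₃ ≤ l * η := mul_le_mul_of_nonneg_left h3.2 hl.le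
    have h5 : l * -η ≤ l * e₃ := mul_le_mul_of_nonneg_left h3.1 hl.le
    rw [e, abs_div, abs_of_pos hl, lt_div_iff₀ hl, mul_sub, mul_add, not_and_or, not_le, not_le,
      lt_abs]
    rw [mul_sub] at hℓ1
    rw [mul_add] at hℓ2
    constructor
    · rintro (h6 | h6)
      · left
        rcases le_abs.1 hℓ1 with h7 | h7 <;> linarith
      · right
        rcases le_abs.1 hℓ2 with h7 | h7 <;> linarith
    · rintro (h6 | h6)
      · left
        rcases le_abs.1 hℓ1 with h7 | h7 <;> linarith
      · right
        rcases le_abs.1 hℓ2 with h7 | h7 <;> linarith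
  · have hle := hpath.le_toReal_pathCapped (t₀ := t₀) (c := c) hxm hc (fun hcon => hlt (hiff.1 hcon))
    have hfalse : ¬(l * (K - T) ≤ ℓ ∧ ℓ ≤ l * (K + T)) := fun hh => by
      have h7 : l * (K - T) ≤ ℓ := hh.1
      have h8 : ℓ = l * (K - T) := by linarith
      rw [h8, sub_self, abs_zero] at hℓ1
      linarith
    simp only [hfalse, not_false_eq_true, iff_true]
    refine lt_of_lt_of_le ?_ (le_abs_self _)
    rw [hI, ← hldef] at hle
    have e : (-(1 / 4) * Real.log c - 7 / 8 * (l * t₀ + e₂)) / l =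
        -(1 / (4 * l) * Real.log c) - 7 / 8 * t₀ - 7 / 8 * (e₂ / l) := by
      field_simp
      ring
    have h9 : e₂ / l ≤ 1 / 2 := by
      rw [div_le_iff₀ hl]
      linarith
    rcases min_le_iff.1 hle with h8 | h8
    · linarith
    · rw [e] at h8
      linarith

end ExpandingDrift

/-- The drift `b` reflected at the point `a`. -/
def reflectDrift (b : ℝ → ℝ) (a x : ℝ) : ℝ := -b (2 * a - x)

section Reflect

variable {b : ℝ → ℝ} {L a : ℝ}

theorem deriv_reflectDrift (b : ℝ → ℝ) (a x : ℝ) :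
    deriv (reflectDrift b a) x = deriv b (2 * a - x) := by
  have : reflectDrift b a = fun x => -(fun x => b (2 * a - x)) x := rfl
  rw [this, deriv.fun_neg, deriv_comp_const_sub, neg_neg]

theorem deriv_reflectDrift_self (b : ℝ → ℝ) (a : ℝ) : deriv (reflectDrift b a) a = deriv b a := by
  rw [deriv_reflectDrift, two_mul, add_sub_cancel_right]

theorem RegularDrift.reflectDrift (hb : RegularDrift b L) (a : ℝ) :
    RegularDrift (reflectDrift b a) L where
  differentiable :=
    (hb.differentiable.comp ((differentiable_const (2 * a)).sub differentiable_id)).neg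
  bound x := by
    rw [AHL.reflectDrift, abs_neg]
    exact hb.bound _
  deriv_bound x := by
    rw [deriv_reflectDrift]
    exact hb.deriv_bound _
  deriv_holder x y := by
    rw [deriv_reflectDrift, deriv_reflectDrift]
    refine (hb.deriv_holder _ _).trans_eq ?_
    rw [sub_sub_sub_cancel_left, abs_sub_comm]

theorem hasDerivAt_reflect {y : ℝ → ℝ} (hy : ∀ s, HasDerivAt y (b (y s)) s) (s : ℝ) :
    HasDerivAt (fun s => 2 * a - y s) (reflectDrift b a (2 * a - y s)) s := by
  rw [reflectDrift, sub_sub_cancel]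
  exact (hy s).const_sub (2 * a)

end Reflect

/-- The points `w ≠ 0` with `log |w|` in `P` if `w` is positive, and in `Q` if `w` is negative. -/
def logRegion (P Q : Set ℝ) : Set ℝ :=
  {w | (0 < w ∧ Real.log w ∈ P) ∨ (w < 0 ∧ Real.log w ∈ Q)}

/-- The reals of size at most `H` and at distance at least `δ` from `S`. -/
def separatedLogs (S : Set ℝ) (H δ : ℝ) : Set ℝ := {ℓ | |ℓ| ≤ H ∧ ∀ s ∈ S, δ ≤ |ℓ - s|}

section Deterministic

variable {b : ℝ → ℝ} {L a xm xp : ℝ}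

open ExpandingDrift

theorem eventually_capped_iff_mem_logRegion (hr : ExpandingDrift b L a xp)
    (hl : ExpandingDrift (reflectDrift b a) L a (2 * a - xm)) {t₀ : ℝ} (ht : 0 ≤ t₀)
    {H δ : ℝ} (hδ : 0 < δ) {S : Set ℝ} (h1 : capThreshold b a xp t₀ ∈ S)
    (h2 : capThreshold (reflectDrift b a) a (2 * a - xm) t₀ ∈ S) :
    ∀ᶠ c in 𝓝[>] (0 : ℝ), ∀ w, w ≠ 0 → Real.log w ∈ separatedLogs S H δ → ∀ y : ℝ → ℝ,
      y 0 = a + c ^ (1 / 4 : ℝ) * (Real.exp (deriv b a * t₀) * w) →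
      (∀ s, HasDerivAt y (b (y s)) s) →
      (pathCapped y (fun s => deriv b (y s)) xm xp t₀ c = pathExit y xm xp t₀ ↔
        w ∈ logRegion (Set.Ioi (capThreshold b a xp t₀))
          (Set.Ioi (capThreshold (reflectDrift b a) a (2 * a - xm) t₀))) := by
  have hxm : xm < a := by linarith [hl.lt_radius]
  have hxp := hr.lt_radius
  filter_upwards [hr.eventually_capped_iff ht H hδ, hl.eventually_capped_iff ht H hδ]
    with c hcr hcl w hw hS y hy0 hy
  rcases hw.lt_or_gt with hneg | hpos
  · have hexp : Real.exp (Real.log w) = -w := Real.exp_log_of_neg hneg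
    have key := hcl (Real.log w) hS.1 (hS.2 _ h2) (fun s => 2 * a - y s) (2 * a - xp)
      (by linarith) (by rw [hy0, deriv_reflectDrift_self, Real.exp_add, hexp]; ring)
      (hasDerivAt_reflect hy)
    simp only [deriv_reflectDrift, sub_sub_cancel] at key
    rw [pathCapped_reflect, pathExit_reflect] at key
    simp only [key, logRegion, Set.mem_ofPred_eq, Set.mem_Ioi, hneg, hneg.not_gt, false_and,
      true_and, false_or]
  · have hexp : Real.exp (Real.log w) = w := Real.exp_log hpos
    have key := hcr (Real.log w) hS.1 (hS.2 _ h1) y xm hxm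
      (by rw [hy0, Real.exp_add, hexp]) hy
    simp only [key, logRegion, Set.mem_ofPred_eq, Set.mem_Ioi, hpos, hpos.not_gt, false_and,
      true_and, or_false]

/-- The interval of logarithms for which the capped time is within `T` of its centring. -/
noncomputable def centredLogs (b : ℝ → ℝ) (a r T : ℝ) : Set ℝ :=
  Set.Icc (deriv b a * (exitShift b a r - T)) (deriv b a * (exitShift b a r + T))

theorem eventually_deviation_iff_mem_logRegion (hr : ExpandingDrift b L a xp)
    (hl : ExpandingDrift (reflectDrift b a) L a (2 * a - xm)) {t₀ T : ℝ} (ht : 0 ≤ t₀)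
    (hTr : T + 8 * L / deriv b a ^ 2 * Real.sqrt (xp - a) + 1 ≤ t₀ / 8)
    (hTl : T + 8 * L / deriv b a ^ 2 * Real.sqrt (2 * a - xm - a) + 1 ≤ t₀ / 8)
    (hcr : capThreshold b a xp t₀ ≤ deriv b a * (exitShift b a xp - T))
    (hcl : capThreshold (reflectDrift b a) a (2 * a - xm) t₀ ≤
      deriv b a * (exitShift (reflectDrift b a) a (2 * a - xm) - T))
    {H δ : ℝ} (hδ : 0 < δ) {S : Set ℝ} (h1 : capThreshold b a xp t₀ ∈ S)
    (h2 : capThreshold (reflectDrift b a) a (2 * a - xm) t₀ ∈ S)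
    (h3 : deriv b a * (exitShift b a xp - T) ∈ S) (h4 : deriv b a * (exitShift b a xp + T) ∈ S)
    (h5 : deriv b a * (exitShift (reflectDrift b a) a (2 * a - xm) - T) ∈ S)
    (h6 : deriv b a * (exitShift (reflectDrift b a) a (2 * a - xm) + T) ∈ S) :
    ∀ᶠ c in 𝓝[>] (0 : ℝ), ∀ w, w ≠ 0 → Real.log w ∈ separatedLogs S H δ → ∀ y : ℝ → ℝ,
      y 0 = a + c ^ (1 / 4 : ℝ) * (Real.exp (deriv b a * t₀) * w) →
      (∀ s, HasDerivAt y (b (y s)) s) →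
      (T < |(pathCapped y (fun s => deriv b (y s)) xm xp t₀ c).toReal -
          1 / (4 * deriv b a) * Real.log c⁻¹| ↔
        w ∈ logRegion (centredLogs b a xp T)ᶜ
          (centredLogs (reflectDrift b a) a (2 * a - xm) T)ᶜ) := by
  have hxm : xm < a := by linarith [hl.lt_radius]
  have hxp := hr.lt_radius
  have hdl := hl.eventually_deviation_iff (T := T) ht
  simp only [deriv_reflectDrift_self] at hdl
  filter_upwards [hr.eventually_deviation_iff ht hTr hcr H hδ, hdl hTl hcl H hδ]
    with c hcr hcl w hw hS y hy0 hy
  rcases hw.lt_or_gt with hneg | hpos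
  · have hexp : Real.exp (Real.log w) = -w := Real.exp_log_of_neg hneg
    have key := hcl (Real.log w) hS.1 (hS.2 _ h2) (hS.2 _ h5) (hS.2 _ h6) (fun s => 2 * a - y s)
      (2 * a - xp) (by linarith) (by rw [hy0, Real.exp_add, hexp]; ring)
      (hasDerivAt_reflect hy)
    simp only [deriv_reflectDrift, sub_sub_cancel] at key
    rw [pathCapped_reflect] at key
    simp only [key, logRegion, Set.mem_ofPred_eq, Set.mem_compl_iff, centredLogs, Set.mem_Icc, hneg,
      hneg.not_gt, false_and, true_and, false_or, deriv_reflectDrift_self]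
  · have hexp : Real.exp (Real.log w) = w := Real.exp_log hpos
    have key := hcr (Real.log w) hS.1 (hS.2 _ h1) (hS.2 _ h3) (hS.2 _ h4) y xm hxm
      (by rw [hy0, Real.exp_add, hexp]) hy
    simp only [key, logRegion, Set.mem_ofPred_eq, Set.mem_compl_iff, centredLogs, Set.mem_Icc, hpos,
      hpos.not_gt, false_and, true_and, or_false]

end Deterministic

section Regions

variable {P Q S : Set ℝ}

theorem measurableSet_logRegion (hP : MeasurableSet P) (hQ : MeasurableSet Q) :
    MeasurableSet (logRegion P Q) :=
  (measurableSet_Ioi.inter (Real.measurable_log hP)).union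
    (measurableSet_Iio.inter (Real.measurable_log hQ))

theorem logRegion_mono {P' Q' : Set ℝ} (hP : P ⊆ P') (hQ : Q ⊆ Q') :
    logRegion P Q ⊆ logRegion P' Q' := fun _ hw =>
  hw.imp (And.imp_right fun h => hP h) (And.imp_right fun h => hQ h)

theorem countable_log_preimage (hS : S.Countable) : {w | w = 0 ∨ Real.log w ∈ S}.Countable := by
  refine (((Set.countable_singleton (0 : ℝ)).union (hS.image Real.exp)).union
    (hS.image fun s => -Real.exp s)).mono ?_
  rintro w (hw | hw)
  · exact Or.inl (Or.inl hw)
  · rcases lt_trichotomy w 0 with h | h | h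
    · exact Or.inr ⟨_, hw, by simp only [Real.exp_log_of_neg h, neg_neg]⟩
    · exact Or.inl (Or.inl h)
    · exact Or.inl (Or.inr ⟨_, hw, Real.exp_log h⟩)

theorem frontier_logRegion_subset :
    frontier (logRegion P Q) ⊆ {w | w = 0 ∨ Real.log w ∈ frontier P ∪ frontier Q} := by
  intro w hw
  by_contra hcon
  simp only [Set.mem_ofPred_eq, Set.mem_union, not_or] at hcon
  obtain ⟨h0, hP, hQ⟩ := hcon
  have hcont : ContinuousAt Real.log w := Real.continuousAt_log h0
  have hstable : ∀ R : Set ℝ, Real.log w ∉ frontier R →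
      (∀ᶠ x in 𝓝 w, Real.log x ∈ R) ∨ ∀ᶠ x in 𝓝 w, Real.log x ∉ R := fun R hR => by
    rw [← Set.mem_compl_iff, compl_frontier_eq_union_interior] at hR
    exact hR.imp (fun h => hcont (mem_interior_iff_mem_nhds.1 h))
      (fun h => hcont (mem_interior_iff_mem_nhds.1 h))
  have hmem : (∀ᶠ x in 𝓝 w, x ∈ logRegion P Q) ∨ ∀ᶠ x in 𝓝 w, x ∈ (logRegion P Q)ᶜ := by
    rcases lt_or_gt_of_ne h0 with h | h
    · refine (hstable Q hQ).imp (fun hQ => ?_) (fun hQ => ?_) <;>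
      · filter_upwards [hQ, gt_mem_nhds h] with x h1 h2
        simp [logRegion, h1, h2, h2.not_gt]
    · refine (hstable P hP).imp (fun hP => ?_) (fun hP => ?_) <;>
      · filter_upwards [hP, lt_mem_nhds h] with x h1 h2
        simp [logRegion, h1, h2, h2.not_gt]
  have hw' : w ∉ (frontier (logRegion P Q))ᶜ := fun h => h hw
  rw [compl_frontier_eq_union_interior] at hw'
  exact hw' (hmem.imp mem_interior_iff_mem_nhds.2 mem_interior_iff_mem_nhds.2)

theorem countable_frontier_separatedLogs (hS : S.Finite) (H δ : ℝ) :
    (frontier (separatedLogs S H δ)).Countable := by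
  have hclosed : IsClosed (separatedLogs S H δ) := by
    have : separatedLogs S H δ = {ℓ | |ℓ| ≤ H} ∩ ⋂ s ∈ S, {ℓ | δ ≤ |ℓ - s|} := by
      ext ℓ
      simp [separatedLogs]
    rw [this]
    exact (isClosed_le (by fun_prop) (by fun_prop)).inter
      (isClosed_biInter fun s _ => isClosed_le (by fun_prop) (by fun_prop))
  have hopen : IsOpen ({ℓ | |ℓ| < H} ∩ ⋂ s ∈ S, {ℓ : ℝ | δ < |ℓ - s|}) :=
    (isOpen_lt (by fun_prop) (by fun_prop)).inter
      (hS.isOpen_biInter fun s _ => isOpen_lt (by fun_prop) (by fun_prop))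
  have hsub : ({ℓ | |ℓ| < H} ∩ ⋂ s ∈ S, {ℓ : ℝ | δ < |ℓ - s|}) ⊆ separatedLogs S H δ := by
    rintro ℓ ⟨h1, h2⟩
    exact ⟨le_of_lt h1, fun s hs => le_of_lt (Set.mem_iInter₂.1 h2 s hs)⟩
  have hfin : (({H, -H} : Set ℝ) ∪ ((fun s => s + δ) '' S ∪ (fun s => s - δ) '' S)).Finite :=
    (Set.toFinite _).union ((hS.image _).union (hS.image _))
  refine hfin.countable.mono fun ℓ hℓ => ?_
  rw [hclosed.frontier_eq] at hℓ
  have hnot := fun h => hℓ.2 (interior_maximal hsub hopen h)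
  obtain ⟨h1, h2⟩ := hℓ.1
  by_contra hcon
  simp only [Set.mem_union, Set.mem_insert_iff, Set.mem_singleton_iff, Set.mem_image, not_or,
    not_exists, not_and] at hcon
  obtain ⟨⟨h3, h4⟩, h5, h6⟩ := hcon
  refine hnot ⟨lt_of_le_of_ne h1 fun h => ?_, Set.mem_iInter₂.2 fun s hs =>
    lt_of_le_of_ne (h2 s hs) fun h => ?_⟩
  · rcases eq_or_eq_neg_of_abs_eq h with h | h
    · exact h3 h
    · exact h4 h
  · rcases eq_or_eq_neg_of_abs_eq h.symm with h | h
    · exact h5 s hs (by linarith)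
    · exact h6 s hs (by linarith)

theorem measurableSet_separatedLogs (hS : S.Finite) (H δ : ℝ) :
    MeasurableSet (separatedLogs S H δ) := by
  have : separatedLogs S H δ = {ℓ | |ℓ| ≤ H} ∩ ⋂ s ∈ S, {ℓ | δ ≤ |ℓ - s|} := by
    ext ℓ
    simp [separatedLogs]
  rw [this]
  exact (measurableSet_le (by fun_prop) (by fun_prop)).inter
    (hS.measurableSet_biInter fun s _ => measurableSet_le (by fun_prop) (by fun_prop))

variable {γ : Measure ℝ} [NullSingletonClass γ]

theorem measure_frontier_logRegion (hP : (frontier P).Countable) (hQ : (frontier Q).Countable) :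
    γ (frontier (logRegion P Q)) = 0 :=
  measure_mono_null frontier_logRegion_subset
    ((countable_log_preimage (hP.union hQ)).measure_zero γ)

theorem exists_separatedLogs (γ : Measure ℝ) [IsProbabilityMeasure γ] [NullSingletonClass γ]
    (hS : S.Finite) {ε : ℝ} (hε : 0 < ε) :
    ∃ H δ : ℝ, 0 < H ∧ 0 < δ ∧
      1 - ε < γ.real (logRegion (separatedLogs S H δ) (separatedLogs S H δ)) := by
  set G : ℕ → Set ℝ := fun n => logRegion (separatedLogs S (n + 1) (1 / (n + 1)))
    (separatedLogs S (n + 1) (1 / (n + 1))) with hG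
  have hmono : Monotone G := fun m n hmn => by
    have hmn' : (m : ℝ) ≤ n := Nat.cast_le.2 hmn
    have : separatedLogs S (m + 1) (1 / (m + 1)) ⊆ separatedLogs S (n + 1) (1 / (n + 1)) :=
      fun ℓ hℓ => ⟨hℓ.1.trans (by linarith), fun s hs =>
        (one_div_le_one_div_of_le (by positivity) (by linarith)).trans (hℓ.2 s hs)⟩
    exact logRegion_mono this this
  have hunion : {w | w = 0 ∨ Real.log w ∈ S}ᶜ ⊆ ⋃ n, G n := by
    intro w hw
    simp only [Set.mem_compl_iff, Set.mem_ofPred_eq, not_or] at hw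
    have hev : ∀ᶠ n : ℕ in atTop, Real.log w ∈ separatedLogs S (n + 1) (1 / (n + 1)) := by
      have h1 : ∀ᶠ n : ℕ in atTop, |Real.log w| ≤ n + 1 :=
        (tendsto_natCast_atTop_atTop.eventually_ge_atTop |Real.log w|).mono fun n hn => by linarith
      have h2 : ∀ᶠ n : ℕ in atTop, ∀ s ∈ S, 1 / ((n : ℝ) + 1) ≤ |Real.log w - s| := by
        rw [eventually_all_finite hS]
        intro s hs
        have : 0 < |Real.log w - s| := abs_pos.2 fun h => hw.2 (by rwa [sub_eq_zero.1 h])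
        exact (tendsto_one_div_add_atTop_nhds_zero_nat (𝕜 := ℝ)).eventually (ge_mem_nhds this)
      exact h1.and h2
    obtain ⟨n, hn⟩ := hev.exists
    refine Set.mem_iUnion.2 ⟨n, ?_⟩
    rcases lt_or_gt_of_ne hw.1 with h | h
    · exact Or.inr ⟨h, hn⟩
    · exact Or.inl ⟨h, hn⟩
  have hone : γ (⋃ n, G n) = 1 := by
    refine le_antisymm prob_le_one ?_
    refine le_trans ?_ (measure_mono hunion)
    rw [prob_compl_eq_one_sub (countable_log_preimage hS.countable).measurableSet,
      (countable_log_preimage hS.countable).measure_zero γ, tsub_zero]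
  have hlim := tendsto_measure_iUnion_atTop (μ := γ) hmono
  rw [hone] at hlim
  have hlim' := (ENNReal.tendsto_toReal ENNReal.one_ne_top).comp hlim
  rw [ENNReal.toReal_one] at hlim'
  obtain ⟨n, hn⟩ := (hlim'.eventually (lt_mem_nhds (sub_lt_self 1 hε))).exists
  exact ⟨n + 1, 1 / (n + 1), by positivity, by positivity, hn⟩

/-- If, off a neighbourhood of finitely many values of the logarithm of `W`, an event coincides
eventually with `W` lying in a region, then its probability converges to that of the region. -/
theorem tendsto_measureReal_of_iff_mem_logRegion [IsProbabilityMeasure γ] {Ω : Type*} [MeasurableSpace Ω] {μ : Measure Ω}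
    [IsProbabilityMeasure μ] {W : ℝ → Ω → ℝ} {E : ℝ → Set Ω} {F : Filter ℝ}
    (hW : ∀ c, Measurable (W c))
    (hconv : ∀ A : Set ℝ, MeasurableSet A → γ (frontier A) = 0 →
      Tendsto (fun c => μ.real {ω | W c ω ∈ A}) F (𝓝 (γ.real A)))
    (hS : S.Finite) (hP : MeasurableSet P) (hQ : MeasurableSet Q)
    (hP' : (frontier P).Countable) (hQ' : (frontier Q).Countable)
    (hE : ∀ H δ : ℝ, 0 < δ → ∀ᶠ c in F, ∀ ω, W c ω ≠ 0 →
      Real.log (W c ω) ∈ separatedLogs S H δ → (ω ∈ E c ↔ W c ω ∈ logRegion P Q)) :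
    Tendsto (fun c => μ.real (E c)) F (𝓝 (γ.real (logRegion P Q))) := by
  rw [Metric.tendsto_nhds]
  intro ε hε
  obtain ⟨H, δ, -, hδ, hG⟩ := exists_separatedLogs γ hS (half_pos hε)
  set V := separatedLogs S H δ
  have hV : MeasurableSet V := measurableSet_separatedLogs hS H δ
  have hV' : (frontier V).Countable := countable_frontier_separatedLogs hS H δ
  have hGm := measurableSet_logRegion hV hV
  have c1 := hconv _ (measurableSet_logRegion hP hQ) (measure_frontier_logRegion hP' hQ')
  have c2 := hconv _ hGm (measure_frontier_logRegion hV' hV')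
  filter_upwards [hE H δ hδ, Metric.tendsto_nhds.1 c1 (ε / 2) (half_pos hε),
    c2.eventually (lt_mem_nhds hG)] with c hEc hI hGc
  set I := {ω | W c ω ∈ logRegion P Q}
  set B := {ω | W c ω ∈ logRegion V V} with hB
  have hBm : MeasurableSet B := hW c hGm
  have hBc : μ.real Bᶜ < ε / 2 := by
    rw [probReal_compl_eq_one_sub hBm]
    linarith
  have hiff : ∀ ω, ω ∈ B → (ω ∈ E c ↔ ω ∈ I) := by
    rintro ω (h | h)
    · exact hEc ω h.1.ne' h.2
    · exact hEc ω h.1.ne h.2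
  have u1 : μ.real (E c) ≤ μ.real I + μ.real Bᶜ := by
    refine (measureReal_mono fun ω hω => ?_).trans (measureReal_union_le _ _)
    by_cases hb : ω ∈ B
    · exact Or.inl ((hiff ω hb).1 hω)
    · exact Or.inr hb
  have u2 : μ.real I ≤ μ.real (E c) + μ.real Bᶜ := by
    refine (measureReal_mono fun ω hω => ?_).trans (measureReal_union_le _ _)
    by_cases hb : ω ∈ B
    · exact Or.inl ((hiff ω hb).2 hω)
    · exact Or.inr hb
  rw [Real.dist_eq, abs_lt] at hI ⊢
  constructor <;> linarith [hI.1, hI.2]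

end Regions

/-- Centred Gaussian laws depend continuously on the variance. -/
theorem tendsto_gaussianReal_real {v : ℝ → NNReal} {v₀ : NNReal} {F : Filter ℝ}
    [F.IsCountablyGenerated] (hv : Tendsto v F (𝓝 v₀)) {E : Set ℝ}
    (hfr : gaussianReal 0 v₀ (frontier E) = 0) :
    Tendsto (fun t => (gaussianReal 0 (v t)).real E) F (𝓝 ((gaussianReal 0 v₀).real E)) := by
  refine tendsto_of_seq_tendsto fun u hu => ?_
  let Q : ℕ → ProbabilityMeasure ℝ := fun n => ⟨gaussianReal 0 (v (u n)), inferInstance⟩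
  let Q₀ : ProbabilityMeasure ℝ := ⟨gaussianReal 0 v₀, inferInstance⟩
  have hQ : Tendsto Q atTop (𝓝 Q₀) := by
    refine ProbabilityMeasure.tendsto_of_tendsto_charFun fun ξ => ?_
    change Tendsto (fun n => charFun (gaussianReal 0 (v (u n))) ξ) atTop
      (𝓝 (charFun (gaussianReal 0 v₀) ξ))
    simp only [charFun_gaussianReal]
    have : Continuous fun w : NNReal => Complex.exp (ξ * ((0 : ℝ) : ℂ) * Complex.I -
        ((w : ℝ) : ℂ) * ξ ^ 2 / 2) := by fun_prop
    exact (this.tendsto v₀).comp (hv.comp hu)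
  have h3 := ProbabilityMeasure.tendsto_measure_of_null_frontier_of_tendsto' hQ (E := E) hfr
  exact (ENNReal.tendsto_toReal (measure_ne_top (gaussianReal 0 v₀) E)).comp h3

section Limits

open ExpandingDrift

variable {h : ℝ → ℝ} {a xm xp : ℝ}

theorem tendsto_limitVar (hl : 0 < deriv (drift h) a) :
    Tendsto (limitVar h a) atTop (𝓝 (2 * slitSqLimit * h a * (1 / (2 * deriv (drift h) a)))) := by
  have h1 : Tendsto (fun t₀ : ℝ => Real.exp (-(2 * deriv (drift h) a * t₀))) atTop (𝓝 0) :=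
    Real.tendsto_exp_neg_atTop_nhds_zero.comp
      (tendsto_id.const_mul_atTop (mul_pos two_pos hl))
  have h2 := ((h1.const_sub 1).div_const (2 * deriv (drift h) a)).const_mul (2 * slitSqLimit * h a)
  rwa [sub_zero] at h2

theorem tendsto_capThreshold {b : ℝ → ℝ} {r : ℝ} (hl : 0 < deriv b a) :
    Tendsto (capThreshold b a r) atTop atBot := by
  have h1 : Tendsto (fun t₀ : ℝ => deriv b a * t₀ / 8) atTop atTop :=
    (tendsto_id.const_mul_atTop hl).atTop_div_const (by norm_num)
  exact tendsto_atBot_add_const_left _ _ (tendsto_neg_atTop_atBot.comp h1)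

theorem harmonicFlow_eq_scaledFlow {c : ℝ} (hc : 0 < c) (l a t₀ : ℝ) (θ : ℕ → ℝ) :
    harmonicFlow c θ a ⌊t₀ / c⌋₊ =
      a + c ^ (1 / 4 : ℝ) * (Real.exp (l * t₀) * scaledFlow l a t₀ c θ) := by
  have := (Real.rpow_pos_of_pos hc (1 / 4)).ne'
  rw [scaledFlow, ← mul_assoc (Real.exp _), ← Real.exp_add, add_neg_cancel, Real.exp_zero]
  field_simp
  ring

variable {Ω : Type*} [MeasurableSpace Ω] {μ : Measure Ω} [IsProbabilityMeasure μ] {θ : ℕ → Ω → ℝ}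
  {L : ℝ}

theorem tendsto_measureReal_capped_eq_exit (hs : ContDiff ℝ 2 h) (hper : Function.Periodic h 1)
    (h0 : ∀ x, 0 ≤ h x) (hmass : ∫ x in (0 : ℝ)..1, h x = 1)
    (hr : ExpandingDrift (drift h) L a xp)
    (hl : ExpandingDrift (reflectDrift (drift h) a) L a (2 * a - xm))
    (hθ : ∀ n, Measurable (θ n)) (hi : iIndepFun θ μ) (hlaw : ∀ n, μ.map (θ n) = angleLaw h)
    {t₀ : ℝ} (ht : 0 ≤ t₀) (hv : 0 < limitVar h a t₀) :
    Tendsto (fun c => μ.real {ω | cappedTime h a xm xp t₀ c (fun n => θ n ω) =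
        exitTime h a xm xp t₀ c (fun n => θ n ω)}) (𝓝[>] 0)
      (𝓝 ((gaussianReal 0 (limitVar h a t₀).toNNReal).real
        (logRegion (Set.Ioi (capThreshold (drift h) a xp t₀))
          (Set.Ioi (capThreshold (reflectDrift (drift h) a) a (2 * a - xm) t₀))))) := by
  have := nullSingletonClass_gaussianReal (μ := 0) (Real.toNNReal_pos.2 hv).ne'
  refine tendsto_measureReal_of_iff_mem_logRegion
    (S := {capThreshold (drift h) a xp t₀,
      capThreshold (reflectDrift (drift h) a) a (2 * a - xm) t₀})
    (fun c => measurable_scaledFlow hθ (deriv (drift h) a) a t₀ c)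
    (fun A hA hfr => tendsto_measureReal_scaledFlow hs hper h0 hmass hr.fixed hr.unstable hθ hi hlaw
      ht (Real.coe_toNNReal _ hv.le) hA hfr)
    (Set.toFinite _) measurableSet_Ioi measurableSet_Ioi (by simp) (by simp) fun H δ hδ => ?_
  filter_upwards [eventually_capped_iff_mem_logRegion hr hl ht (H := H) hδ
    (S := {capThreshold (drift h) a xp t₀,
      capThreshold (reflectDrift (drift h) a) a (2 * a - xm) t₀}) (by simp) (by simp), self_mem_nhdsWithin] with c hcap hc ω hw hlog
  have hflow := hr.regular.odeFlow_spec (harmonicFlow c (fun n => θ n ω) a ⌊t₀ / c⌋₊)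
  have key := hcap _ hw hlog
    (fun s => odeFlow (drift h) s (harmonicFlow c (fun n => θ n ω) a ⌊t₀ / c⌋₊))
    (hflow.1.trans (harmonicFlow_eq_scaledFlow hc (deriv (drift h) a) a t₀ _)) hflow.2
  rw [cappedTime_eq_pathCapped, exitTime_eq_pathExit]
  exact key

theorem countable_frontier_centredLogs (b : ℝ → ℝ) (a r T : ℝ) :
    (frontier (centredLogs b a r T)ᶜ).Countable := by
  rw [frontier_compl]
  refine (Set.toFinite {deriv b a * (exitShift b a r - T),
    deriv b a * (exitShift b a r + T)}).countable.mono ?_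
  rw [centredLogs]
  intro x hx
  rw [isClosed_Icc.frontier_eq, interior_Icc] at hx
  by_contra hcon
  simp only [Set.mem_insert_iff, Set.mem_singleton_iff, not_or] at hcon
  exact hx.2 ⟨lt_of_le_of_ne hx.1.1 (Ne.symm hcon.1), lt_of_le_of_ne hx.1.2 hcon.2⟩

theorem tendsto_measureReal_deviation (hs : ContDiff ℝ 2 h) (hper : Function.Periodic h 1)
    (h0 : ∀ x, 0 ≤ h x) (hmass : ∫ x in (0 : ℝ)..1, h x = 1)
    (hr : ExpandingDrift (drift h) L a xp)
    (hl : ExpandingDrift (reflectDrift (drift h) a) L a (2 * a - xm))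
    (hθ : ∀ n, Measurable (θ n)) (hi : iIndepFun θ μ) (hlaw : ∀ n, μ.map (θ n) = angleLaw h)
    {t₀ T : ℝ} (ht : 0 ≤ t₀) (hv : 0 < limitVar h a t₀)
    (hTr : T + 8 * L / deriv (drift h) a ^ 2 * Real.sqrt (xp - a) + 1 ≤ t₀ / 8)
    (hTl : T + 8 * L / deriv (drift h) a ^ 2 * Real.sqrt (2 * a - xm - a) + 1 ≤ t₀ / 8)
    (hcr : capThreshold (drift h) a xp t₀ ≤
      deriv (drift h) a * (exitShift (drift h) a xp - T))
    (hcl : capThreshold (reflectDrift (drift h) a) a (2 * a - xm) t₀ ≤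
      deriv (drift h) a * (exitShift (reflectDrift (drift h) a) a (2 * a - xm) - T)) :
    Tendsto (fun c => μ.real {ω | T < |(cappedTime h a xm xp t₀ c (fun n => θ n ω)).toReal -
        1 / (4 * deriv (drift h) a) * Real.log c⁻¹|}) (𝓝[>] 0)
      (𝓝 ((gaussianReal 0 (limitVar h a t₀).toNNReal).real
        (logRegion (centredLogs (drift h) a xp T)ᶜ
          (centredLogs (reflectDrift (drift h) a) a (2 * a - xm) T)ᶜ))) := by
  have := nullSingletonClass_gaussianReal (μ := 0) (Real.toNNReal_pos.2 hv).ne'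
  refine tendsto_measureReal_of_iff_mem_logRegion
    (S := {capThreshold (drift h) a xp t₀,
      capThreshold (reflectDrift (drift h) a) a (2 * a - xm) t₀,
      deriv (drift h) a * (exitShift (drift h) a xp - T),
      deriv (drift h) a * (exitShift (drift h) a xp + T),
      deriv (drift h) a * (exitShift (reflectDrift (drift h) a) a (2 * a - xm) - T),
      deriv (drift h) a * (exitShift (reflectDrift (drift h) a) a (2 * a - xm) + T)})
    (fun c => measurable_scaledFlow hθ (deriv (drift h) a) a t₀ c)
    (fun A hA hfr => tendsto_measureReal_scaledFlow hs hper h0 hmass hr.fixed hr.unstable hθ hi hlaw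
      ht (Real.coe_toNNReal _ hv.le) hA hfr)
    (Set.toFinite _) measurableSet_Icc.compl measurableSet_Icc.compl
    (countable_frontier_centredLogs _ _ _ _) (countable_frontier_centredLogs _ _ _ _)
    fun H δ hδ => ?_
  filter_upwards [eventually_deviation_iff_mem_logRegion hr hl ht hTr hTl hcr hcl (H := H) hδ
    (S := {capThreshold (drift h) a xp t₀,
      capThreshold (reflectDrift (drift h) a) a (2 * a - xm) t₀,
      deriv (drift h) a * (exitShift (drift h) a xp - T),
      deriv (drift h) a * (exitShift (drift h) a xp + T),
      deriv (drift h) a * (exitShift (reflectDrift (drift h) a) a (2 * a - xm) - T),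
      deriv (drift h) a * (exitShift (reflectDrift (drift h) a) a (2 * a - xm) + T)})
    (by simp) (by simp) (by simp) (by simp) (by simp) (by simp), self_mem_nhdsWithin]
    with c hdev hc ω hw hlog
  have hflow := hr.regular.odeFlow_spec (harmonicFlow c (fun n => θ n ω) a ⌊t₀ / c⌋₊)
  have key := hdev _ hw hlog
    (fun s => odeFlow (drift h) s (harmonicFlow c (fun n => θ n ω) a ⌊t₀ / c⌋₊))
    (hflow.1.trans (harmonicFlow_eq_scaledFlow hc (deriv (drift h) a) a t₀ _)) hflow.2
  rw [cappedTime_eq_pathCapped]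
  exact key

theorem tendsto_gaussianReal_capped {v : ℝ → NNReal} {v₀ : NNReal} (hv : Tendsto v atTop (𝓝 v₀))
    (hv₀ : v₀ ≠ 0) {p q : ℝ → ℝ} (hp : Tendsto p atTop atBot) (hq : Tendsto q atTop atBot) :
    Tendsto (fun t => (gaussianReal 0 (v t)).real (logRegion (Set.Ioi (p t)) (Set.Ioi (q t))))
      atTop (𝓝 1) := by
  have := nullSingletonClass_gaussianReal (μ := 0) hv₀
  refine tendsto_order.2 ⟨fun x hx => ?_, fun x hx => Eventually.of_forall fun t =>
    lt_of_le_of_lt measureReal_le_one hx⟩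
  obtain ⟨H, δ, -, hδ, hG⟩ := exists_separatedLogs (gaussianReal 0 v₀) Set.finite_empty
    (sub_pos.2 hx)
  rw [sub_sub_cancel] at hG
  have hfr := countable_frontier_separatedLogs Set.finite_empty H δ
  have hconv := tendsto_gaussianReal_real hv (measure_frontier_logRegion hfr hfr)
  filter_upwards [hconv.eventually (lt_mem_nhds hG), hp.eventually_lt_atBot (-H),
    hq.eventually_lt_atBot (-H)] with t h1 h2 h3
  refine lt_of_lt_of_le h1 (measureReal_mono (logRegion_mono ?_ ?_))
  · exact fun ℓ hℓ => h2.trans_le (abs_le.1 hℓ.1).1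
  · exact fun ℓ hℓ => h3.trans_le (abs_le.1 hℓ.1).1

theorem exists_gaussianReal_deviation_lt {v : NNReal} (hv : v ≠ 0) {l : ℝ} (hl : 0 < l) (K K' : ℝ)
    {ε : ℝ} (hε : 0 < ε) :
    ∃ T : ℝ, 0 < T ∧ (gaussianReal 0 v).real (logRegion (Set.Icc (l * (K - T)) (l * (K + T)))ᶜ
      (Set.Icc (l * (K' - T)) (l * (K' + T)))ᶜ) < ε := by
  have := nullSingletonClass_gaussianReal (μ := 0) hv
  obtain ⟨H, δ, hH, hδ, hG⟩ := exists_separatedLogs (gaussianReal 0 v) Set.finite_empty hε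
  have hT : l * (H / l) = H := mul_div_cancel₀ _ hl.ne'
  refine ⟨H / l + |K| + |K'|, by positivity, ?_⟩
  have hVm := measurableSet_separatedLogs Set.finite_empty H δ
  have hcompl := probReal_compl_eq_one_sub (μ := gaussianReal 0 v) (measurableSet_logRegion hVm hVm)
  refine lt_of_le_of_lt (measureReal_mono ?_) (by rw [hcompl]; linarith :
    (gaussianReal 0 v).real (logRegion (separatedLogs ∅ H δ) (separatedLogs ∅ H δ))ᶜ < ε)
  have hin : ∀ k : ℝ, |k| ≤ |K| + |K'| → separatedLogs ∅ H δ ⊆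
      Set.Icc (l * (k - (H / l + |K| + |K'|))) (l * (k + (H / l + |K| + |K'|))) := by
    intro k hk ℓ hℓ
    have h1 := abs_le.1 hℓ.1
    have h2 := abs_le.1 hk
    constructor
    · nlinarith
    · nlinarith
  rintro w (hw | hw) (hw' | hw')
  · exact hw.2 (hin K (by linarith [abs_nonneg K']) hw'.2)
  · exact absurd hw.1 hw'.1.not_gt
  · exact absurd hw.1 hw'.1.not_gt
  · exact hw.2 (hin K' (by linarith [abs_nonneg K]) hw'.2)

end Limits

end AHL

theorem theorem4p5
    -- the density of the attachment angles
    (h : ℝ → ℝ) (h_smooth : ContDiff ℝ 2 h) (h_periodic : Function.Periodic h 1)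
    (h_nonneg : ∀ x, 0 ≤ h x) (h_mass : ∫ x in (0 : ℝ)..1, h x = 1)
    -- the unstable fixed point and its neighbourhood
    (a xm xp : ℝ) (ha_fixed : AHL.drift h a = 0) (ha_unstable : 0 < deriv (AHL.drift h) a)
    (ha_pos : 0 < h a) (hxm : xm < a) (hxp : a < xp)
    (h_nbhd : ∀ x ∈ Set.Icc xm xp, deriv (AHL.drift h) a / 2 ≤ deriv (AHL.drift h) x ∧
      deriv (AHL.drift h) x ≤ 3 * deriv (AHL.drift h) a / 2)
    -- the i.i.d. attachment angles
    {Ω : Type*} [MeasurableSpace Ω] (μ : Measure Ω) [IsProbabilityMeasure μ]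
    (θ : ℕ → Ω → ℝ) (hθ_meas : ∀ n, Measurable (θ n)) (hθ_indep : iIndepFun θ μ)
    (hθ_law : ∀ n, μ.map (θ n) = AHL.angleLaw h) :
    AHL.HasIteratedLimit (fun t₀ c => μ.real {ω |
        AHL.cappedTime h a xm xp t₀ c (fun n => θ n ω) =
          AHL.exitTime h a xm xp t₀ c (fun n => θ n ω)}) 1 ∧
    ∀ ε : ℝ, 0 < ε → ∃ T : ℝ, 0 < T ∧ ∃ l : ℝ, l < ε ∧
      AHL.HasIteratedLimit (fun t₀ c => μ.real {ω |
        T < |(AHL.cappedTime h a xm xp t₀ c (fun n => θ n ω)).toReal -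
          1 / (4 * deriv (AHL.drift h) a) * Real.log c⁻¹|}) l := by
  obtain ⟨L, -, hreg⟩ := AHL.regularDrift_drift h_smooth h_periodic
  have hr : AHL.ExpandingDrift (AHL.drift h) L a xp :=
    ⟨hreg, ha_fixed, ha_unstable, fun x hx => (h_nbhd x ⟨hxm.le.trans hx.1, hx.2⟩).1, hxp⟩
  have hself := AHL.deriv_reflectDrift_self (AHL.drift h) a
  have hl : AHL.ExpandingDrift (AHL.reflectDrift (AHL.drift h) a) L a (2 * a - xm) := by
    refine ⟨hreg.reflectDrift a, ?_, hself.symm ▸ ha_unstable, fun x hx => ?_, by linarith⟩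
    · rw [AHL.reflectDrift, two_mul, add_sub_cancel_right, ha_fixed, neg_zero]
    · rw [hself, AHL.deriv_reflectDrift]
      exact (h_nbhd _ ⟨by linarith [hx.2], by linarith [hx.1]⟩).1
  have hvar := AHL.tendsto_limitVar (h := h) ha_unstable
  set v₀ := 2 * AHL.slitSqLimit * h a * (1 / (2 * deriv (AHL.drift h) a)) with hv₀
  have hv₀pos : 0 < v₀ := by
    have := AHL.slitSqLimit_pos
    positivity
  have hvarN : Tendsto (fun t₀ => (AHL.limitVar h a t₀).toNNReal) atTop (𝓝 v₀.toNNReal) :=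
    (continuous_real_toNNReal.tendsto _).comp hvar
  have hv₀N : v₀.toNNReal ≠ 0 := (Real.toNNReal_pos.2 hv₀pos).ne'
  have hpos := hvar.eventually (lt_mem_nhds hv₀pos)
  have htr := AHL.tendsto_capThreshold (r := xp) hr.unstable
  have htl := AHL.tendsto_capThreshold (r := 2 * a - xm) hl.unstable
  refine ⟨⟨_, ?_, AHL.tendsto_gaussianReal_capped hvarN hv₀N htr htl⟩, fun ε hε => ?_⟩
  · filter_upwards [hpos, eventually_ge_atTop 0] with t₀ h1 h2
    exact AHL.tendsto_measureReal_capped_eq_exit h_smooth h_periodic h_nonneg h_mass hr hl hθ_meas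
      hθ_indep hθ_law h2 h1
  · obtain ⟨T, hT, hlt⟩ := AHL.exists_gaussianReal_deviation_lt hv₀N ha_unstable
      (AHL.ExpandingDrift.exitShift (AHL.drift h) a xp)
      (AHL.ExpandingDrift.exitShift (AHL.reflectDrift (AHL.drift h) a) a (2 * a - xm)) hε
    have := nullSingletonClass_gaussianReal (μ := 0) hv₀N
    refine ⟨T, hT, _, ?_, _, ?_, AHL.tendsto_gaussianReal_real hvarN
      (AHL.measure_frontier_logRegion
        (AHL.countable_frontier_centredLogs (AHL.drift h) a xp T)
        (AHL.countable_frontier_centredLogs (AHL.reflectDrift (AHL.drift h) a) a (2 * a - xm) T))⟩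
    · rw [AHL.centredLogs, AHL.centredLogs, hself]
      exact hlt
    · have hT8 : Tendsto (fun t₀ : ℝ => t₀ / 8) atTop atTop :=
        tendsto_id.atTop_div_const (by norm_num)
      filter_upwards [hpos, eventually_ge_atTop 0, hT8.eventually_ge_atTop _,
        hT8.eventually_ge_atTop _, htr.eventually_le_atBot _, htl.eventually_le_atBot _]
        with t₀ h1 h2 h3 h4 h5 h6
      exact AHL.tendsto_measureReal_deviation h_smooth h_periodic h_nonneg h_mass hr hl hθ_meas
        hθ_indep hθ_law h2 h1 h3 h4 h5 h6
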